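/- Throughout, $\Delta\ge 3$ and $D\ge 1$ are integers. **Strings.** $X_\Delta$ is the set of strings $x_jx_{j-1}\dots x_0$ ($j\ge 0$) with $x_0\in\{1,2\}$ and $x_i\in\{1,\dots,\Delta,*\}$ for $i\ge 1$; $x_i$ is the $i$-th symbol and $j+1$ the length of the string. $X_\Delta^-\subseteq X_\Delta$ consists of the strings without $*$. A string $x$ is a final substring of $y$ if $x$ is a suffix of $y$. **Construction trees.** Let $T$ be a finite rooted tree with root $r$, and let the layer $L_i$ ($i\ge1$) be the set of nodes at distance $i-1$ from $r$; only nonempty layers are considered. A node is a *reflect node* if it has exactly one child, and a *split node* otherwise; $V_R$ is the set of reflect nodes. Assume that every node has $0$, $1$ or $\Delta$ children and that nodes in the same layer have equally many children, so that each layer is a reflect layer or a split layer. Let $i_{\max}$ be the index of the last layer. $T$ is *well-nested* if it has as many split layers as reflect layers, $L_1$ is a reflect layer, $L_{i_{\max}}$ is a split layer, and there is a (necessarily unique) bijection $\varphi$ from the indices of reflect layers to those of split layers such that $\varphi(1)=i_{\max}$, $i<\varphi(i)$ for all $i$, and $\varphi(j)<\varphi(i)$ whenever $i<j<\varphi(i)$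 (with $i,j$ indices of reflect layers). If $L_k$ is the $j$-th reflect layer (counted from the root), then the nodes of $L_k$ have reflect index $j$ and the nodes of $L_{\varphi(k)}$ have split index $j$. A *$\Delta$-ary construction tree* is such a well-nested tree $T$ together with a labeling $\ell:V(T)\to X_\Delta$ such that: 1. $\ell(r)=1$; 2. each reflect node of reflect index $i$ has a label of length $i$; the labels of distinct reflect nodes are distinct and contain no $*$; 3. no label of a reflect node is a final substring of the label of another reflect node, and every string in $X_\Delta^-$ that is at least as long as all labels of reflect nodes has the label of some reflect node as a final substring; 4. the length of the label of a split node in $L_i$ is $1$ plus the number of reflect layers $L_j$ with $j<i$; 5. for a split node $v$ of split index $i$, whose ancestor of reflect index $i$ is $w$, the $i$-th symbol of $\ell(v)$ is $*$, this is the only $*$ in $\ell(v)$, and the symbols $0,\dots,i-1$ of $\ell(v)$ and $\ell(w)$ agree; 6. for a split node $v$ of split index $i$ with $\Delta$ children, there is a bijection $\rho$ from its children to $\{1,\dots,\Delta\}$ such that, for each child $w$, the $i$-th symbol of the label of every descendant of $w$ (including $w$) is $\rho(w)$. **Input tree.** Start with the graph $G^{(0)}$ consisting of two unmarked adjacent nodes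 labeled $1$ and $2$. List the nodes of $T$ as $v^{(1)},\dots,v^{(|V(T)|)}$ so that each node appears after all its proper ancestors. $G^{(i)}$ arises from $G^{(i-1)}$ as follows. Let $x$ be the node of $G^{(i-1)}$ with label $\ell(v^{(i)})$ (it exists and is unique). If $v^{(i)}$ is a split node, mark $x$. If $v^{(i)}$ is a reflect node, let $H_1$ be the connected component of $x$ in the subgraph induced by the unmarked nodes, add $\Delta-1$ copies $H_2,\dots,H_\Delta$ of $H_1$, identify $x$ with all its copies, prepend the symbol $i'$ to the label of each node $\ne x$ of $H_{i'}$ ($1\le i'\le\Delta$), and prepend $*$ to the label of $x$. Then $G_T:=G^{(|V(T)|)}$. The tree $T$ is *distance-$D$-correct* if, for every $i$ such that $v^{(i)}$ is a split node, with corresponding node $x$ of $G^{(i-1)}$, each leaf (node of degree $1$) of $G^{(i-1)}$ whose label has $0$-th symbol $2$ and which lies in the same component of unmarked nodes as $x$ has distance at least $D$ from $x$ in $G^{(i-1)}$. (Neither $G_T$ nor this property depends on the chosen listing.) **Model.** In the randomized online-LOCAL model with locality $L$, an oblivious adversary fixes an $n$-node graph with port numbers (each node $v$ numbers its incident edges $1,\dots,\deg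 v$) and an ordering (query sequence) of all its nodes. The nodes are presented in this order. When $v$ is presented, the algorithm, which knows $n$ and has unlimited randomness and memory, learns the $L$-hop neighborhood of $v$ with the degrees and port numbers of its nodes, including which of these nodes it has seen before; nodes have no identifiers. It then has to decide immediately, for each edge incident to $v$, on an orientation of this edge. It solves *sinkless orientation* correctly if the two endpoints of each edge decide on the same orientation and every node of degree at least $3$ has an outgoing edge. **Lemma.** Let $T$ be a distance-$D$-correct $\Delta$-ary construction tree with set $V_R$ of reflect nodes, and let $\mathcal A$ be an algorithm for sinkless orientation in the randomized online-LOCAL model with locality $D-1$. Then for every $n\ge\Delta\cdot|V(G_T)|$ there exist an $n$-node tree $\mathcal T$ (with port numbers) and a query sequence on which $\mathcal A$ produces an incorrect output with probability at least $1/\Delta^{|V_R|}$. -/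

import Mathlib

namespace SinklessLB

/-! ### Strings -/

/-- A symbol of a label: the special symbol `*`, or a number. -/
inductive Symbol : Type
  | star : Symbol
  | num : ℕ → Symbol

/-- A string `x_j … x_0`, written from left to right, so that prepending a symbol is `List.cons`
and `x` is a final substring of `y` iff `x <:+ y`. -/
abbrev Word : Type := List Symbol

/-- The `i`-th symbol of a string; indices start at `0` at the right-most symbol. -/
def symb (x : Word) (i : ℕ) : Option Symbol := x.reverse[i]?

/-- The set `X_b`: nonempty strings over `{1, …, b, *}` whose `0`-th symbol is `1` or `2`. -/
def words (b : ℕ) : Set Word :=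
  {x | (symb x 0 = some (.num 1) ∨ symb x 0 = some (.num 2)) ∧
    ∀ s ∈ x, s = .star ∨ ∃ k ∈ Set.Icc 1 b, s = .num k}

/-- The set `X_b⁻`: the strings in `X_b` without the symbol `*`. -/
def starFreeWords (b : ℕ) : Set Word := {x ∈ words b | Symbol.star ∉ x}

/-- No string of `Y` is a final substring of another one. -/
def Independent (Y : Set Word) : Prop := ∀ y ∈ Y, ∀ y' ∈ Y, y ≠ y' → ¬ y <:+ y'

/-- Every string in `X_b⁻` that is at least as long as every string of `Y` has a final
substring in `Y`. -/
def Clearing (b : ℕ) (Y : Set Word) : Prop :=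
  ∀ x ∈ starFreeWords b, (∀ y ∈ Y, y.length ≤ x.length) → ∃ y ∈ Y, y <:+ x

/-! ### Balanced and well-nested rooted trees

Rooted trees are Mathlib's `RootedTree`: `v ≤ w` says that `w` is a descendant of `v`, the root is
`⊥`, and the children of `v` are the nodes covering `v`. -/

/-- The number of children of a node. -/
noncomputable def numChildren {T : RootedTree} (v : T) : ℕ := {w : T | v ⋖ w}.ncard

/-- The layer index of a node: `1` plus its distance from the root. -/
noncomputable def layerIndex {T : RootedTree} (v : T) : ℕ := {u : T | u ≤ v}.ncard

/-- `b`-balanced rooted trees. -/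
def IsBalanced (b : ℕ) (T : RootedTree) : Prop :=
  (∀ v : T, numChildren v = 0 ∨ numChildren v = 1 ∨ numChildren v = b) ∧
    ∀ v w : T, layerIndex v = layerIndex w → numChildren v = numChildren w

/-- A reflect node has precisely one child; all other nodes are split nodes. -/
def IsReflect {T : RootedTree} (v : T) : Prop := numChildren v = 1

/-- The set `V_R` of reflect nodes. -/
def reflectNodes (T : RootedTree) : Set T := {v | IsReflect v}

/-- The indices of the (nonempty) reflect layers. -/
def reflectLayers (T : RootedTree) : Set ℕ :=
  {i | (∃ v : T, layerIndex v = i) ∧ ∀ v : T, layerIndex v = i → IsReflect v}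

/-- The indices of the (nonempty) split layers. -/
def splitLayers (T : RootedTree) : Set ℕ :=
  {i | (∃ v : T, layerIndex v = i) ∧ ∀ v : T, layerIndex v = i → ¬ IsReflect v}

/-- The index `i_max` of the last layer. -/
noncomputable def lastLayer (T : RootedTree) : ℕ := sSup (Set.range (layerIndex (T := T)))

/-- `φ` is a bijection from reflect layers to split layers that witnesses that `T` is
well-nested. (Such a `φ` is unique on the reflect layers.) -/
structure IsNesting (T : RootedTree) (φ : ℕ → ℕ) : Prop where
  card_eq : (splitLayers T).ncard = (reflectLayers T).ncard
  one_mem : 1 ∈ reflectLayers T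
  last_mem : lastLayer T ∈ splitLayers T
  bijOn : Set.BijOn φ (reflectLayers T) (splitLayers T)
  map_one : φ 1 = lastLayer T
  lt_map : ∀ i ∈ reflectLayers T, i < φ i
  nested : ∀ i ∈ reflectLayers T, ∀ j ∈ reflectLayers T, i < j → j < φ i → φ j < φ i

/-- The reflect index of the reflect layer with layer index `k`: its rank among all reflect
layers, counted from `1`. The split layer with layer index `φ k` has, as its split index, the same
number. -/
noncomputable def reflectIndex (T : RootedTree) (k : ℕ) : ℕ := {j ∈ reflectLayers T | j ≤ k}.ncard

/-! ### Construction trees -/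

/-- The labeling `ℓ` is solid, with respect to the nesting bijection `φ`. -/
structure IsSolid (b : ℕ) (T : RootedTree) (φ : ℕ → ℕ) (ℓ : T → Word) : Prop where
  mem_words : ∀ v, ℓ v ∈ words b
  root : ℓ ⊥ = [.num 1]
  reflect_length : ∀ v, IsReflect v → (ℓ v).length = reflectIndex T (layerIndex v)
  reflect_injOn : Set.InjOn ℓ (reflectNodes T)
  reflect_starFree : ∀ v, IsReflect v → ℓ v ∈ starFreeWords b
  independent : Independent (ℓ '' reflectNodes T)
  clearing : Clearing b (ℓ '' reflectNodes T)
  split_length : ∀ v, ¬ IsReflect v →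
    (ℓ v).length = {j ∈ reflectLayers T | j < layerIndex v}.ncard + 1
  /-- `w` is the ancestor of the split node `v` in the reflect layer matched with the layer
  of `v`. -/
  split_star : ∀ v w, ¬ IsReflect v → w ≤ v → layerIndex w ∈ reflectLayers T →
    φ (layerIndex w) = layerIndex v →
      symb (ℓ v) (reflectIndex T (layerIndex w)) = some .star ∧
        ∀ i < reflectIndex T (layerIndex w), symb (ℓ v) i = symb (ℓ w) i
  split_star_unique : ∀ v, ¬ IsReflect v → ∃! i, symb (ℓ v) i = some .star
  /-- `v` is an internal split node, and `reflectIndex T k` is its split index. -/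
  split_children : ∀ v, numChildren v = b → ∀ k ∈ reflectLayers T, φ k = layerIndex v →
    ∃ ρ : T → ℕ, Set.BijOn ρ {w | v ⋖ w} (Set.Icc 1 b) ∧
      ∀ w, v ⋖ w → ∀ u, w ≤ u → symb (ℓ u) (reflectIndex T k) = some (.num (ρ w))

/-- `(T, ℓ)` is a `b`-ary construction tree: `T` is a well-nested `b`-balanced rooted tree, and
`ℓ` is a solid labeling of `T`. -/
def IsConstructionTree (b : ℕ) (T : RootedTree) (ℓ : T → Word) : Prop :=
  3 ≤ b ∧ Finite T ∧ IsBalanced b T ∧ ∃ φ : ℕ → ℕ, IsNesting T φ ∧ IsSolid b T φ ℓ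

/-! ### Marked graphs, reflections and splits

Port numbers are left out here: neither the number of nodes of the input tree nor any distance
depends on them. All marked graphs that arise from a construction tree are trees. -/

/-- A finite graph with node labels and a set of marked nodes. -/
structure MarkedGraph : Type 1 where
  V : Type
  finite : Finite V
  graph : SimpleGraph V
  label : V → Word
  marked : Set V

namespace MarkedGraph

/-- The subgraph formed by the edges between unmarked nodes. -/
def unmarkedGraph (G : MarkedGraph) : SimpleGraph G.V where
  Adj x y := G.graph.Adj x y ∧ x ∉ G.marked ∧ y ∉ G.marked
  symm := ⟨fun _ _ h => ⟨h.1.symm, h.2.2, h.2.1⟩⟩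
  loopless := ⟨fun _ h => h.1.ne rfl⟩

/-- The maximal connected component of unmarked nodes that contains the unmarked node `v`. -/
def component (G : MarkedGraph) (v : G.V) : Set G.V := {w | G.unmarkedGraph.Reachable v w}

/-- The nodes of the graph obtained by reflection at `v`: `(1, w)` is the node `w` of `G` itself,
and `(i, w)`, for `2 ≤ i ≤ Δ`, is the `i`-copy of a node `w ≠ v` in the component of `v`. -/
def ReflectNode (Δ : ℕ) (G : MarkedGraph) (v : G.V) : Type :=
  {p : ℕ × G.V // p.1 = 1 ∨ (2 ≤ p.1 ∧ p.1 ≤ Δ ∧ p.2 ∈ G.component v ∧ p.2 ≠ v)}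

theorem finite_reflectNode (Δ : ℕ) (G : MarkedGraph) (v : G.V) : Finite (ReflectNode Δ G v) := by
  have := G.finite
  refine Set.Finite.to_subtype (Set.Finite.subset
    ((Set.finite_Iic (Δ + 1)).prod (Set.finite_univ (α := G.V))) ?_)
  rintro ⟨i, w⟩ h
  refine ⟨?_, trivial⟩
  rcases h with h | h
  · have h1 : i = 1 := h
    simp [h1]
  · have h2 : i ≤ Δ := h.2.1
    simp only [Set.mem_Iic]
    omega

open Classical in
/-- Reflection of `G` at `v`. -/
noncomputable def reflect (Δ : ℕ) (G : MarkedGraph) (v : G.V) : MarkedGraph where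
  V := ReflectNode Δ G v
  finite := finite_reflectNode Δ G v
  graph :=
    { Adj := fun p q => G.graph.Adj p.1.2 q.1.2 ∧ (p.1.1 = q.1.1 ∨ p.1.2 = v ∨ q.1.2 = v)
      symm := ⟨fun _ _ h => ⟨h.1.symm, h.2.elim (fun e => Or.inl e.symm) fun e => Or.inr e.symm⟩⟩
      loopless := ⟨fun _ h => h.1.ne rfl⟩ }
  label := fun p =>
    if p.1.2 = v then .star :: G.label v
    else if p.1.2 ∈ G.component v then .num p.1.1 :: G.label p.1.2
    else G.label p.1.2
  marked := {p | p.1.2 ∈ G.marked}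

/-- Split of `G` at `v`. -/
def split (G : MarkedGraph) (v : G.V) : MarkedGraph where
  V := G.V
  finite := G.finite
  graph := G.graph
  label := G.label
  marked := insert v G.marked

/-- The initial graph: one edge, with endpoints labeled `1` and `2`, both unmarked. -/
def initial : MarkedGraph where
  V := Fin 2
  finite := inferInstance
  graph := ⊤
  label := ![[.num 1], [.num 2]]
  marked := ∅

/-- `2`-leaves: nodes of degree `1` whose label has `0`-th symbol `2`. -/
def IsTwoLeaf (G : MarkedGraph) (v : G.V) : Prop :=
  (G.graph.neighborSet v).ncard = 1 ∧ symb (G.label v) 0 = some (.num 2)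

open Classical in
/-- Process the node `t` of the construction tree: reflect or split at the node of `G` that has
the same label as `t`. (Such a node exists and is unique whenever this is used.) -/
noncomputable def process (Δ : ℕ) {T : RootedTree} (ℓ : T → Word) (G : MarkedGraph) (t : T) :
    MarkedGraph :=
  if h : ∃ x : G.V, G.label x = ℓ t then
    if IsReflect t then G.reflect Δ h.choose else G.split h.choose
  else G

end MarkedGraph

/-- An ordering of all nodes of `T` in which a node appears only after all its ancestors. -/
def IsProcessingOrder {T : RootedTree} (o : List T) : Prop :=
  o.Nodup ∧ (∀ t, t ∈ o) ∧ o.Pairwise fun s t => ¬ t < s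

/-- The marked graph obtained from the initial one by processing the listed nodes one by one. -/
noncomputable def graphAfter (Δ : ℕ) {T : RootedTree} (ℓ : T → Word) (o : List T) : MarkedGraph :=
  o.foldl (MarkedGraph.process Δ ℓ) MarkedGraph.initial

/-- The input tree `G_T`, computed along the ordering `o` of the nodes of `T`. -/
noncomputable def inputTree (Δ : ℕ) {T : RootedTree} (ℓ : T → Word) (o : List T) : MarkedGraph :=
  graphAfter Δ ℓ o

/-- Distance-`D`-correctness, along the ordering `o` of the nodes of `T`: if `o[i]` is a split
node, then, in the graph `G` right before `o[i]` is processed, every `2`-leaf in the component (of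
unmarked nodes) of the node labeled `ℓ o[i]` has distance at least `D` from that node. -/
def IsDistanceCorrect (Δ : ℕ) {T : RootedTree} (ℓ : T → Word) (o : List T) (D : ℕ) : Prop :=
  ∀ (i : ℕ) (hi : i < o.length), ¬ IsReflect o[i] →
    ∀ x y : (graphAfter Δ ℓ (o.take i)).V,
      (graphAfter Δ ℓ (o.take i)).label x = ℓ o[i] →
      (graphAfter Δ ℓ (o.take i)).IsTwoLeaf y →
      y ∈ (graphAfter Δ ℓ (o.take i)).component x →
        D ≤ (graphAfter Δ ℓ (o.take i)).graph.dist x y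

/-! ### The randomized online-LOCAL model -/

/-- An `n`-node graph with port numbers: the node `v` assigns the port numbers `1, …, deg v` to its
incident edges, and `port v u` is the number that `v` assigns to the edge `{v, u}`. -/
structure PortGraph (n : ℕ) where
  graph : SimpleGraph (Fin n)
  port : Fin n → Fin n → ℕ
  port_bijOn : ∀ v, Set.BijOn (port v) (graph.neighborSet v)
    (Set.Icc 1 (graph.neighborSet v).ncard)

namespace PortGraph

variable {n : ℕ}

/-- The degree of a node. -/
noncomputable def deg (G : PortGraph n) (v : Fin n) : ℕ := (G.graph.neighborSet v).ncard

/-- With locality `L`, the node `v` has been seen after the nodes in `s` have been presented. -/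
def SeenNode (G : PortGraph n) (L : ℕ) (s : List (Fin n)) (v : Fin n) : Prop :=
  ∃ w ∈ s, G.graph.edist w v ≤ L

/-- With locality `L`, the edge `{u, v}` has been seen after the nodes in `s` have been
presented. -/
def SeenEdge (G : PortGraph n) (L : ℕ) (s : List (Fin n)) (u v : Fin n) : Prop :=
  G.graph.Adj u v ∧ ∃ w ∈ s, G.graph.edist w u ≤ L ∧ G.graph.edist w v ≤ L

/-- Presenting the nodes in `s`, one after another, on `G` reveals, with locality `L`, exactly the
same information as presenting the nodes in `s'` on `G'`: up to renaming nodes, the sequences of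
presented nodes, the seen nodes, their degrees, the seen edges and the port numbers at both ends of
seen edges coincide. (As nodes carry no identifiers, only the information up to renaming is
available to an algorithm. The nodes that have not been seen are renamed arbitrarily.) -/
def SameInformation (L : ℕ) (G : PortGraph n) (s : List (Fin n))
    (G' : PortGraph n) (s' : List (Fin n)) : Prop :=
  ∃ f : Equiv.Perm (Fin n), s' = s.map f ∧
    (∀ v, G.SeenNode L s v ↔ G'.SeenNode L s' (f v)) ∧
    (∀ v, G.SeenNode L s v → G.deg v = G'.deg (f v)) ∧
    (∀ u v, G.SeenEdge L s u v ↔ G'.SeenEdge L s' (f u) (f v)) ∧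
    (∀ u v, G.SeenEdge L s u v → G.port u v = G'.port (f u) (f v))

/-- `O v u` says that `v` declares its edge to `u` to be oriented away from `v`. The output `O` is a
sinkless orientation if adjacent nodes agree on the orientation of the edge between them, and every
node of degree at least `3` has an outgoing edge. -/
def IsSinklessOrientation (G : PortGraph n) (O : Fin n → Fin n → Prop) : Prop :=
  (∀ u v, G.graph.Adj u v → (O u v ↔ ¬ O v u)) ∧
    ∀ v, 3 ≤ G.deg v → ∃ u, G.graph.Adj v u ∧ O v u

end PortGraph

/-- A deterministic online-LOCAL algorithm with locality `L` that orients edges. When the nodes in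
the list `s` have been presented in this order on the `n`-node graph `G`, then `out n G s` is the
set of ports whose edges the algorithm orients away from the last presented node. This decision is
a function of `n` and of the information revealed so far. -/
structure OnlineLocalAlgorithm (L : ℕ) where
  out : (n : ℕ) → PortGraph n → List (Fin n) → Set ℕ
  online_local : ∀ (n : ℕ) (G G' : PortGraph n) (s s' : List (Fin n)),
    G.SameInformation L s G' s' → out n G s = out n G' s'

/-- The global output of an algorithm on the query sequence `σ`: each node `v` decides on the
orientation of its incident edges at the moment at which it is presented. -/
def OnlineLocalAlgorithm.output {L : ℕ} (A : OnlineLocalAlgorithm L) {n : ℕ} (G : PortGraph n)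
    (σ : List (Fin n)) (v u : Fin n) : Prop :=
  G.port v u ∈ A.out n G (σ.take (σ.idxOf v + 1))

/-- A randomized online-LOCAL algorithm with locality `L` that orients edges, and draws its random
bits from the sample space `Ω`. -/
structure RandomizedOnlineLocalAlgorithm (Ω : Type*) [MeasurableSpace Ω] (L : ℕ) where
  algo : Ω → OnlineLocalAlgorithm L
  measurable_out : ∀ (n : ℕ) (G : PortGraph n) (s : List (Fin n)) (p : ℕ),
    MeasurableSet {ω | p ∈ (algo ω).out n G s}

end SinklessLB

open SinklessLB

/-! The adversary does not play on `G_T` itself, but on a family of trees over one common vertex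
set, one tree for every choice `c` of a number in {1, …, Δ} at each reflect node. The main vertices
are the split nodes of `T`: the childless ones ("leaves", labels ending in 1) and the internal ones
(labels ending in 2). A leaf `u` below an internal `v` is a potential neighbor of `v` (`Cand`) if
from position 2 up to the length of `ℓ v` the labels agree outside the star of `ℓ v`. It is an
actual neighbor (`Link`) if, in addition, its label spells the choices `c w` at the reflect nodes
`w` between `v` and `u`. Independence and clearing give each leaf exactly one potential neighbor per
number (`existsUnique_cand`); each internal node has exactly one actual neighbor per direction
(`existsUnique_link`). Potential neighbors that are not actual ones are replaced by filler vertices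
(slots) using the same port, so every main vertex always has degree Δ, and its port numbers do not
depend on `c`.

For each reflect node `w` there is a pivot: the split node matched with `w` that is found by
following the choices at proper descendants of `w`. The pivots are queried with descendants before
ancestors. To leave the part of the instance that lies below `w`, one has to pass a leaf with a
potential neighbor above `w`, and such leaves are at distance at least D - 1 from the pivot
(`far_of_isDistanceCorrect`). With locality D - 1, the answer at the pivot of `w` therefore depends
only on choices strictly below `w` and at reflect nodes treated earlier (`inst_sameInformation`),
and `c w` can be set afterwards to the port of an edge that the pivot orients outwards.

Once all choices are made, descend from the root, taking at each internal split node `v` the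
direction `c (mate v)`. All potential neighbors of the leaf reached are actual neighbors, all are
pivots, and each orients its edge towards this leaf, which becomes a sink (`exists_sink`,
`exists_failure`). So every deterministic algorithm fails on one of the Δ ^ |V_R| instances. These,
with their query sequences, are fixed without reference to the algorithm, and a union bound over
them gives the probability.

The distance bound comes from a description of the intermediate graphs (`Describes`): their unmarked
components correspond to the unprocessed nodes `t` whose proper ancestors are all processed, the
labels in such a component are the strings in `Slab t`, and adjacency is `WAdj`. Cutting the labels
of split nodes below `v` to length `rk v + 1` maps links to edges of the graph present just before
`v` is processed, and maps pivots to 2-leaves. The same description embeds the split nodes into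
`G_T`, which together with a count of the slots shows that an instance fits into `n` vertices. -/

namespace SinklessLB

/-! ### Rooted trees: ancestors, children and layers -/

section Order

variable {T : RootedTree} {s t u v w : T}

theorem ancestors_total (hu : u ≤ t) (hv : v ≤ t) : u ≤ v ∨ v ≤ u :=
  le_total_of_directed hv hu

theorem ancestors_lt_trichotomy (hu : u ≤ t) (hv : v ≤ t) : u < v ∨ u = v ∨ v < u := by
  rcases ancestors_total hu hv with h | h
  · rcases h.lt_or_eq with h | h
    · exact .inl h
    · exact .inr (.inl h)
  · rcases h.lt_or_eq with h | h
    · exact .inr (.inr h)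
    · exact .inr (.inl h.symm)

theorem exists_child_le [Finite T] (h : s < t) : ∃ c, s ⋖ c ∧ c ≤ t :=
  exists_covBy_le_of_lt h

theorem le_of_lt_child (hs : s ⋖ u) (h : v < u) : v ≤ s := by
  rcases ancestors_lt_trichotomy h.le hs.1.le with h' | h' | h'
  · exact h'.le
  · exact h'.le
  · exact absurd h (hs.2 h')

theorem lt_child_iff (hs : s ⋖ u) : v < u ↔ v ≤ s :=
  ⟨le_of_lt_child hs, fun h => h.trans_lt hs.1⟩

theorem exists_parent [Finite T] (h : t ≠ ⊥) : ∃ s, s ⋖ t :=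
  ⟨Order.pred t, Order.pred_covBy_of_not_isMin (fun hm => h hm.eq_bot)⟩

theorem layerIndex_child [Finite T] (h : s ⋖ t) : layerIndex t = layerIndex s + 1 := by
  have : {u : T | u ≤ t} = insert t {u : T | u ≤ s} := by
    ext x
    simp only [Set.mem_ofPred_eq, Set.mem_insert_iff, le_iff_eq_or_lt (b := t), lt_child_iff h]
  rw [layerIndex, this, Set.ncard_insert_of_notMem (by simpa using h.1.not_ge) (Set.toFinite _)]
  rfl

theorem layerIndex_bot : layerIndex (⊥ : T) = 1 := by
  have : {u : T | u ≤ ⊥} = {⊥} := by ext; simp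
  rw [layerIndex, this, Set.ncard_singleton]

theorem layerIndex_lt [Finite T] (h : s < t) : layerIndex s < layerIndex t :=
  Set.ncard_lt_ncard ⟨fun _ hx => le_trans hx h.le, fun hx => h.not_ge (hx (le_refl t))⟩
    (Set.toFinite _)

theorem layerIndex_inj [Finite T] (hu : u ≤ t) (hv : v ≤ t) (h : layerIndex u = layerIndex v) :
    u = v := by
  rcases ancestors_lt_trichotomy hu hv with h' | h' | h'
  · exact absurd h (layerIndex_lt h').ne
  · exact h'
  · exact absurd h (layerIndex_lt h').ne'

theorem lt_of_layerIndex_lt [Finite T] (hu : u ≤ t) (hv : v ≤ t)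
    (h : layerIndex u < layerIndex v) : u < v := by
  rcases ancestors_lt_trichotomy hu hv with h' | h' | h'
  · exact h'
  · exact absurd h (by simp [h'])
  · exact absurd h (layerIndex_lt h').not_gt

theorem one_le_layerIndex [Finite T] (t : T) : 1 ≤ layerIndex t := by
  rcases eq_or_ne t ⊥ with rfl | h
  · exact layerIndex_bot.ge
  · exact layerIndex_bot.ge.trans (layerIndex_lt (bot_lt_iff_ne_bot.2 h)).le

theorem tree_induction [Finite T] {p : T → Prop} (bot : p ⊥)
    (child : ∀ s t, s ⋖ t → p s → p t) (t : T) : p t := by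
  induction t using (wellFounded_lt (α := T)).induction with
  | _ t ih =>
    rcases eq_or_ne t ⊥ with rfl | h
    · exact bot
    · obtain ⟨s, hs⟩ := exists_parent h
      exact child s t hs (ih s hs.1)

theorem exists_ancestor_layerIndex [Finite T] (t : T) {i : ℕ} (h1 : 1 ≤ i)
    (h2 : i ≤ layerIndex t) : ∃ u ≤ t, layerIndex u = i := by
  induction t using tree_induction with
  | bot => exact ⟨⊥, le_rfl, by rw [layerIndex_bot] at *; omega⟩
  | child s t hs ih =>
    rcases h2.eq_or_lt with h | h
    · exact ⟨t, le_rfl, h.symm⟩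
    · rw [layerIndex_child hs] at h
      obtain ⟨u, hu, hi⟩ := ih (by omega)
      exact ⟨u, hu.trans hs.1.le, hi⟩

/-- The number of reflect nodes among the proper ancestors of a node. -/
noncomputable def rk (t : T) : ℕ := {w : T | IsReflect w ∧ w < t}.ncard

theorem rk_bot : rk (⊥ : T) = 0 := by simp [rk]

theorem rk_child_reflect [Finite T] (h : s ⋖ t) (hs : IsReflect s) : rk t = rk s + 1 := by
  have : {w : T | IsReflect w ∧ w < t} = insert s {w : T | IsReflect w ∧ w < s} := by
    ext x
    simp only [Set.mem_ofPred_eq, Set.mem_insert_iff, lt_child_iff h, le_iff_eq_or_lt]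
    constructor
    · rintro ⟨h1, h2 | h2⟩
      · exact .inl h2
      · exact .inr ⟨h1, h2⟩
    · rintro (rfl | ⟨h1, h2⟩)
      · exact ⟨hs, .inl rfl⟩
      · exact ⟨h1, .inr h2⟩
  rw [rk, this, Set.ncard_insert_of_notMem (by simp) (Set.toFinite _)]
  rfl

theorem rk_child_split [Finite T] (h : s ⋖ t) (hs : ¬ IsReflect s) : rk t = rk s := by
  have : {w : T | IsReflect w ∧ w < t} = {w : T | IsReflect w ∧ w < s} := by
    ext x
    simp only [Set.mem_ofPred_eq, lt_child_iff h, le_iff_eq_or_lt]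
    constructor
    · rintro ⟨h1, rfl | h2⟩
      · exact absurd h1 hs
      · exact ⟨h1, h2⟩
    · rintro ⟨h1, h2⟩
      exact ⟨h1, .inr h2⟩
  rw [rk, this]
  rfl

theorem rk_mono [Finite T] (h : s ≤ t) : rk s ≤ rk t :=
  Set.ncard_le_ncard (fun _ hx => ⟨hx.1, hx.2.trans_le h⟩) (Set.toFinite _)

theorem rk_lt [Finite T] (hs : IsReflect s) (h : s < t) : rk s < rk t :=
  Set.ncard_lt_ncard ⟨fun _ hx => ⟨hx.1, hx.2.trans h⟩,
    fun hx => lt_irrefl s (hx (show s ∈ _ from ⟨hs, h⟩)).2⟩ (Set.toFinite _)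

theorem rk_inj [Finite T] (hs : IsReflect s) (ht : IsReflect t) (h1 : s ≤ u) (h2 : t ≤ u)
    (h : rk s = rk t) : s = t := by
  rcases ancestors_lt_trichotomy h1 h2 with h' | h' | h'
  · exact absurd h (rk_lt hs h').ne
  · exact h'
  · exact absurd h (rk_lt ht h').ne'

theorem lt_of_rk_lt [Finite T] (h1 : s ≤ u) (h2 : t ≤ u) (h : rk s < rk t) : s < t := by
  rcases ancestors_lt_trichotomy h1 h2 with h' | h' | h'
  · exact h'
  · exact absurd h (by simp [h'])
  · exact absurd h (rk_mono h'.le).not_gt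

theorem exists_reflect_rk [Finite T] (t : T) {i : ℕ} (h : i < rk t) :
    ∃ w < t, IsReflect w ∧ rk w = i := by
  induction t using tree_induction with
  | bot => simp [rk_bot] at h
  | child s t hs ih =>
    by_cases hr : IsReflect s
    · rw [rk_child_reflect hs hr] at h
      rcases (Nat.lt_succ_iff.1 h).eq_or_lt with h | h
      · exact ⟨s, hs.1, hr, h.symm⟩
      · obtain ⟨w, hw, h'⟩ := ih h
        exact ⟨w, hw.trans hs.1, h'⟩
    · rw [rk_child_split hs hr] at h
      obtain ⟨w, hw, h'⟩ := ih h
      exact ⟨w, hw.trans hs.1, h'⟩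

end Order

/-! ### Strings -/

theorem symb_cons (s : Symbol) (x : Word) (i : ℕ) :
    symb (s :: x) i = if i < x.length then symb x i else if i = x.length then some s else none := by
  unfold symb
  rw [List.reverse_cons, List.getElem?_append]
  simp only [List.length_reverse]
  split_ifs with h1 h2
  · rfl
  · simp [h2]
  · rw [List.getElem?_eq_none]
    simp
    omega

theorem symb_cons_of_lt {s : Symbol} {x : Word} {i : ℕ} (h : i < x.length) :
    symb (s :: x) i = symb x i := by simp [symb_cons, h]

theorem symb_cons_length (s : Symbol) (x : Word) : symb (s :: x) x.length = some s := by
  simp [symb_cons]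

theorem symb_eq_none {x : Word} {i : ℕ} (h : x.length ≤ i) : symb x i = none := by
  simp [symb, h]

theorem lt_length_of_symb {x : Word} {i : ℕ} {s : Symbol} (h : symb x i = some s) :
    i < x.length := by
  by_contra h'
  rw [symb_eq_none (not_lt.1 h')] at h
  cases h

theorem exists_symb {x : Word} {i : ℕ} (h : i < x.length) : ∃ s, symb x i = some s :=
  ⟨_, by rw [symb, List.getElem?_eq_getElem (by simpa using h)]⟩

theorem mem_iff_symb {x : Word} {s : Symbol} : s ∈ x ↔ ∃ i, symb x i = some s := by
  rw [← List.mem_reverse, List.mem_iff_getElem?]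
  rfl

theorem word_ext {x y : Word} (h : ∀ i, symb x i = symb y i) : x = y :=
  List.reverse_injective (List.ext_getElem? h)

theorem word_ext_of_length {x y : Word} (hl : x.length = y.length)
    (h : ∀ i < x.length, symb x i = symb y i) : x = y := by
  refine word_ext fun i => ?_
  by_cases hi : i < x.length
  · exact h i hi
  · rw [symb_eq_none (not_lt.1 hi), symb_eq_none (hl ▸ not_lt.1 hi)]

theorem suffix_iff_symb {x y : Word} :
    x <:+ y ↔ ∀ i < x.length, symb x i = symb y i := by
  rw [← List.reverse_prefix, List.prefix_iff_getElem?]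
  simp only [List.length_reverse]
  constructor
  · intro h i hi
    rw [symb, symb, h i hi, List.getElem?_eq_getElem]
  · intro h i hi
    have := h i hi
    rw [symb, symb, List.getElem?_eq_getElem (by simpa using hi)] at this
    rw [← this]

/-- The string of length `n` with the given symbols. -/
def wordOf (n : ℕ) (f : ℕ → Symbol) : Word := ((List.range n).map f).reverse

theorem length_wordOf (n : ℕ) (f : ℕ → Symbol) : (wordOf n f).length = n := by simp [wordOf]

theorem symb_wordOf {n : ℕ} {f : ℕ → Symbol} {i : ℕ} (h : i < n) :
    symb (wordOf n f) i = some (f i) := by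
  simp [symb, wordOf, h]

/-- The `i`-th symbol as an element of `Symbol`, with a default value past the end. -/
def symbD (x : Word) (i : ℕ) : Symbol := (symb x i).getD .star

theorem symbD_spec {x : Word} {i : ℕ} (h : i < x.length) : symb x i = some (symbD x i) := by
  obtain ⟨s, hs⟩ := exists_symb h
  simp [symbD, hs]

/-- `o` is a number between `1` and `b`. -/
def IsNum (b : ℕ) (o : Option Symbol) : Prop := ∃ k ∈ Set.Icc 1 b, o = some (.num k)

theorem IsNum.ne_star {b : ℕ} {o : Option Symbol} (h : IsNum b o) : o ≠ some .star := by
  obtain ⟨k, _, rfl⟩ := h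
  simp

theorem mem_words_symb {b : ℕ} {x : Word} (hx : x ∈ words b) {i : ℕ} (hi : i < x.length) :
    symb x i = some .star ∨ IsNum b (symb x i) := by
  obtain ⟨s, hs⟩ := exists_symb hi
  rcases hx.2 s (mem_iff_symb.2 ⟨i, hs⟩) with rfl | ⟨k, hk, rfl⟩
  · exact .inl hs
  · exact .inr ⟨k, hk, hs⟩

/-! ### The combinatorial data of a construction tree -/

/-- The properties of a construction tree that are used below. For a split node `v`,
`mate v` is its ancestor in the reflect layer matched with the layer of `v`. -/
structure Layout (b : ℕ) (T : RootedTree) (ℓ : T → Word) (mate : T → T) : Prop where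
  finite : Finite T
  three_le : 3 ≤ b
  children_cases : ∀ v : T, ¬ IsReflect v → numChildren v = 0 ∨ numChildren v = b
  root_reflect : IsReflect (⊥ : T)
  mate_reflect : ∀ v, ¬ IsReflect v → IsReflect (mate v)
  mate_lt : ∀ v, ¬ IsReflect v → mate v < v
  mate_ne : ∀ v v', ¬ IsReflect v → ¬ IsReflect v' → v' < v → mate v' ≠ mate v
  closes : ∀ v w, ¬ IsReflect v → IsReflect w → mate v < w → w < v →
    ∃ v', ¬ IsReflect v' ∧ mate v' = w ∧ w < v' ∧ v' < v
  mate_eq_bot : ∀ v, ¬ IsReflect v → (mate v = ⊥ ↔ numChildren v = 0)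
  matched : ∀ u w : T, numChildren u = 0 → IsReflect w → w < u →
    ∃ v, ¬ IsReflect v ∧ mate v = w ∧ w < v ∧ v ≤ u
  rk_le : ∀ u t : T, numChildren u = 0 → rk t ≤ rk u
  length : ∀ t, (ℓ t).length = rk t + 1
  mem_words : ∀ t, ℓ t ∈ words b
  root : ℓ ⊥ = [.num 1]
  starFree : ∀ v, IsReflect v → Symbol.star ∉ ℓ v
  independent : ∀ v w, IsReflect v → IsReflect w → v ≠ w → ¬ ℓ v <:+ ℓ w
  clearing : Clearing b (ℓ '' reflectNodes T)
  symb_mate : ∀ v, ¬ IsReflect v → symb (ℓ v) (rk (mate v) + 1) = some .star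
  symb_below_mate : ∀ v, ¬ IsReflect v → ∀ i < rk (mate v) + 1,
    symb (ℓ v) i = symb (ℓ (mate v)) i
  star_unique : ∀ v, ¬ IsReflect v → ∀ i, symb (ℓ v) i = some .star → i = rk (mate v) + 1
  children : ∀ v, numChildren v = b → ∃ ρ : T → ℕ, Set.BijOn ρ {w | v ⋖ w} (Set.Icc 1 b) ∧
      ∀ w, v ⋖ w → ∀ u, w ≤ u → symb (ℓ u) (rk (mate v) + 1) = some (.num (ρ w))

section Construction

variable {b : ℕ} {T : RootedTree}

theorem layerIndex_mem_reflectLayers (hb : IsBalanced b T) {v : T} (hv : IsReflect v) :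
    layerIndex v ∈ reflectLayers T :=
  ⟨⟨v, rfl⟩, fun w hw => (hb.2 w v hw).trans hv⟩

theorem layerIndex_mem_splitLayers (hb : IsBalanced b T) {v : T} (hv : ¬ IsReflect v) :
    layerIndex v ∈ splitLayers T :=
  ⟨⟨v, rfl⟩, fun w hw h => hv ((hb.2 w v hw).symm.trans h)⟩

theorem isReflect_of_layer {v : T} {i : ℕ} (hi : i ∈ reflectLayers T) (hv : layerIndex v = i) :
    IsReflect v := hi.2 v hv

theorem not_isReflect_of_layer {v : T} {i : ℕ} (hi : i ∈ splitLayers T)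
    (hv : layerIndex v = i) : ¬ IsReflect v := hi.2 v hv

/-- The ancestors of `t` meet every earlier layer exactly once, and balance makes a layer a reflect
layer as soon as one of its nodes is a reflect node. So counting layers is counting along a branch.
-/
theorem ncard_reflectLayers_lt [Finite T] (hb : IsBalanced b T) (t : T) :
    {j ∈ reflectLayers T | j < layerIndex t}.ncard = rk t := by
  have : {j ∈ reflectLayers T | j < layerIndex t} =
      layerIndex '' {w : T | IsReflect w ∧ w < t} := by
    ext j
    constructor
    · rintro ⟨h1, h2⟩
      obtain ⟨w, hw⟩ := h1.1
      obtain ⟨u, hu, hi⟩ := exists_ancestor_layerIndex t (hw ▸ one_le_layerIndex w) h2.le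
      exact ⟨u, ⟨isReflect_of_layer h1 hi, lt_of_layerIndex_lt hu le_rfl (hi ▸ h2)⟩, hi⟩
    · rintro ⟨w, ⟨h1, h2⟩, rfl⟩
      exact ⟨layerIndex_mem_reflectLayers hb h1, layerIndex_lt h2⟩
  rw [this, Set.InjOn.ncard_image]
  · rfl
  · exact fun x hx y hy h => layerIndex_inj hx.2.le hy.2.le h

/-- This is the source of the positions `rk w + 1`: reflect indices start at 1, whereas `rk` counts
proper ancestors only. -/
theorem reflectIndex_layerIndex [Finite T] (hb : IsBalanced b T) {w : T} (hw : IsReflect w) :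
    reflectIndex T (layerIndex w) = rk w + 1 := by
  have : {j ∈ reflectLayers T | j ≤ layerIndex w} =
      insert (layerIndex w) {j ∈ reflectLayers T | j < layerIndex w} := by
    ext j
    simp only [Set.mem_ofPred_eq, Set.mem_insert_iff, le_iff_eq_or_lt]
    constructor
    · rintro ⟨h1, h2 | h2⟩
      · exact .inl h2
      · exact .inr ⟨h1, h2⟩
    · rintro (rfl | ⟨h1, h2⟩)
      · exact ⟨layerIndex_mem_reflectLayers hb hw, .inl rfl⟩
      · exact ⟨h1, .inr h2⟩
  rw [reflectIndex, this, Set.ncard_insert_of_notMem (by simp)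
    ((Set.finite_Iio (layerIndex w)).subset fun _ h => h.2), ncard_reflectLayers_lt hb]

theorem layerIndex_le_lastLayer [Finite T] (t : T) : layerIndex t ≤ lastLayer T :=
  le_csSup (Set.finite_range _).bddAbove ⟨t, rfl⟩

theorem numChildren_eq_zero_iff [Finite T] {v : T} : numChildren v = 0 ↔ ∀ w, ¬ v ⋖ w := by
  rw [numChildren, Set.ncard_eq_zero (Set.toFinite _), Set.eq_empty_iff_forall_notMem]
  rfl

theorem numChildren_eq_zero_iff_layer [Finite T] (hb : IsBalanced b T) {v : T} :
    numChildren v = 0 ↔ layerIndex v = lastLayer T := by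
  constructor
  · intro h
    refine (layerIndex_le_lastLayer v).antisymm (csSup_le ⟨_, ⟨v, rfl⟩⟩ ?_)
    rintro _ ⟨t, rfl⟩
    by_contra! hlt
    obtain ⟨u, hu, hi⟩ := exists_ancestor_layerIndex t (one_le_layerIndex v) hlt.le
    obtain ⟨c, hc, -⟩ := exists_child_le (lt_of_layerIndex_lt hu le_rfl (hi ▸ hlt))
    exact numChildren_eq_zero_iff.1 ((hb.2 u v hi).trans h) c hc
  · intro h
    rw [numChildren_eq_zero_iff]
    intro w hw
    have := layerIndex_le_lastLayer w
    rw [layerIndex_child hw] at this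
    omega

/-- Translates layers into nodes: a reflect layer matched with the layer of `v` meets the branch of
`v` in a single node, `mate v`, and the nesting condition turns into `closes`. Afterwards layers are
not needed any more. -/
theorem IsConstructionTree.exists_layout {ℓ : T → Word} (h : IsConstructionTree b T ℓ) :
    ∃ mate, Layout b T ℓ mate := by
  obtain ⟨hb3, hfin, hb, φ, hφ, hl⟩ := h
  have key : ∀ v : T, ∃ w : T, ¬ IsReflect v →
      IsReflect w ∧ w < v ∧ φ (layerIndex w) = layerIndex v := by
    intro v
    by_cases hv : IsReflect v
    · exact ⟨v, fun h => absurd hv h⟩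
    obtain ⟨i, hi, hiv⟩ := hφ.bijOn.surjOn (layerIndex_mem_splitLayers hb hv)
    obtain ⟨x, hx⟩ := hi.1
    have hlt := hφ.lt_map i hi
    obtain ⟨w, hw, rfl⟩ := exists_ancestor_layerIndex v (hx ▸ one_le_layerIndex x)
      (hiv ▸ hlt.le)
    exact ⟨w, fun _ => ⟨isReflect_of_layer hi rfl,
      lt_of_layerIndex_lt hw le_rfl (hiv ▸ hlt), hiv⟩⟩
  choose mate hmate using key
  have hroot : IsReflect (⊥ : T) := isReflect_of_layer hφ.one_mem layerIndex_bot
  have hmem : ∀ {w : T}, IsReflect w → layerIndex w ∈ reflectLayers T :=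
    fun hw => layerIndex_mem_reflectLayers hb hw
  have hstar := fun v (hv : ¬ IsReflect v) => hl.split_star v (mate v) hv (hmate v hv).2.1.le
    (hmem (hmate v hv).1) (hmate v hv).2.2
  have huniq : ∀ {v w t : T}, ¬ IsReflect v → IsReflect w → v ≤ t → w ≤ t →
      φ (layerIndex w) = layerIndex v → mate v = w := by
    intro v w t hv hw hvt hwt h
    refine layerIndex_inj ((hmate v hv).2.1.le.trans hvt) hwt ?_
    exact hφ.bijOn.injOn (hmem (hmate v hv).1) (hmem hw) ((hmate v hv).2.2.trans h.symm)
  refine ⟨mate, ⟨hfin, hb3, ?_, hroot, fun v hv => (hmate v hv).1, fun v hv => (hmate v hv).2.1,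
    ?_, ?_, ?_, ?_, ?_, ?_, hl.mem_words, hl.root,
    fun v hv => (hl.reflect_starFree v hv).2, ?_, hl.clearing, ?_, ?_, ?_, ?_⟩⟩
  · intro v hv
    rcases hb.1 v with h | h | h
    · exact .inl h
    · exact absurd h hv
    · exact .inr h
  · intro v v' hv hv' hlt h
    have h1 := (hmate v hv).2.2
    rw [← h, (hmate v' hv').2.2] at h1
    exact (layerIndex_lt hlt).ne h1
  · intro v w hv hw h1 h2
    have hm := (hmate v hv).2.2
    have hn := hφ.nested _ (hmem (hmate v hv).1) _ (hmem hw) (layerIndex_lt h1)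
      (hm ▸ layerIndex_lt h2)
    have hs := hφ.bijOn.mapsTo (hmem hw)
    have hw' := hφ.lt_map _ (hmem hw)
    obtain ⟨v', hv', hi⟩ := exists_ancestor_layerIndex v
      ((Nat.zero_le (layerIndex w)).trans_lt hw') (hm ▸ hn.le)
    have hsp := not_isReflect_of_layer hs hi
    exact ⟨v', hsp, huniq hsp hw hv' h2.le hi.symm, lt_of_layerIndex_lt h2.le hv' (hi ▸ hw'),
      lt_of_layerIndex_lt hv' le_rfl (by omega)⟩
  · intro v hv
    rw [numChildren_eq_zero_iff_layer hb, ← hφ.map_one, ← (hmate v hv).2.2]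
    constructor
    · intro h
      rw [h, layerIndex_bot]
    · intro h
      have := hφ.bijOn.injOn (hmem (hmate v hv).1) hφ.one_mem h
      exact layerIndex_inj le_rfl bot_le (this.trans layerIndex_bot.symm)
  · intro u w hu hw hlt
    have hs := hφ.bijOn.mapsTo (hmem hw)
    have hw' := hφ.lt_map _ (hmem hw)
    obtain ⟨x, hx⟩ := hs.1
    have hle : φ (layerIndex w) ≤ layerIndex u := by
      rw [(numChildren_eq_zero_iff_layer hb).1 hu, ← hx]
      exact layerIndex_le_lastLayer x
    obtain ⟨v, hv, hi⟩ := exists_ancestor_layerIndex u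
      ((Nat.zero_le (layerIndex w)).trans_lt hw') hle
    have hsp := not_isReflect_of_layer hs hi
    exact ⟨v, hsp, huniq hsp hw hv hlt.le hi.symm, lt_of_layerIndex_lt hlt.le hv (hi ▸ hw'), hv⟩
  · intro u t hu
    rw [← ncard_reflectLayers_lt hb, ← ncard_reflectLayers_lt hb]
    refine Set.ncard_le_ncard (fun j hj => ⟨hj.1, hj.2.trans_le ?_⟩)
      ((Set.finite_Iio (layerIndex u)).subset fun _ h => h.2)
    rw [(numChildren_eq_zero_iff_layer hb).1 hu]
    exact layerIndex_le_lastLayer t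
  · intro t
    by_cases ht : IsReflect t
    · rw [hl.reflect_length t ht, reflectIndex_layerIndex hb ht]
    · rw [hl.split_length t ht, ncard_reflectLayers_lt hb]
  · intro v w hv hw hne
    exact hl.independent _ ⟨v, hv, rfl⟩ _ ⟨w, hw, rfl⟩ fun h => hne (hl.reflect_injOn hv hw h)
  · intro v hv
    rw [← reflectIndex_layerIndex hb (hmate v hv).1]
    exact (hstar v hv).1
  · intro v hv
    rw [← reflectIndex_layerIndex hb (hmate v hv).1]
    exact (hstar v hv).2
  · intro v hv i hi
    rw [← reflectIndex_layerIndex hb (hmate v hv).1]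
    exact (hl.split_star_unique v hv).unique hi (hstar v hv).1
  · intro v hv
    have hv' : ¬ IsReflect v := fun h => by
      have : numChildren v = 1 := h
      omega
    rw [← reflectIndex_layerIndex hb (hmate v hv').1]
    exact hl.split_children v hv _ (hmem (hmate v hv').1) (hmate v hv').2.2

end Construction

/-! ### Directions at split nodes, leaves, and matching along a branch -/

namespace Layout

variable {b : ℕ} {T : RootedTree} {ℓ : T → Word} {mate : T → T}

theorem not_isReflect (h : Layout b T ℓ mate) {v : T} (hv : numChildren v = b) :
    ¬ IsReflect v := fun h' => by
  have h1 : numChildren v = 1 := h'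
  have := h.three_le
  omega

theorem not_isReflect_leaf {u : T} (hu : numChildren u = 0) : ¬ IsReflect u := fun h' => by
  have h1 : numChildren u = 1 := h'
  omega

theorem internal_of_lt (h : Layout b T ℓ mate) {v t : T} (hv : ¬ IsReflect v) (ht : v < t) :
    numChildren v = b := by
  have := h.finite
  refine (h.children_cases v hv).resolve_left fun h0 => ?_
  obtain ⟨c, hc, -⟩ := exists_child_le ht
  exact numChildren_eq_zero_iff.1 h0 c hc

theorem leaf_not_lt (h : Layout b T ℓ mate) {u t : T} (hu : numChildren u = 0) : ¬ u < t :=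
  fun ht => by
  have := h.internal_of_lt (not_isReflect_leaf hu) ht
  have := h.three_le
  omega

theorem mate_ne_bot (h : Layout b T ℓ mate) {v : T} (hv : numChildren v = b) : mate v ≠ ⊥ := by
  intro h'
  have := (h.mate_eq_bot v (h.not_isReflect hv)).1 h'
  have := h.three_le
  omega

theorem one_le_rk (h : Layout b T ℓ mate) {w : T} (hw : w ≠ ⊥) : 1 ≤ rk w := by
  have := h.finite
  exact (Nat.zero_le _).trans_lt (rk_lt h.root_reflect (bot_lt_iff_ne_bot.2 hw))

theorem rk_mate_lt (h : Layout b T ℓ mate) {v : T} (hv : ¬ IsReflect v) : rk (mate v) < rk v := by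
  have := h.finite
  exact rk_lt (h.mate_reflect v hv) (h.mate_lt v hv)

theorem symb_child (h : Layout b T ℓ mate) {v t s : T} (hv : numChildren v = b) (ht : v < t)
    (hs : t ≤ s) : symb (ℓ s) (rk (mate v) + 1) = symb (ℓ t) (rk (mate v) + 1) := by
  have := h.finite
  obtain ⟨ρ, -, hρ⟩ := h.children v hv
  obtain ⟨c, hc, hct⟩ := exists_child_le ht
  rw [hρ c hc t hct, hρ c hc s (hct.trans hs)]

theorem isNum_dir (h : Layout b T ℓ mate) {v t : T} (hv : numChildren v = b) (ht : v < t) :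
    IsNum b (symb (ℓ t) (rk (mate v) + 1)) := by
  have := h.finite
  obtain ⟨ρ, hb, hρ⟩ := h.children v hv
  obtain ⟨c, hc, hct⟩ := exists_child_le ht
  exact ⟨ρ c, hb.mapsTo hc, hρ c hc t hct⟩

theorem exists_child_dir (h : Layout b T ℓ mate) {v : T} (hv : numChildren v = b) {k : ℕ}
    (hk : k ∈ Set.Icc 1 b) :
    ∃ c, v ⋖ c ∧ ∀ t, c ≤ t → symb (ℓ t) (rk (mate v) + 1) = some (.num k) := by
  obtain ⟨ρ, hb, hρ⟩ := h.children v hv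
  obtain ⟨c, hc, rfl⟩ := hb.surjOn hk
  exact ⟨c, hc, hρ c hc⟩

theorem child_eq_of_dir (h : Layout b T ℓ mate) {v c c' t t' : T} (hv : numChildren v = b)
    (hc : v ⋖ c) (hc' : v ⋖ c') (ht : c ≤ t) (ht' : c' ≤ t')
    (he : symb (ℓ t) (rk (mate v) + 1) = symb (ℓ t') (rk (mate v) + 1)) : c = c' := by
  obtain ⟨ρ, hb, hρ⟩ := h.children v hv
  rw [hρ c hc t ht, hρ c' hc' t' ht'] at he
  simp only [Option.some.injEq, Symbol.num.injEq] at he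
  exact hb.injOn hc hc' he

/-- Incomparable nodes part at their infimum, which has two children and hence is an internal split
node; its children carry different symbols at its position. -/
theorem separation (h : Layout b T ℓ mate) {s s' : T} (h1 : ¬ s ≤ s') (h2 : ¬ s' ≤ s) :
    ∃ g, numChildren g = b ∧ g < s ∧ g < s' ∧
      symb (ℓ s) (rk (mate g) + 1) ≠ symb (ℓ s') (rk (mate g) + 1) := by
  have := h.finite
  have hs : s ⊓ s' < s := inf_le_left.lt_of_ne fun e => h1 (inf_eq_left.1 e)
  have hs' : s ⊓ s' < s' := inf_le_right.lt_of_ne fun e => h2 (inf_eq_right.1 e)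
  obtain ⟨c, hc, hcs⟩ := exists_child_le hs
  obtain ⟨c', hc', hcs'⟩ := exists_child_le hs'
  have hne : c ≠ c' := by
    rintro rfl
    exact hc.1.not_ge (le_inf hcs hcs')
  have hg : ¬ IsReflect (s ⊓ s') := by
    intro hr
    obtain ⟨x, hx⟩ := Set.ncard_eq_one.1 hr
    have e1 : c ∈ ({x} : Set T) := hx ▸ hc
    have e2 : c' ∈ ({x} : Set T) := hx ▸ hc'
    exact hne (e1.trans e2.symm)
  have hb := h.internal_of_lt hg hs
  exact ⟨s ⊓ s', hb, hs, hs', fun he => hne (h.child_eq_of_dir hb hc hc' hcs hcs' he)⟩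

theorem le_or_le_of_dir (h : Layout b T ℓ mate) {s s' : T}
    (hd : ∀ g, numChildren g = b → g < s → g < s' →
      symb (ℓ s) (rk (mate g) + 1) = symb (ℓ s') (rk (mate g) + 1)) : s ≤ s' ∨ s' ≤ s := by
  by_contra! hn
  obtain ⟨g, hg, h1, h2, h3⟩ := h.separation hn.1 hn.2
  exact h3 (hd g hg h1 h2)

theorem isNum_symb_reflect (h : Layout b T ℓ mate) {w : T} (hw : IsReflect w) {i : ℕ}
    (hi : i ≤ rk w) : IsNum b (symb (ℓ w) i) := by
  refine (mem_words_symb (h.mem_words w) (by rw [h.length]; omega)).resolve_left fun h' => ?_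
  exact h.starFree w hw (mem_iff_symb.2 ⟨i, h'⟩)

theorem isNum_symb_split (h : Layout b T ℓ mate) {v : T} (hv : ¬ IsReflect v) {i : ℕ}
    (hi : i ≤ rk v) (hne : i ≠ rk (mate v) + 1) : IsNum b (symb (ℓ v) i) := by
  refine (mem_words_symb (h.mem_words v) (by rw [h.length]; omega)).resolve_left fun h' => ?_
  exact hne (h.star_unique v hv i h')

/-- A label ending in 1 would have the label of the root as a final substring, against independence.
Hence the 0-th symbol 1 occurs only at the root and at split nodes matched with it, which are the
leaves. -/
theorem symb_reflect_zero (h : Layout b T ℓ mate) {w : T} (hw : IsReflect w) (hne : w ≠ ⊥) :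
    symb (ℓ w) 0 = some (.num 2) := by
  refine (h.mem_words w).1.resolve_left fun h' => ?_
  refine h.independent ⊥ w h.root_reflect hw hne.symm (suffix_iff_symb.2 ?_)
  intro i hi
  rw [h.root, List.length_singleton] at hi
  obtain rfl : i = 0 := by omega
  rw [h', h.root]
  rfl

theorem symb_internal_zero (h : Layout b T ℓ mate) {v : T} (hv : numChildren v = b) :
    symb (ℓ v) 0 = some (.num 2) := by
  have hr := h.not_isReflect hv
  rw [h.symb_below_mate v hr 0 (by omega)]
  exact h.symb_reflect_zero (h.mate_reflect v hr) (h.mate_ne_bot hv)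

theorem mate_leaf (h : Layout b T ℓ mate) {u : T} (hu : numChildren u = 0) : mate u = ⊥ :=
  (h.mate_eq_bot u (not_isReflect_leaf hu)).2 hu

theorem symb_leaf_zero (h : Layout b T ℓ mate) {u : T} (hu : numChildren u = 0) :
    symb (ℓ u) 0 = some (.num 1) := by
  rw [h.symb_below_mate u (not_isReflect_leaf hu) 0 (by omega), h.mate_leaf hu, h.root]
  rfl

theorem rk_mate_pos (h : Layout b T ℓ mate) {v : T} (hv : numChildren v = b) :
    1 ≤ rk (mate v) := h.one_le_rk (h.mate_ne_bot hv)

theorem isNum_symb_one (h : Layout b T ℓ mate) {v : T} (hv : numChildren v = b) :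
    IsNum b (symb (ℓ v) 1) := by
  have hr := h.not_isReflect hv
  have h1 := h.rk_mate_pos hv
  rw [h.symb_below_mate v hr 1 (by omega)]
  exact h.isNum_symb_reflect (h.mate_reflect v hr) h1

/-- There is a leaf below `t` that follows prescribed directions. -/
theorem exists_leaf (h : Layout b T ℓ mate) (χ : T → ℕ) (hχ : ∀ v, χ v ∈ Set.Icc 1 b) (t : T) :
    ∃ u, t ≤ u ∧ numChildren u = 0 ∧ ∀ v, numChildren v = b → t ≤ v → v < u →
      symb (ℓ u) (rk (mate v) + 1) = some (.num (χ v)) := by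
  have := h.finite
  induction t using (wellFounded_gt (α := T)).induction with
  | _ t ih =>
    by_cases h0 : numChildren t = 0
    · exact ⟨t, le_rfl, h0, fun v _ h1 h2 => absurd h1 h2.not_ge⟩
    by_cases hr : IsReflect t
    · obtain ⟨c, hc⟩ : ∃ c, t ⋖ c := by
        by_contra! hn
        exact h0 (numChildren_eq_zero_iff.2 hn)
      obtain ⟨u, hu, hu0, hd⟩ := ih c hc.1
      refine ⟨u, hc.1.le.trans hu, hu0, fun v hv h1 h2 => hd v hv ?_ h2⟩
      rcases h1.eq_or_lt with rfl | h1
      · exact absurd hr (h.not_isReflect hv)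
      · rcases ancestors_total hu h2.le with h3 | h3
        · exact h3
        · rcases h3.eq_or_lt with rfl | h3
          · exact le_rfl
          · exact absurd h3 (hc.2 h1)
    · have hb := (h.children_cases t hr).resolve_left h0
      obtain ⟨c, hc, hcd⟩ := h.exists_child_dir hb (hχ t)
      obtain ⟨u, hu, hu0, hd⟩ := ih c hc.1
      refine ⟨u, hc.1.le.trans hu, hu0, fun v hv h1 h2 => ?_⟩
      rcases h1.eq_or_lt with rfl | h1
      · exact hcd u hu
      · refine hd v hv ?_ h2
        rcases ancestors_total hu h2.le with h3 | h3
        · exact h3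
        · rcases h3.eq_or_lt with rfl | h3
          · exact le_rfl
          · exact absurd h3 (hc.2 h1)

theorem leaf_unique (h : Layout b T ℓ mate) {t u u' : T} (hu : t ≤ u) (hu' : t ≤ u')
    (h0 : numChildren u = 0) (h0' : numChildren u' = 0)
    (hd : ∀ v, numChildren v = b → t ≤ v → v < u → v < u' →
      symb (ℓ u) (rk (mate v) + 1) = symb (ℓ u') (rk (mate v) + 1)) : u = u' := by
  have key : u ≤ u' ∨ u' ≤ u := h.le_or_le_of_dir fun g hg h1 h2 => by
    rcases ancestors_total hu h1.le with h3 | h3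
    · exact hd g hg h3 h1 h2
    · rcases h3.eq_or_lt with rfl | h3
      · exact hd g hg le_rfl h1 h2
      · rw [h.symb_child hg h3 hu, h.symb_child hg h3 hu']
  rcases key with h1 | h1
  · exact h1.eq_of_not_lt (h.leaf_not_lt h0)
  · exact (h1.eq_of_not_lt (h.leaf_not_lt h0')).symm

/-- Along a branch, at most one split node is matched with a given reflect node. -/
theorem mate_unique (h : Layout b T ℓ mate) {v v' t : T} (hv : ¬ IsReflect v)
    (hv' : ¬ IsReflect v') (h1 : v ≤ t) (h2 : v' ≤ t) (he : mate v = mate v') : v = v' := by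
  rcases ancestors_lt_trichotomy h1 h2 with h' | h' | h'
  · exact absurd he (h.mate_ne v' v hv' hv h')
  · exact h'
  · exact absurd he.symm (h.mate_ne v v' hv hv' h')

/-- A split node strictly between `mate v` and `v` is matched with a node below `mate v`. -/
theorem mate_lt_mate (h : Layout b T ℓ mate) {v g : T} (hv : ¬ IsReflect v) (hg : ¬ IsReflect g)
    (h1 : mate v < g) (h2 : g < v) : mate v < mate g := by
  rcases ancestors_lt_trichotomy h1.le (h.mate_lt g hg).le with h' | h' | h'
  · exact h'
  · exact absurd h'.symm (h.mate_ne v g hv hg h2)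
  · obtain ⟨v', hv', he, -, h4⟩ := h.closes g (mate v) hg (h.mate_reflect v hv) h' h1
    exact absurd he (h.mate_ne v v' hv hv' (h4.trans h2))

end Layout

/-! ### Adjacency between internal split nodes and leaves -/

/-- The string `x` agrees with `y` at all positions in `[2, n)`, except for stars of `y`. -/
def Fits (n : ℕ) (x y : Word) : Prop :=
  -- Position 0 only tells leaves from internal nodes, and position 1 carries the star of every leaf
  -- label; neither can be compared.
  ∀ j, 2 ≤ j → j < n → symb x j = symb y j ∨ symb y j = some .star

/-- The leaf `u` may become a neighbor of the internal split node `v`. -/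
structure Cand (b : ℕ) {T : RootedTree} (ℓ : T → Word) (v u : T) : Prop where
  internal : numChildren v = b
  leaf : numChildren u = 0
  lt : v < u
  fits : Fits (rk v + 1) (ℓ u) (ℓ v)

/-- The internal split node `v` and the leaf `u` are adjacent when at each reflect node `w` the
copy with number `c w` is the one that stays connected to the rest. -/
structure Link (b : ℕ) {T : RootedTree} (ℓ : T → Word) (c : T → ℕ) (v u : T) : Prop
    extends Cand b ℓ v u where
  choice : ∀ w, IsReflect w → v < w → w < u → symb (ℓ u) (rk w + 1) = some (.num (c w))

namespace Layout

variable {b : ℕ} {T : RootedTree} {ℓ : T → Word} {mate : T → T}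

/-- The position of a reflect node `w < v` is governed by the split node on the branch that is
matched with `w`: if that node is above `v`, the symbols agree anyway, if it is `v`, then `ℓ v` has
its star there, and only if it is below `v` does a condition remain. -/
theorem cand_iff (h : Layout b T ℓ mate) {v u : T} (hv : numChildren v = b)
    (hu : numChildren u = 0) (hlt : v < u) :
    Cand b ℓ v u ↔ ∀ g, numChildren g = b → v < g → g < u → mate g < v →
      symb (ℓ u) (rk (mate g) + 1) = symb (ℓ v) (rk (mate g) + 1) := by
  have := h.finite
  have hvr := h.not_isReflect hv
  constructor
  · intro hc g hg h1 h2 h3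
    have hgr := h.not_isReflect hg
    have h4 := rk_lt (h.mate_reflect g hgr) h3
    refine (hc.fits _ (by have := h.rk_mate_pos hg; omega) (by omega)).resolve_right fun hs => ?_
    have := h.star_unique v hvr _ hs
    exact h.mate_ne g v hgr hvr h1
      (rk_inj (h.mate_reflect v hvr) (h.mate_reflect g hgr) (h.mate_lt v hvr).le h3.le (by omega))
  · intro hd
    refine ⟨hv, hu, hlt, fun j hj2 hj => ?_⟩
    obtain ⟨w, hwv, hw, hwj⟩ := exists_reflect_rk v (i := j - 1) (by omega)
    obtain rfl : j = rk w + 1 := by omega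
    obtain ⟨g, hg, hgw, h1, h2⟩ := h.matched u w hu hw (hwv.trans hlt)
    subst hgw
    have hgu : g < u := h2.lt_of_ne fun e => by
      rw [e, h.mate_leaf hu, rk_bot] at hj2
      omega
    have hgb := h.internal_of_lt hg hgu
    rcases ancestors_lt_trichotomy h2 hlt.le with h3 | h3 | h3
    · left
      rw [h.symb_child hgb h3 hlt.le]
    · right
      rw [h3]
      exact h.symb_mate v hvr
    · exact .inl (hd g hgb h3 hgu hwv)

/-- Every direction strictly between `v` and `u` is prescribed, by `ℓ v` or by `c`, as `mate g = v`
is impossible for a split node `v`. So the first direction determines the whole branch. -/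
theorem link_iff (h : Layout b T ℓ mate) {c : T → ℕ} {v u : T} (hv : numChildren v = b)
    (hu : numChildren u = 0) (hlt : v < u) :
    Link b ℓ c v u ↔ ∀ g, numChildren g = b → v < g → g < u →
      (mate g < v → symb (ℓ u) (rk (mate g) + 1) = symb (ℓ v) (rk (mate g) + 1)) ∧
      (v < mate g → symb (ℓ u) (rk (mate g) + 1) = some (.num (c (mate g)))) := by
  constructor
  · intro hl g hg h1 h2
    have hgr := h.not_isReflect hg
    exact ⟨(h.cand_iff hv hu hlt).1 hl.toCand g hg h1 h2,
      fun h3 => hl.choice _ (h.mate_reflect g hgr) h3 ((h.mate_lt g hgr).trans h2)⟩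
  · intro hd
    refine ⟨(h.cand_iff hv hu hlt).2 fun g hg h1 h2 => (hd g hg h1 h2).1, fun w hw h1 h2 => ?_⟩
    obtain ⟨g, hg, rfl, h3, h4⟩ := h.matched u w hu hw h2
    have hgu : g < u := h4.lt_of_ne fun e => by
      rw [e, h.mate_leaf hu] at h1
      exact not_lt_bot h1
    exact (hd g (h.internal_of_lt hg hgu) (h1.trans h3) hgu).2 h1

/-- An internal split node has precisely one neighbor in each direction. -/
theorem existsUnique_link (h : Layout b T ℓ mate) {c : T → ℕ} (hc : ∀ w, c w ∈ Set.Icc 1 b)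
    {v : T} (hv : numChildren v = b) {k : ℕ} (hk : k ∈ Set.Icc 1 b) :
    ∃! u, Link b ℓ c v u ∧ symb (ℓ u) (rk (mate v) + 1) = some (.num k) := by
  classical
  have := h.finite
  have hvr := h.not_isReflect hv
  obtain ⟨a, hva, ha⟩ := h.exists_child_dir hv hk
  have hnum : ∀ g, ∃ m ∈ Set.Icc 1 b, numChildren g = b → mate g < v → v < g →
      symb (ℓ v) (rk (mate g) + 1) = some (.num m) := by
    intro g
    by_cases hg : numChildren g = b ∧ mate g < v ∧ v < g
    · have hgr := h.not_isReflect hg.1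
      have h4 := rk_lt (h.mate_reflect g hgr) hg.2.1
      obtain ⟨m, hm, he⟩ := h.isNum_symb_split hvr (i := rk (mate g) + 1) (by omega) fun he =>
        h.mate_ne g v hgr hvr hg.2.2 (rk_inj (h.mate_reflect v hvr) (h.mate_reflect g hgr)
          (h.mate_lt v hvr).le hg.2.1.le (by omega))
      exact ⟨m, hm, fun _ _ _ => he⟩
    · exact ⟨1, ⟨le_rfl, by have := h.three_le; omega⟩, fun h1 h2 h3 => absurd ⟨h1, h2, h3⟩ hg⟩
  choose m hm1 hm2 using hnum
  obtain ⟨u, hau, hu, hd⟩ := h.exists_leaf (fun g => if v < mate g then c (mate g) else m g)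
    (fun g => by
      split_ifs
      · exact hc _
      · exact hm1 _) a
  have hvu : v < u := hva.1.trans_le hau
  have hag : ∀ g, v < g → g < u → a ≤ g := fun g h1 h2 => by
    rcases ancestors_total hau h2.le with h3 | h3
    · exact h3
    · rcases h3.eq_or_lt with rfl | h3
      · exact le_rfl
      · exact absurd h3 (hva.2 h1)
  refine ⟨u, ⟨(h.link_iff hv hu hvu).2 fun g hg h1 h2 => ⟨fun h3 => ?_, fun h3 => ?_⟩,
    ha u hau⟩, ?_⟩
  · rw [hd g hg (hag g h1 h2) h2, if_neg h3.not_gt, hm2 g hg h3 h1]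
  · rw [hd g hg (hag g h1 h2) h2, if_pos h3]
  · rintro u' ⟨hl, hk'⟩
    obtain ⟨a', hva', ha'⟩ := exists_child_le hl.lt
    obtain rfl := h.child_eq_of_dir hv hva hva' hau ha' (by rw [hk', ha u hau])
    refine h.leaf_unique ha' hau hl.leaf hu fun g hg h1 h2 h3 => ?_
    have hvg := hva.1.trans_le h1
    obtain ⟨e1, e2⟩ := (h.link_iff hv hl.leaf hl.lt).1 hl g hg hvg h2
    rw [hd g hg h1 h3]
    have hgr := h.not_isReflect hg
    rcases ancestors_lt_trichotomy (h.mate_lt g hgr).le hvg.le with h4 | h4 | h4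
    · rw [if_neg h4.not_gt, e1 h4, hm2 g hg h4 hvg]
    · exact absurd (h4 ▸ h.mate_reflect g hgr) hvr
    · rw [if_pos h4, e2 h4]

/-- In each direction, a leaf has precisely one potential neighbor. -/
theorem existsUnique_cand (h : Layout b T ℓ mate) {u : T} (hu : numChildren u = 0) {k : ℕ}
    (hk : k ∈ Set.Icc 1 b) : ∃! v, Cand b ℓ v u ∧ symb (ℓ v) 1 = some (.num k) := by
  classical
  have := h.finite
  have hur := not_isReflect_leaf hu
  have hub : rk (mate u) = 0 := by rw [h.mate_leaf hu, rk_bot]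
  -- The star of `ℓ u` is replaced by `k`, and the 0-th symbol by 2. Clearing gives a reflect node
  -- whose label is a final substring of this star-free string, and the split node matched with it
  -- is the neighbor. Conversely, the mate of any candidate has such a label, so independence gives
  -- uniqueness.
  set a : Word := wordOf (rk u + 1)
    (fun j => if j = 0 then .num 2 else if j = 1 then .num k else symbD (ℓ u) j) with ha
  have hal : a.length = rk u + 1 := length_wordOf _ _
  have hbotu : (⊥ : T) < u := bot_lt_iff_ne_bot.2 fun e => hur (e ▸ h.root_reflect)
  have hrku : 1 ≤ rk u := (Nat.zero_le _).trans_lt (rk_lt h.root_reflect hbotu)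
  have ha0 : symb a 0 = some (.num 2) := by rw [ha, symb_wordOf (by omega)]; rfl
  have ha1 : symb a 1 = some (.num k) := by rw [ha, symb_wordOf (by omega)]; rfl
  have ha2 : ∀ j, 2 ≤ j → symb a j = symb (ℓ u) j := by
    intro j hj
    by_cases hj' : j ≤ rk u
    · rw [ha, symb_wordOf (by omega), if_neg (by omega), if_neg (by omega), ← symbD_spec]
      rw [h.length]; omega
    · rw [symb_eq_none (by rw [hal]; omega), symb_eq_none (by rw [h.length]; omega)]
  have hanum : ∀ j ≤ rk u, IsNum b (symb a j) := by
    intro j hj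
    rcases Nat.lt_or_ge j 2 with hj2 | hj2
    · have h3 := h.three_le
      interval_cases j
      · exact ⟨2, ⟨by omega, by omega⟩, ha0⟩
      · exact ⟨k, hk, ha1⟩
    · rw [ha2 j hj2]
      exact h.isNum_symb_split hur hj (by omega)
  -- Branches part at positions at least 2, where `a` coincides with `ℓ u`; hence `w` lies on the
  -- branch of `u`.
  have hsep : ∀ w, IsReflect w → ℓ w <:+ a → w < u := by
    intro w hw hs
    rw [suffix_iff_symb, h.length] at hs
    have key : w ≤ u ∨ u ≤ w := h.le_or_le_of_dir fun g hg h1 h2 => by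
      have h3 := h.rk_mate_lt (h.not_isReflect hg)
      have h4 := rk_mono h1.le
      have h5 := h.rk_mate_pos hg
      rw [hs _ (by omega), ha2 _ (by omega)]
    rcases key with h1 | h1
    · exact h1.lt_of_ne fun e => hur (e ▸ hw)
    · exact absurd hw ((h1.eq_of_not_lt (h.leaf_not_lt hu)) ▸ hur)
  obtain ⟨_, ⟨w, hw, rfl⟩, hwa⟩ : ∃ y ∈ ℓ '' reflectNodes T, y <:+ a := by
    refine h.clearing a ⟨⟨.inr ha0, fun s hs => ?_⟩, fun hs => ?_⟩ ?_
    · obtain ⟨i, hi⟩ := mem_iff_symb.1 hs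
      obtain ⟨k, hk, he⟩ := hanum i (by have := lt_length_of_symb hi; omega)
      rw [hi] at he
      exact .inr ⟨k, hk, Option.some.inj he⟩
    · obtain ⟨i, hi⟩ := mem_iff_symb.1 hs
      exact (hanum i (by have := lt_length_of_symb hi; omega)).ne_star hi
    · rintro _ ⟨w, hw, rfl⟩
      rw [hal, h.length]
      exact Nat.succ_le_succ (h.rk_le u w hu)
  have hwu := hsep w hw hwa
  have hwa' := suffix_iff_symb.1 hwa
  rw [h.length] at hwa'
  have hw0 : w ≠ ⊥ := by
    rintro rfl
    have := hwa' 0 (by omega)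
    rw [ha0, h.root] at this
    simp [symb] at this
  have hw1 := h.one_le_rk hw0
  obtain ⟨v, hv, rfl, hwv, hvu⟩ := h.matched u w hu hw hwu
  have hvu : v < u := hvu.lt_of_ne fun e => hw0 (e ▸ h.mate_leaf hu)
  have hvb := h.internal_of_lt hv hvu
  refine ⟨v, ⟨(h.cand_iff hvb hu hvu).2 fun g hg h1 h2 h3 => ?_, ?_⟩, ?_⟩
  · have hgr := h.not_isReflect hg
    rcases ancestors_lt_trichotomy h3.le hwv.le with h4 | h4 | h4
    · have h5 := rk_lt (h.mate_reflect g hgr) h4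
      have h6 := h.rk_mate_pos hg
      rw [h.symb_below_mate v hv _ (by omega), hwa' _ (by omega), ha2 _ (by omega)]
    · exact absurd h4.symm (h.mate_ne g v hgr hv h1)
    · obtain ⟨g', hg', he, h5, h6⟩ := h.closes v (mate g) hv (h.mate_reflect g hgr) h4 h3
      exact absurd he (h.mate_ne g g' hgr hg' (h6.trans h1))
  · rw [h.symb_below_mate v hv 1 (by omega), hwa' _ (by omega), ha1]
  · rintro v' ⟨hc, hk'⟩
    have hvr' := h.not_isReflect hc.internal
    have hm' := h.mate_reflect v' hvr'
    have hp := h.rk_mate_pos hc.internal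
    have hs : ℓ (mate v') <:+ a := by
      rw [suffix_iff_symb, h.length]
      intro i hi
      rcases Nat.lt_or_ge i 2 with hi2 | hi2
      · interval_cases i
        · rw [h.symb_reflect_zero hm' (h.mate_ne_bot hc.internal), ha0]
        · rw [← h.symb_below_mate v' hvr' _ hi, hk', ha1]
      · rw [ha2 i hi2, ← h.symb_below_mate v' hvr' _ hi]
        refine ((hc.fits i hi2 ?_).resolve_right fun hs => ?_).symm
        · have := h.rk_mate_lt hvr'
          omega
        · have := h.star_unique v' hvr' i hs
          omega
    refine h.mate_unique hvr' hv hc.lt.le hvu.le ?_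
    by_contra hne
    rcases le_total (ℓ (mate v')).length (ℓ (mate v)).length with hle | hle
    · exact h.independent _ _ hm' hw hne (List.suffix_of_suffix_length_le hs hwa hle)
    · exact h.independent _ _ hw hm' (Ne.symm hne) (List.suffix_of_suffix_length_le hwa hs hle)

end Layout

/-! ### Pivots, the final sink, and twins -/

/-- `v` is the split node matched with `w` that is reached from `w` when at each split node that is
matched with a node `w' > w`, the direction `c w'` is followed. -/
structure IsPivot (b : ℕ) {T : RootedTree} (ℓ : T → Word) (mate : T → T) (c : T → ℕ)
    (w v : T) : Prop where
  split : ¬ IsReflect v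
  mate_eq : mate v = w
  dir : ∀ g, numChildren g = b → w < g → g < v → w < mate g →
    symb (ℓ v) (rk (mate g) + 1) = some (.num (c (mate g)))

open Classical in
/-- The node `v` with `IsPivot b ℓ mate c w v`. -/
noncomputable def pivot (b : ℕ) {T : RootedTree} (ℓ : T → Word) (mate : T → T) (c : T → ℕ)
    (w : T) : T :=
  if h : ∃ v, IsPivot b ℓ mate c w v then h.choose else w

namespace Layout

variable {b : ℕ} {T : RootedTree} {ℓ : T → Word} {mate : T → T}

theorem exists_isPivot (h : Layout b T ℓ mate) {c : T → ℕ} (hc : ∀ w, c w ∈ Set.Icc 1 b) {w : T}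
    (hw : IsReflect w) : ∃ v, IsPivot b ℓ mate c w v := by
  have := h.finite
  obtain ⟨u, hwu, hu, hd⟩ := h.exists_leaf (fun v => c (mate v)) (fun v => hc _) w
  have hlt : w < u := hwu.lt_of_ne fun e => not_isReflect_leaf hu (e ▸ hw)
  obtain ⟨v, hv, hvw, h1, h2⟩ := h.matched u w hu hw hlt
  refine ⟨v, hv, hvw, fun g hg h3 h4 h5 => ?_⟩
  rw [← hd g hg h3.le (h4.trans_le h2), h.symb_child hg h4 h2]

/-- All split nodes strictly between `w` and a split node matched with it are themselves matched
below `w` (`mate_lt_mate`), so `c` prescribes all directions on the way. -/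
theorem isPivot_unique (h : Layout b T ℓ mate) {c : T → ℕ} {w v v' : T}
    (hv : IsPivot b ℓ mate c w v) (hv' : IsPivot b ℓ mate c w v') : v = v' := by
  have hwv := hv.mate_eq ▸ h.mate_lt v hv.split
  have hwv' := hv'.mate_eq ▸ h.mate_lt v' hv'.split
  have key : v ≤ v' ∨ v' ≤ v := h.le_or_le_of_dir fun g hg h1 h2 => by
    rcases ancestors_lt_trichotomy hwv.le h1.le with h3 | h3 | h3
    · have h4 : w < mate g := by
        have := h.mate_lt_mate hv.split (h.not_isReflect hg) (hv.mate_eq ▸ h3) h1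
        rwa [hv.mate_eq] at this
      rw [hv.dir g hg h3 h1 h4, hv'.dir g hg h3 h2 h4]
    · exact absurd (h3 ▸ hv.mate_eq ▸ h.mate_reflect v hv.split) (h.not_isReflect hg)
    · rw [h.symb_child hg h3 hwv.le, h.symb_child hg h3 hwv'.le]
  rcases key with h1 | h1
  · exact h.mate_unique hv.split hv'.split h1 le_rfl (hv.mate_eq.trans hv'.mate_eq.symm)
  · exact h.mate_unique hv.split hv'.split le_rfl h1 (hv.mate_eq.trans hv'.mate_eq.symm)

theorem isPivot_pivot (h : Layout b T ℓ mate) {c : T → ℕ} (hc : ∀ w, c w ∈ Set.Icc 1 b) {w : T}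
    (hw : IsReflect w) : IsPivot b ℓ mate c w (pivot b ℓ mate c w) := by
  have he := h.exists_isPivot hc hw
  rw [pivot, dif_pos he]
  exact he.choose_spec

theorem eq_pivot (h : Layout b T ℓ mate) {c : T → ℕ} {w v : T}
    (hv : IsPivot b ℓ mate c w v) : v = pivot b ℓ mate c w := by
  have he : ∃ v, IsPivot b ℓ mate c w v := ⟨v, hv⟩
  rw [pivot, dif_pos he]
  exact h.isPivot_unique hv he.choose_spec

theorem lt_pivot (h : Layout b T ℓ mate) {c : T → ℕ} (hc : ∀ w, c w ∈ Set.Icc 1 b) {w : T}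
    (hw : IsReflect w) : w < pivot b ℓ mate c w := by
  have := h.isPivot_pivot hc hw
  simpa [this.mate_eq] using h.mate_lt _ this.split

theorem internal_pivot (h : Layout b T ℓ mate) {c : T → ℕ} (hc : ∀ w, c w ∈ Set.Icc 1 b) {w : T}
    (hw : IsReflect w) (hne : w ≠ ⊥) : numChildren (pivot b ℓ mate c w) = b := by
  have := h.isPivot_pivot hc hw
  refine (h.children_cases _ this.split).resolve_left fun h0 => hne ?_
  rw [← this.mate_eq, h.mate_leaf h0]

/-- The choice at `w` does not influence the pivot of `w`, so it may still be changed after that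
pivot has been queried. -/
theorem pivot_congr (h : Layout b T ℓ mate) {c c' : T → ℕ} (hc : ∀ w, c w ∈ Set.Icc 1 b) {w : T}
    (hw : IsReflect w) (hcc : ∀ w', w < w' → c w' = c' w') :
    pivot b ℓ mate c w = pivot b ℓ mate c' w := by
  have hp := h.isPivot_pivot hc hw
  exact h.eq_pivot ⟨hp.split, hp.mate_eq, fun g hg h1 h2 h3 => by
    rw [hp.dir g hg h1 h2 h3, hcc _ h3]⟩

/-- A leaf all of whose potential neighbors are actual neighbors, and pivots. -/
theorem exists_sink (h : Layout b T ℓ mate) {c : T → ℕ} (hc : ∀ w, c w ∈ Set.Icc 1 b) :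
    ∃ u, numChildren u = 0 ∧ ∀ v, Cand b ℓ v u → Link b ℓ c v u ∧ IsPivot b ℓ mate c (mate v) v ∧
      symb (ℓ u) (rk (mate v) + 1) = some (.num (c (mate v))) := by
  -- Following `c` at every split node from the root on meets the requirements of `link_iff` and of
  -- `IsPivot` simultaneously, for all potential neighbors of `u`.
  obtain ⟨u, -, hu, hd⟩ := h.exists_leaf (fun v => c (mate v)) (fun v => hc _) ⊥
  refine ⟨u, hu, fun v hv => ⟨?_, ⟨h.not_isReflect hv.internal, rfl, fun g hg _ h2 _ => ?_⟩,
    hd v hv.internal bot_le hv.lt⟩⟩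
  · rw [h.link_iff hv.internal hu hv.lt]
    exact fun g hg h1 h2 => ⟨(h.cand_iff hv.internal hu hv.lt).1 hv g hg h1 h2,
      fun _ => hd g hg bot_le h2⟩
  · rw [← hd g hg bot_le (h2.trans hv.lt), h.symb_child hg h2 hv.lt.le]

/-- If there is a reflect node between `v` and `u`, then the position of `u` is copied. -/
theorem exists_twin (h : Layout b T ℓ mate) {v u w : T} (hc : Cand b ℓ v u) (hw : IsReflect w)
    (h1 : v < w) (h2 : w < u) : ∃ u', Cand b ℓ v u' ∧ w < u' ∧
      symb (ℓ u') (rk w + 1) ≠ symb (ℓ u) (rk w + 1) := by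
  classical
  have := h.finite
  have hb3 := h.three_le
  have hnum : ∀ x, ∃ m ∈ Set.Icc 1 b, IsReflect x → v < x → x < u →
      symb (ℓ u) (rk x + 1) = some (.num m) := by
    intro x
    by_cases hx : IsReflect x ∧ v < x ∧ x < u
    · have hxb : x ≠ ⊥ := fun e => not_lt_bot (e ▸ hx.2.1)
      obtain ⟨m, hm, he⟩ := h.isNum_symb_split (not_isReflect_leaf hc.leaf) (i := rk x + 1)
        (by have := rk_lt hx.1 hx.2.2; omega)
        (by rw [h.mate_leaf hc.leaf, rk_bot]; have := h.one_le_rk hxb; omega)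
      exact ⟨m, hm, fun _ _ _ => he⟩
    · exact ⟨1, ⟨le_rfl, by omega⟩, fun h1 h2 h3 => absurd ⟨h1, h2, h3⟩ hx⟩
  choose m hm1 hm2 using hnum
  -- With the choices `m`, the neighbor of `v` in the direction of `u` would be `u` itself. Changing
  -- the choice at `w` alone gives a leaf that still lies below `w`, since the split node where this
  -- choice acts is a descendant of `w`.
  obtain ⟨d, hd, hdm⟩ : ∃ d ∈ Set.Icc 1 b, d ≠ m w := by
    by_cases hmw : m w = 1
    · exact ⟨2, ⟨by omega, by omega⟩, by omega⟩
    · exact ⟨1, ⟨le_rfl, by omega⟩, by omega⟩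
  obtain ⟨k, hk, hku⟩ := h.isNum_dir hc.internal hc.lt
  obtain ⟨u', ⟨hl, hku'⟩, -⟩ := h.existsUnique_link (c := Function.update m w d) (fun x => by
    by_cases hx : x = w
    · subst hx; simpa using hd
    · simpa [hx] using hm1 x) hc.internal hk
  have hwu' : w < u' := by
    have key : w ≤ u' ∨ u' ≤ w := h.le_or_le_of_dir fun g hg h3 h4 => by
      have hgr := h.not_isReflect hg
      rcases ancestors_lt_trichotomy h3.le h1.le with h5 | h5 | h5
      · rw [h.symb_child hg h5 h1.le, h.symb_child hg h5 hl.lt.le]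
      · subst h5
        rw [hku', ← hku, h.symb_child hc.internal h1 h2.le]
      · rw [← h.symb_child hg h3 h2.le]
        obtain ⟨e1, e2⟩ := (h.link_iff hc.internal hl.leaf hl.lt).1 hl g hg h5 h4
        rcases ancestors_lt_trichotomy (h.mate_lt g hgr).le h5.le with h6 | h6 | h6
        · rw [e1 h6, (h.cand_iff hc.internal hc.leaf hc.lt).1 hc g hg h5 (h3.trans h2) h6]
        · exact absurd (h6 ▸ h.mate_reflect g hgr) (h.not_isReflect hc.internal)
        · have h7 : mate g ≠ w := fun e => (h.mate_lt g hgr).not_gt (e ▸ h3)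
          rw [e2 h6, Function.update_of_ne h7, hm2 (mate g) (h.mate_reflect g hgr) h6
            ((h.mate_lt g hgr).trans (h3.trans h2))]
    rcases key with h3 | h3
    · exact h3.lt_of_ne fun e => not_isReflect_leaf hl.leaf (e ▸ hw)
    · exact absurd hw (h3.eq_of_not_lt (h.leaf_not_lt hl.leaf) ▸ not_isReflect_leaf hl.leaf)
  refine ⟨u', hl.toCand, hwu', ?_⟩
  rw [hl.choice w hw h1 hwu', hm2 w hw h1 h2]
  simpa using hdm

/-! ### Counting -/

theorem sum_numChildren [Fintype T] : ∑ s : T, numChildren s + 1 = Fintype.card T := by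
  classical
  have h1 : ((Finset.univ : Finset T).erase ⊥).card = ∑ s : T, numChildren s := by
    rw [Finset.card_eq_sum_card_fiberwise (f := Order.pred) (t := Finset.univ)
      (fun _ _ => Finset.mem_coe.2 (Finset.mem_univ _))]
    refine Finset.sum_congr rfl fun s _ => ?_
    rw [numChildren, ← Set.ncard_coe_finset]
    congr 1
    ext t
    simp only [Finset.coe_filter, Finset.mem_erase, Finset.mem_univ, and_true, Set.mem_ofPred_eq]
    constructor
    · rintro ⟨h1, rfl⟩
      exact Order.pred_covBy_of_not_isMin fun hm => h1 hm.eq_bot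
    · intro hst
      exact ⟨fun e => not_lt_bot (e ▸ hst.1), hst.pred_eq⟩
  rw [← h1, Finset.card_erase_add_one (Finset.mem_univ _), Finset.card_univ]

/-- Reflect nodes contribute one to both sides of `sum_numChildren` and cancel, so the formula is
that of a `b`-ary tree with the reflect nodes contracted. -/
theorem card_internal (h : Layout b T ℓ mate) :
    b * {v : T | numChildren v = b}.ncard + 1 =
      {v : T | numChildren v = b}.ncard + {v : T | numChildren v = 0}.ncard := by
  classical
  have := h.finite
  have := Fintype.ofFinite T
  have hb := h.three_le
  have h1 : ∀ s : T, numChildren s = b * (if numChildren s = b then 1 else 0) +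
      (if IsReflect s then 1 else 0) := by
    intro s
    by_cases hr : IsReflect s
    · have h1 : numChildren s = 1 := hr
      rw [if_neg (by omega), if_pos hr, h1, mul_zero]
    · rcases h.children_cases s hr with h0 | h0
      · rw [if_neg (by omega), if_neg hr, h0, mul_zero]
      · rw [if_pos h0, if_neg hr, h0, mul_one, add_zero]
  have h2 : ∀ s : T, 1 = (if numChildren s = b then 1 else 0) +
      (if numChildren s = 0 then 1 else 0) + (if IsReflect s then 1 else 0) := by
    intro s
    by_cases hr : IsReflect s
    · have h1 : numChildren s = 1 := hr
      rw [if_neg (by omega), if_neg (by omega), if_pos hr]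
    · rcases h.children_cases s hr with h0 | h0
      · rw [if_neg (by omega), if_neg hr, if_pos h0]
      · rw [if_pos h0, if_neg hr, if_neg (by omega)]
  have e1 := Finset.sum_congr rfl fun s (_ : s ∈ (Finset.univ : Finset T)) => h1 s
  have e2 := Finset.sum_congr rfl fun s (_ : s ∈ (Finset.univ : Finset T)) => h2 s
  rw [Finset.sum_add_distrib, ← Finset.mul_sum] at e1
  rw [Finset.sum_add_distrib, Finset.sum_add_distrib, ← Finset.card_eq_sum_ones,
    Finset.card_univ] at e2
  have hcard : ∀ k, {v : T | numChildren v = k}.ncard =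
      ∑ s : T, (if numChildren s = k then 1 else 0) := by
    intro k
    rw [Set.ncard_eq_toFinset_card', Finset.card_eq_sum_ones, ← Finset.sum_filter]
    congr 1
    ext
    simp
  have hs : Finset.univ.sum numChildren + 1 = Fintype.card T := sum_numChildren
  rw [hcard, hcard]
  omega

theorem split_eq (h : Layout b T ℓ mate) :
    {v : T | ¬ IsReflect v} = {v : T | numChildren v = b} ∪ {v : T | numChildren v = 0} := by
  ext v
  simp only [Set.mem_ofPred_eq, Set.mem_union]
  constructor
  · exact fun hv => (h.children_cases v hv).symm
  · rintro (hv | hv)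
    · exact h.not_isReflect hv
    · exact not_isReflect_leaf hv

theorem ncard_split (h : Layout b T ℓ mate) :
    {v : T | ¬ IsReflect v}.ncard =
      {v : T | numChildren v = b}.ncard + {v : T | numChildren v = 0}.ncard := by
  have := h.finite
  rw [h.split_eq, Set.ncard_union_eq]
  rw [Set.disjoint_left]
  intro v (hv : numChildren v = b) (hv' : numChildren v = 0)
  have := h.three_le
  omega

end Layout

/-- The number in an optional symbol. -/
def numVal : Option Symbol → ℕ
  | some (.num k) => k
  | _ => 0

theorem IsNum.eq_numVal {b : ℕ} {o : Option Symbol} (h : IsNum b o) :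
    o = some (.num (numVal o)) := by
  obtain ⟨k, _, rfl⟩ := h
  rfl

theorem IsNum.numVal_mem {b : ℕ} {o : Option Symbol} (h : IsNum b o) :
    numVal o ∈ Set.Icc 1 b := by
  obtain ⟨k, hk, rfl⟩ := h
  exact hk

/-- The pairs `(v, u)` for which `v` and `u` are adjacent depending on the choices made. -/
def slots (b : ℕ) {T : RootedTree} (ℓ : T → Word) : Set (T × T) :=
  {p | Cand b ℓ p.1 p.2 ∧ ∃ w, IsReflect w ∧ p.1 < w ∧ w < p.2}

namespace Layout

variable {b : ℕ} {T : RootedTree} {ℓ : T → Word} {mate : T → T}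

/-- A potential adjacency is encoded by its leaf and its number there (`existsUnique_cand`). -/
theorem ncard_cand (h : Layout b T ℓ mate) :
    {p : T × T | Cand b ℓ p.1 p.2}.ncard = {v : T | numChildren v = 0}.ncard * b := by
  have := h.finite
  have hb : b = (Set.Icc 1 b).ncard := by
    rw [Set.ncard_eq_toFinset_card', Set.toFinset_Icc, Nat.card_Icc]
    omega
  rw [hb, ← Set.ncard_prod, ← hb]
  refine Set.ncard_congr (fun p _ => (p.2, numVal (symb (ℓ p.1) 1))) ?_ ?_ ?_
  · rintro ⟨v, u⟩ (hp : Cand b ℓ v u)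
    exact ⟨hp.leaf, (h.isNum_symb_one hp.internal).numVal_mem⟩
  · rintro ⟨v, u⟩ ⟨v', u'⟩ (hp : Cand b ℓ v u) (hp' : Cand b ℓ v' u') he
    simp only [Prod.mk.injEq] at he
    obtain ⟨rfl, he⟩ := he
    have h1 := h.isNum_symb_one hp.internal
    rw [(h.existsUnique_cand hp.leaf h1.numVal_mem).unique ⟨hp, h1.eq_numVal⟩
      ⟨hp', he ▸ (h.isNum_symb_one hp'.internal).eq_numVal⟩]
  · rintro ⟨u, k⟩ ⟨hu, hk⟩
    obtain ⟨v, ⟨hc, hv⟩, -⟩ := h.existsUnique_cand hu hk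
    exact ⟨(v, u), hc, by simp [hv, numVal]⟩

/-- With no reflect node in between there is no choice to respect, so such a pair is linked for
every `c`. Taking `c` constant, `existsUnique_link` allows only one per direction. -/
theorem ncard_cand_diff_slots_le (h : Layout b T ℓ mate) :
    ({p : T × T | Cand b ℓ p.1 p.2} \ slots b ℓ).ncard ≤
      {v : T | numChildren v = b}.ncard * b := by
  have := h.finite
  have hb : b = (Set.Icc 1 b).ncard := by
    rw [Set.ncard_eq_toFinset_card', Set.toFinset_Icc, Nat.card_Icc]
    omega
  have h3 := h.three_le
  conv_rhs => rw [hb, ← Set.ncard_prod, ← hb]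
  refine Set.ncard_le_ncard_of_injOn
    (fun p => (p.1, numVal (symb (ℓ p.2) (rk (mate p.1) + 1)))) ?_ ?_ (Set.toFinite _)
  · rintro ⟨v, u⟩ ⟨hp, -⟩
    have hp : Cand b ℓ v u := hp
    exact ⟨hp.internal, (h.isNum_dir hp.internal hp.lt).numVal_mem⟩
  · rintro ⟨v, u⟩ ⟨hp, hs⟩ ⟨v', u'⟩ ⟨hp', hs'⟩ he
    have hp : Cand b ℓ v u := hp
    have hp' : Cand b ℓ v' u' := hp'
    simp only [Prod.mk.injEq] at he
    obtain ⟨rfl, he⟩ := he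
    have hn := h.isNum_dir hp.internal hp.lt
    rw [(h.existsUnique_link (c := fun _ => 1) (fun _ => ⟨le_rfl, by omega⟩) hp.internal
      hn.numVal_mem).unique ⟨⟨hp, fun w hw h1 h2 => absurd ⟨hp, w, hw, h1, h2⟩ hs⟩, hn.eq_numVal⟩
      ⟨⟨hp', fun w hw h1 h2 => absurd ⟨hp', w, hw, h1, h2⟩ hs'⟩,
        he ▸ (h.isNum_dir hp'.internal hp'.lt).eq_numVal⟩]

theorem exists_internal (h : Layout b T ℓ mate) : ∃ v : T, numChildren v = b := by
  have h3 := h.three_le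
  obtain ⟨u, -, hu, -⟩ := h.exists_leaf (fun _ => 1) (fun _ => ⟨le_rfl, by omega⟩) ⊥
  obtain ⟨v, ⟨hc, -⟩, -⟩ := h.existsUnique_cand hu (k := 1) ⟨le_rfl, by omega⟩
  exact ⟨v, hc.internal⟩

/-- Leaves outnumber internal split nodes, so `b` potential neighbors per leaf are more than `b`
permanent neighbors per internal node can account for. Some slot is needed to carry the surplus
vertices of an instance. -/
theorem slots_nonempty (h : Layout b T ℓ mate) : (slots b ℓ).Nonempty := by
  have := h.finite
  by_contra! he
  have h1 := h.ncard_cand_diff_slots_le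
  rw [he, Set.sdiff_empty, h.ncard_cand] at h1
  have h2 := h.card_internal
  have h3 := h.three_le
  have h4 : 0 < {v : T | numChildren v = b}.ncard := (Set.ncard_pos (Set.toFinite _)).2
    h.exists_internal
  nlinarith

/-- No pair with a maximal internal node `v` is a slot: a reflect node between `v` and a leaf would
be matched with an internal node below `v`. -/
theorem ncard_slots_lt (h : Layout b T ℓ mate) :
    (slots b ℓ).ncard < {v : T | numChildren v = 0}.ncard * b := by
  have := h.finite
  have h3 := h.three_le
  rw [← h.ncard_cand]
  refine Set.ncard_lt_ncard ⟨fun p hp => hp.1, fun hsub => ?_⟩ (Set.toFinite _)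
  obtain ⟨v, hv⟩ := (Set.toFinite {v : T | numChildren v = b}).exists_maximal h.exists_internal
  obtain ⟨u, ⟨hl, -⟩, -⟩ := h.existsUnique_link (c := fun _ => 1) (fun _ => ⟨le_rfl, by omega⟩)
    hv.1 (k := 1) ⟨le_rfl, by omega⟩
  obtain ⟨-, w, hw, h1, h2⟩ := hsub (show (v, u) ∈ {p : T × T | Cand b ℓ p.1 p.2} from hl.toCand)
  obtain ⟨g, hg, rfl, h5, h6⟩ := h.matched u w hl.leaf hw h2
  rcases h6.eq_or_lt with rfl | h6
  · rw [h.mate_leaf hl.leaf] at h1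
    exact not_lt_bot h1
  · have := hv.2 (h.internal_of_lt hg h6) (h1.trans h5).le
    exact (h1.trans h5).not_ge this

/-- With `i` internal nodes and `f` leaves, `i + f = b * i + 1`, and there are at most `b * f - 1`
slots; the strict inequality of `ncard_slots_lt` pays for the `+ 1`. -/
theorem card_split_add_slots_le (h : Layout b T ℓ mate) :
    {v : T | ¬ IsReflect v}.ncard + (slots b ℓ).ncard ≤ b * {v : T | ¬ IsReflect v}.ncard := by
  have h1 := h.ncard_slots_lt
  have h2 := h.card_internal
  rw [h.ncard_split]
  nlinarith

end Layout

/-! ### The instances -/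

/-- The nodes of the instances: the split nodes of the construction tree, one node for each slot,
and `r` further nodes. -/
abbrev Vtx (b : ℕ) {T : RootedTree} (ℓ : T → Word) (r : ℕ) : Type _ :=
  {v : T // ¬ IsReflect v} ⊕ slots b ℓ ⊕ Fin r

/-- A twin of a slot belongs to the same internal node, and is never occupied at the same time. -/
def IsTwin {b : ℕ} {T : RootedTree} {ℓ : T → Word} (tw : slots b ℓ → slots b ℓ) : Prop :=
  ∀ p, (tw p).1.1 = p.1.1 ∧
    ∀ c, ¬ (Link b ℓ c p.1.1 p.1.2 ∧ Link b ℓ c (tw p).1.1 (tw p).1.2)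

theorem exists_anyPort {V : Type*} [Finite V] (N : Set V) :
    ∃ f : V → ℕ, Set.BijOn f N (Set.Icc 1 N.ncard) := by
  have : (Set.Icc 1 N.ncard).ncard = N.ncard := by
    rw [Set.ncard_eq_toFinset_card', Set.toFinset_Icc, Nat.card_Icc]
    omega
  exact (Set.toFinite N).exists_bijOn_of_encard_eq (by
    rw [← (Set.toFinite N).cast_ncard_eq, ← (Set.finite_Icc _ _).cast_ncard_eq, this])

/-- Some numbering of a finite set. -/
noncomputable def anyPort {V : Type*} [Finite V] (N : Set V) : V → ℕ := (exists_anyPort N).choose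

theorem bijOn_anyPort {V : Type*} [Finite V] (N : Set V) :
    Set.BijOn (anyPort N) N (Set.Icc 1 N.ncard) := (exists_anyPort N).choose_spec

theorem Cand.not_isReflect_leaf {b : ℕ} {T : RootedTree} {ℓ : T → Word} {v u : T}
    (hc : Cand b ℓ v u) : ¬ IsReflect u := Layout.not_isReflect_leaf hc.leaf

section Instance

variable {b : ℕ} {T : RootedTree} {ℓ : T → Word} {mate : T → T} {r : ℕ}

open Classical in
/-- The node to which the node of a slot is attached: the leaf of the slot, if it is not occupied,
and else the twin of the slot. -/
noncomputable def attach (tw : slots b ℓ → slots b ℓ) (c : T → ℕ) (p : slots b ℓ) : Vtx b ℓ r :=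
  if Link b ℓ c p.1.1 p.1.2 then .inr (.inl (tw p)) else .inl ⟨p.1.2, p.2.1.not_isReflect_leaf⟩

/-- The edges of the instance given by the choices `c`. -/
inductive Edge (tw : slots b ℓ → slots b ℓ) (p0 : slots b ℓ) (c : T → ℕ) :
    Vtx b ℓ r → Vtx b ℓ r → Prop
  | link {v u : {v : T // ¬ IsReflect v}} (h : Link b ℓ c v u) : Edge tw p0 c (.inl v) (.inl u)
  | slot (p : slots b ℓ) : Edge tw p0 c (.inr (.inl p)) (attach tw c p)
  | rest (i : Fin r) : Edge tw p0 c (.inr (.inr i)) (.inr (.inl p0))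

theorem Edge.ne {tw : slots b ℓ → slots b ℓ} (htw : IsTwin tw) {p0 : slots b ℓ} {c : T → ℕ}
    {x y : Vtx b ℓ r} (he : Edge tw p0 c x y) : x ≠ y := by
  cases he with
  | link h =>
    intro e
    exact h.lt.ne (congrArg Subtype.val (Sum.inl.inj e))
  | slot p =>
    intro e
    unfold attach at e
    split_ifs at e with hl
    have hp : p = tw p := Sum.inl.inj (Sum.inr.inj e)
    exact (htw p).2 c ⟨hl, hp ▸ hl⟩
  | rest i => simp

/-- The instance given by the choices `c`, without port numbers. -/
def instGraph (tw : slots b ℓ → slots b ℓ) (htw : IsTwin tw) (p0 : slots b ℓ) (c : T → ℕ) :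
    SimpleGraph (Vtx b ℓ r) where
  Adj x y := Edge tw p0 c x y ∨ Edge tw p0 c y x
  symm := ⟨fun _ _ h => h.symm⟩
  loopless := ⟨fun _ h => h.elim (fun h => h.ne htw rfl) fun h => h.ne htw rfl⟩

variable {tw : slots b ℓ → slots b ℓ} {htw : IsTwin tw} {p0 : slots b ℓ} {c : T → ℕ}

theorem adj_split_split (htw : IsTwin tw) {v u : {v : T // ¬ IsReflect v}} :
    (instGraph (r := r) tw htw p0 c).Adj (.inl v) (.inl u) ↔
      Link b ℓ c v u ∨ Link b ℓ c u v := by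
  constructor
  · rintro (h | h)
    · cases h with | link h => exact .inl h
    · cases h with | link h => exact .inr h
  · rintro (h | h)
    · exact .inl (.link h)
    · exact .inr (.link h)

theorem adj_split_slot (htw : IsTwin tw) {u : {v : T // ¬ IsReflect v}} {p : slots b ℓ} :
    (instGraph (r := r) tw htw p0 c).Adj (.inl u) (.inr (.inl p)) ↔
      p.1.2 = u ∧ ¬ Link b ℓ c p.1.1 p.1.2 := by
  have key : ∀ x y : Vtx b ℓ r, x = .inl u → y = .inr (.inl p) → Edge tw p0 c y x →
      p.1.2 = u ∧ ¬ Link b ℓ c p.1.1 p.1.2 := by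
    intro x y hx hy he
    cases he with
    | link h => cases hy
    | rest i => cases hx
    | slot q =>
      obtain rfl := Sum.inl.inj (Sum.inr.inj hy)
      unfold attach at hx
      split_ifs at hx with hl
      exact ⟨congrArg Subtype.val (Sum.inl.inj hx), hl⟩
  constructor
  · rintro (h | h)
    · cases h
    · exact key _ _ rfl rfl h
  · rintro ⟨h1, h2⟩
    right
    have : (.inl u : Vtx b ℓ r) = attach tw c p := by
      rw [attach, if_neg h2]
      congr
      exact Subtype.ext h1.symm
    rw [this]
    exact .slot p

theorem not_adj_split_rest (htw : IsTwin tw) {u : {v : T // ¬ IsReflect v}} {i : Fin r} :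
    ¬ (instGraph (r := r) tw htw p0 c).Adj (.inl u) (.inr (.inr i)) := by
  rintro (h | h) <;> cases h

theorem adj_slot_slot (htw : IsTwin tw) {p q : slots b ℓ} :
    (instGraph (r := r) tw htw p0 c).Adj (.inr (.inl p)) (.inr (.inl q)) ↔
      (q = tw p ∧ Link b ℓ c p.1.1 p.1.2) ∨ (p = tw q ∧ Link b ℓ c q.1.1 q.1.2) := by
  have key : ∀ (p q : slots b ℓ) (x y : Vtx b ℓ r), x = .inr (.inl p) → y = .inr (.inl q) →
      Edge tw p0 c x y → q = tw p ∧ Link b ℓ c p.1.1 p.1.2 := by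
    intro p q x y hx hy he
    cases he with
    | link h => cases hy
    | rest i => cases hx
    | slot p' =>
      obtain rfl := Sum.inl.inj (Sum.inr.inj hx)
      unfold attach at hy
      split_ifs at hy with hl
      exact ⟨(Sum.inl.inj (Sum.inr.inj hy)).symm, hl⟩
  have key' : ∀ p q : slots b ℓ, q = tw p → Link b ℓ c p.1.1 p.1.2 →
      Edge (r := r) tw p0 c (.inr (.inl p)) (.inr (.inl q)) := by
    rintro p _ rfl hl
    have : (.inr (.inl (tw p)) : Vtx b ℓ r) = attach tw c p := by rw [attach, if_pos hl]
    rw [this]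
    exact .slot p
  constructor
  · rintro (h | h)
    · exact .inl (key _ _ _ _ rfl rfl h)
    · exact .inr (key _ _ _ _ rfl rfl h)
  · rintro (⟨h1, h2⟩ | ⟨h1, h2⟩)
    · exact .inl (key' _ _ h1 h2)
    · exact .inr (key' _ _ h1 h2)

theorem adj_slot_rest (htw : IsTwin tw) {p : slots b ℓ} {i : Fin r} :
    (instGraph (r := r) tw htw p0 c).Adj (.inr (.inl p)) (.inr (.inr i)) ↔ p = p0 := by
  constructor
  · rintro (h | h)
    · have key : ∀ x y : Vtx b ℓ r, y = .inr (.inr i) → ¬ Edge tw p0 c x y := by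
        intro x y hy he
        cases he with
        | link h => cases hy
        | rest i => cases hy
        | slot p' =>
          unfold attach at hy
          split_ifs at hy
          cases hy
      exact absurd h (key _ _ rfl)
    · cases h with | rest i => rfl
  · rintro rfl
    exact .inr (.rest i)

theorem not_adj_rest_rest (htw : IsTwin tw) {i j : Fin r} :
    ¬ (instGraph (r := r) tw htw p0 c).Adj (.inr (.inr i)) (.inr (.inr j)) := by
  rintro (h | h) <;> cases h

-- Induction from the leaves of `T` upwards: below each child of a split node `t` the split nodes
-- are connected to each other, and `t` has a link in the direction of each child.
variable (htw p0) in
theorem reachable_split (h : Layout b T ℓ mate) (hc : ∀ w, c w ∈ Set.Icc 1 b) (t : T) :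
    ∀ s s' : {v : T // ¬ IsReflect v}, t ≤ s.1 → t ≤ s'.1 →
      (instGraph (r := r) tw htw p0 c).Reachable (.inl s) (.inl s') := by
  have := h.finite
  induction t using (wellFounded_gt (α := T)).induction with
  | _ t ih =>
    by_cases hr : IsReflect t
    · intro s s' hs hs'
      have hlt : t < s.1 := hs.lt_of_ne fun e => s.2 (e ▸ hr)
      have hlt' : t < s'.1 := hs'.lt_of_ne fun e => s'.2 (e ▸ hr)
      obtain ⟨a, ha, has⟩ := exists_child_le hlt
      obtain ⟨a', ha', has'⟩ := exists_child_le hlt'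
      obtain ⟨x, hx⟩ := Set.ncard_eq_one.1 hr
      have e1 : a ∈ ({x} : Set T) := hx ▸ ha
      have e2 : a' ∈ ({x} : Set T) := hx ▸ ha'
      obtain rfl : a = a' := e1.trans e2.symm
      exact ih a ha.1 s s' has has'
    · have key : ∀ s : {v : T // ¬ IsReflect v}, t ≤ s.1 →
          (instGraph (r := r) tw htw p0 c).Reachable (.inl s) (.inl ⟨t, hr⟩) := by
        intro s hs
        rcases hs.eq_or_lt with rfl | hlt
        · exact .rfl
        obtain ⟨a, ha, has⟩ := exists_child_le hlt
        have hb := h.internal_of_lt hr hlt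
        have hn := h.isNum_dir hb hlt
        obtain ⟨u, ⟨hl, hu⟩, -⟩ := h.existsUnique_link hc hb hn.numVal_mem
        obtain ⟨a', ha', hau'⟩ := exists_child_le hl.lt
        obtain rfl := h.child_eq_of_dir hb ha ha' has hau' (hn.eq_numVal.trans hu.symm)
        refine (ih a ha.1 s ⟨u, hl.not_isReflect_leaf⟩ has hau').trans ?_
        exact SimpleGraph.Adj.reachable ((adj_split_split htw).2 (.inr hl))
      intro s s' hs hs'
      exact (key s hs).trans (key s' hs').symm

theorem instGraph_connected (h : Layout b T ℓ mate) (hc : ∀ w, c w ∈ Set.Icc 1 b) :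
    (instGraph (r := r) tw htw p0 c).Connected := by
  obtain ⟨v0, hv0⟩ := h.exists_internal
  have h1 : ∀ s, (instGraph (r := r) tw htw p0 c).Reachable (.inl s)
      (.inl ⟨v0, h.not_isReflect hv0⟩) :=
    fun s => reachable_split htw p0 h hc ⊥ _ _ bot_le bot_le
  have h2 : ∀ p : slots b ℓ, ¬ Link b ℓ c p.1.1 p.1.2 →
      (instGraph (r := r) tw htw p0 c).Reachable (.inr (.inl p))
      (.inl ⟨v0, h.not_isReflect hv0⟩) := fun p hp =>
    (SimpleGraph.Adj.reachable ((adj_split_slot htw (u := ⟨p.1.2, p.2.1.not_isReflect_leaf⟩)).2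
      ⟨rfl, hp⟩).symm).trans (h1 _)
  have h3 : ∀ p : slots b ℓ, (instGraph (r := r) tw htw p0 c).Reachable (.inr (.inl p))
      (.inl ⟨v0, h.not_isReflect hv0⟩) := by
    intro p
    by_cases hp : Link b ℓ c p.1.1 p.1.2
    · exact (SimpleGraph.Adj.reachable ((adj_slot_slot htw).2 (.inl ⟨rfl, hp⟩))).trans
        (h2 (tw p) fun hp' => (htw p).2 c ⟨hp, hp'⟩)
    · exact h2 p hp
  have h4 : ∀ x, (instGraph (r := r) tw htw p0 c).Reachable x
      (.inl ⟨v0, h.not_isReflect hv0⟩) := by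
    rintro (s | p | i)
    · exact h1 s
    · exact h3 p
    · exact (SimpleGraph.Adj.reachable ((adj_slot_rest htw).2 rfl).symm).trans (h3 p0)
  have : Nonempty (Vtx b ℓ r) := ⟨.inl ⟨v0, h.not_isReflect hv0⟩⟩
  exact ⟨fun x y => (h4 x).trans (h4 y).symm⟩

theorem ncard_link_le (h : Layout b T ℓ mate) (hc : ∀ w, c w ∈ Set.Icc 1 b) :
    {p : T × T | Link b ℓ c p.1 p.2}.ncard ≤ b * {v : T | numChildren v = b}.ncard := by
  have := h.finite
  have hb : b = (Set.Icc 1 b).ncard := by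
    rw [Set.ncard_eq_toFinset_card', Set.toFinset_Icc, Nat.card_Icc]
    omega
  rw [mul_comm]
  conv_rhs => rw [hb, ← Set.ncard_prod, ← hb]
  refine Set.ncard_le_ncard_of_injOn
    (fun p => (p.1, numVal (symb (ℓ p.2) (rk (mate p.1) + 1)))) ?_ ?_ (Set.toFinite _)
  · rintro ⟨v, u⟩ (hp : Link b ℓ c v u)
    exact ⟨hp.internal, (h.isNum_dir hp.internal hp.lt).numVal_mem⟩
  · rintro ⟨v, u⟩ (hp : Link b ℓ c v u) ⟨v', u'⟩ (hp' : Link b ℓ c v' u') he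
    simp only [Prod.mk.injEq] at he
    obtain ⟨rfl, he⟩ := he
    have hn := h.isNum_dir hp.internal hp.lt
    rw [(h.existsUnique_link hc hp.internal hn.numVal_mem).unique ⟨hp, hn.eq_numVal⟩
      ⟨hp', he ▸ (h.isNum_dir hp'.internal hp'.lt).eq_numVal⟩]

/-- Connectedness leaves only an upper bound on the edges to be shown. Each edge stems from a link,
a slot or a further vertex, and there are at most `b` links per internal node, which is one less
than the number of split nodes in total. -/
theorem instGraph_isTree (h : Layout b T ℓ mate) (hc : ∀ w, c w ∈ Set.Icc 1 b) :
    (instGraph (r := r) tw htw p0 c).IsTree := by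
  have := h.finite
  have hconn := instGraph_connected (r := r) (htw := htw) (p0 := p0) h hc
  refine SimpleGraph.isTree_iff_connected_and_card.2 ⟨hconn, ?_⟩
  refine le_antisymm ?_ hconn.card_vert_le_card_edgeSet_add_one
  let F : {p : T × T | Link b ℓ c p.1 p.2} ⊕ slots b ℓ ⊕ Fin r → Sym2 (Vtx b ℓ r)
    | .inl p => s(.inl ⟨p.1.1, h.not_isReflect p.2.internal⟩,
        .inl ⟨p.1.2, p.2.not_isReflect_leaf⟩)
    | .inr (.inl p) => s(.inr (.inl p), attach tw c p)
    | .inr (.inr i) => s(.inr (.inr i), .inr (.inl p0))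
  have hF : ∀ x y, Edge (r := r) tw p0 c x y → s(x, y) ∈ Set.range F := by
    intro x y he
    cases he with
    | @link v u hl => exact ⟨.inl ⟨(v, u), hl⟩, rfl⟩
    | slot p => exact ⟨.inr (.inl p), rfl⟩
    | rest i => exact ⟨.inr (.inr i), rfl⟩
  have hsub : (instGraph (r := r) tw htw p0 c).edgeSet ⊆ Set.range F := by
    intro e
    induction e using Sym2.ind with
    | _ x y =>
      rintro (he | he)
      · exact hF x y he
      · rw [Sym2.eq_swap]
        exact hF y x he
  have h1 : Nat.card (instGraph (r := r) tw htw p0 c).edgeSet ≤ Nat.card (Set.range F) :=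
    Nat.card_mono (Set.toFinite _) hsub
  have h2 : Nat.card (Set.range F) ≤
      {p : T × T | Link b ℓ c p.1 p.2}.ncard + ((slots b ℓ).ncard + r) := by
    refine (Finite.card_range_le F).trans_eq ?_
    rw [Nat.card_sum, Nat.card_sum, Nat.card_fin, Nat.card_coe_set_eq, Nat.card_coe_set_eq]
  have h3 : Nat.card (Vtx b ℓ r) =
      {v : T | ¬ IsReflect v}.ncard + ((slots b ℓ).ncard + r) := by
    rw [Nat.card_sum, Nat.card_sum, Nat.card_fin, Nat.card_coe_set_eq]
    rfl
  have h4 := ncard_link_le h hc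
  have h5 := h.card_internal
  rw [h3, h.ncard_split]
  omega

/-! ### Port numbers -/

open Classical in
/-- The port numbers of the instance given by the choices `c`. -/
noncomputable def instPort [Finite T] (mate : T → T) (tw : slots b ℓ → slots b ℓ) (htw : IsTwin tw)
    (p0 : slots b ℓ) (c : T → ℕ) : Vtx b ℓ r → Vtx b ℓ r → ℕ
  | .inl v, .inl u =>
    if numChildren v.1 = 0 then numVal (symb (ℓ u) 1) else numVal (symb (ℓ u) (rk (mate v) + 1))
  -- A slot uses the port that belongs to the link it stands in for, so the ports of split nodes are
  -- independent of `c`.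
  | .inl _, .inr (.inl p) => numVal (symb (ℓ p.1.1) 1)
  | .inl _, .inr (.inr _) => 0
  -- Any numbering works, as long as it is determined by the neighbor set alone (`instPort_congr`).
  | .inr x, y => anyPort ((instGraph tw htw p0 c).neighborSet (.inr x)) y

theorem link_of_not_slot {v u : T} (hc : Cand b ℓ v u) (hs : (v, u) ∉ slots b ℓ) :
    Link b ℓ c v u :=
  ⟨hc, fun w hw h1 h2 => absurd ⟨hc, w, hw, h1, h2⟩ hs⟩

/-- At a leaf, each number has one potential neighbor, which is present either through its link or
through its slot. At an internal node, each direction has exactly one link. -/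
theorem instPort_bijOn_split [Finite T] (h : Layout b T ℓ mate) (hc : ∀ w, c w ∈ Set.Icc 1 b)
    (s : {v : T // ¬ IsReflect v}) :
    Set.BijOn (instPort (r := r) mate tw htw p0 c (.inl s))
      ((instGraph tw htw p0 c).neighborSet (.inl s)) (Set.Icc 1 b) := by
  have hb3 := h.three_le
  rcases h.children_cases s.1 s.2 with h0 | h0
  · have hb : ∀ {u}, ¬ Link b ℓ c s u := fun hl => by have := hl.internal; omega
    refine ⟨?_, ?_, ?_⟩
    · rintro (v | p | i) hx
      · have hl := ((adj_split_split htw).1 hx).resolve_left hb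
        simp only [instPort, if_pos h0]
        exact (h.isNum_symb_one hl.internal).numVal_mem
      · exact (h.isNum_symb_one p.2.1.internal).numVal_mem
      · exact absurd hx (not_adj_split_rest htw)
    · have key : ∀ x ∈ (instGraph (r := r) tw htw p0 c).neighborSet (.inl s), ∃ v,
          Cand b ℓ v s.1 ∧ instPort (r := r) mate tw htw p0 c (.inl s) x = numVal (symb (ℓ v) 1) ∧
          ((∃ hv, x = .inl ⟨v, hv⟩ ∧ Link b ℓ c v s) ∨
            ∃ hv, x = .inr (.inl ⟨(v, s.1), hv⟩) ∧ ¬ Link b ℓ c v s) := by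
        rintro (v | p | i) hx
        · have hl := ((adj_split_split htw).1 hx).resolve_left hb
          exact ⟨v, hl.toCand, by simp only [instPort, if_pos h0], .inl ⟨v.2, rfl, hl⟩⟩
        · obtain ⟨h1, h2⟩ := (adj_split_slot htw).1 hx
          obtain ⟨⟨v, u⟩, hp⟩ := p
          obtain rfl : u = s.1 := h1
          exact ⟨v, hp.1, rfl, .inr ⟨hp, rfl, h2⟩⟩
        · exact absurd hx (not_adj_split_rest htw)
      intro x hx y hy he
      obtain ⟨v, hv, e1, h1⟩ := key x hx
      obtain ⟨v', hv', e2, h2⟩ := key y hy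
      rw [e1, e2] at he
      have hn := h.isNum_symb_one hv.internal
      obtain rfl := (h.existsUnique_cand hv.leaf hn.numVal_mem).unique ⟨hv, hn.eq_numVal⟩
        ⟨hv', he ▸ (h.isNum_symb_one hv'.internal).eq_numVal⟩
      rcases h1 with ⟨_, rfl, h1⟩ | ⟨_, rfl, h1⟩ <;> rcases h2 with ⟨_, rfl, h2⟩ | ⟨_, rfl, h2⟩
      · rfl
      · exact absurd h1 h2
      · exact absurd h2 h1
      · rfl
    · intro k hk
      obtain ⟨v, ⟨hv, hvk⟩, -⟩ := h.existsUnique_cand h0 hk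
      by_cases hl : Link b ℓ c v s
      · refine ⟨.inl ⟨v, h.not_isReflect hv.internal⟩, (adj_split_split htw).2 (.inr hl), ?_⟩
        simp only [instPort, if_pos h0, hvk]
        rfl
      · refine ⟨.inr (.inl ⟨(v, s.1), ?_⟩), (adj_split_slot htw).2 ⟨rfl, hl⟩, ?_⟩
        · by_contra hs
          exact hl (link_of_not_slot hv hs)
        · simp only [instPort, hvk]
          rfl
  · have h0' : numChildren s.1 ≠ 0 := by omega
    have hb : ∀ {u}, ¬ Link b ℓ c u s := fun hl => h0' hl.leaf
    refine ⟨?_, ?_, ?_⟩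
    · rintro (v | p | i) hx
      · have hl := ((adj_split_split htw).1 hx).resolve_right hb
        simp only [instPort, if_neg h0']
        exact (h.isNum_dir hl.internal hl.lt).numVal_mem
      · exact absurd (((adj_split_slot htw).1 hx).1 ▸ p.2.1.leaf) h0'
      · exact absurd hx (not_adj_split_rest htw)
    · have key : ∀ x ∈ (instGraph (r := r) tw htw p0 c).neighborSet (.inl s), ∃ u hu,
          x = .inl ⟨u, hu⟩ ∧ Link b ℓ c s u := by
        rintro (v | p | i) hx
        · exact ⟨v, v.2, rfl, ((adj_split_split htw).1 hx).resolve_right hb⟩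
        · exact absurd (((adj_split_slot htw).1 hx).1 ▸ p.2.1.leaf) h0'
        · exact absurd hx (not_adj_split_rest htw)
      intro x hx y hy he
      obtain ⟨u, hu, rfl, hl⟩ := key x hx
      obtain ⟨u', hu', rfl, hl'⟩ := key y hy
      simp only [instPort, if_neg h0'] at he
      have hn := h.isNum_dir hl.internal hl.lt
      obtain rfl := (h.existsUnique_link hc h0 hn.numVal_mem).unique ⟨hl, hn.eq_numVal⟩
        ⟨hl', he ▸ (h.isNum_dir hl'.internal hl'.lt).eq_numVal⟩
      rfl
    · intro k hk
      obtain ⟨u, ⟨hl, huk⟩, -⟩ := h.existsUnique_link hc h0 hk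
      refine ⟨.inl ⟨u, hl.not_isReflect_leaf⟩, (adj_split_split htw).2 (.inl hl), ?_⟩
      simp only [instPort, if_neg h0', huk]
      rfl

theorem ncard_Icc_one (b : ℕ) : (Set.Icc 1 b).ncard = b := by
  rw [Set.ncard_eq_toFinset_card', Set.toFinset_Icc, Nat.card_Icc]
  omega

theorem ncard_neighborSet_split (h : Layout b T ℓ mate) (hc : ∀ w, c w ∈ Set.Icc 1 b)
    (s : {v : T // ¬ IsReflect v}) :
    ((instGraph (r := r) tw htw p0 c).neighborSet (.inl s)).ncard = b := by
  have := h.finite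
  have hb := instPort_bijOn_split (r := r) (htw := htw) (p0 := p0) h hc s
  rw [← hb.injOn.ncard_image, hb.image_eq, ncard_Icc_one]

theorem instPort_bijOn [Finite T] (h : Layout b T ℓ mate) (hc : ∀ w, c w ∈ Set.Icc 1 b)
    (x : Vtx b ℓ r) :
    Set.BijOn (instPort (r := r) mate tw htw p0 c x) ((instGraph tw htw p0 c).neighborSet x)
      (Set.Icc 1 ((instGraph tw htw p0 c).neighborSet x).ncard) := by
  rcases x with s | x
  · rw [ncard_neighborSet_split h hc]
    exact instPort_bijOn_split h hc s
  · exact bijOn_anyPort _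

end Instance

/-! ### Information revealed inside regions -/

theorem walk_transfer {V : Type*} {G G' : SimpleGraph V} {R : Set V}
    (hadj : ∀ a ∈ R, ∀ b ∈ R, G.Adj a b → G'.Adj a b) {a x : V} (q : G.Walk a x)
    (hq : ∀ y ∈ q.support, y ∈ R) : ∃ q' : G'.Walk a x, q'.length = q.length := by
  induction q with
  | nil => exact ⟨.nil, rfl⟩
  | @cons a b x hab q ih =>
    obtain ⟨q', hq'⟩ := ih fun y hy => hq y (List.mem_cons_of_mem _ hy)
    exact ⟨.cons (hadj a (hq a (by simp)) b (hq b (by simp)) hab) q', by simp [hq']⟩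

/-- Follow the walk backwards from `x`. The first step out of `R` would come after a part of length
at least `L` inside `R`, and the step itself exceeds the bound. So exits at distance exactly `L` are
allowed. -/
theorem support_subset_of_far {V : Type*} {G : SimpleGraph V} {R : Set V} {x : V} (hx : x ∈ R)
    {L : ℕ} (hfar : ∀ a ∈ R, ∀ b ∉ R, G.Adj a b → ∀ q : G.Walk a x,
      (∀ y ∈ q.support, y ∈ R) → L ≤ q.length) {a : V} (q : G.Walk a x) (hq : q.length ≤ L) :
    ∀ y ∈ q.support, y ∈ R := by
  induction q with
  | nil => simpa using hx
  | @cons a b x hab q ih =>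
    rw [SimpleGraph.Walk.length_cons] at hq
    have h1 := ih hx hfar (by omega)
    have ha : a ∈ R := by
      by_contra ha
      have := hfar b (h1 b (by simp)) a ha hab.symm q h1
      omega
    simpa using ⟨ha, by simpa using h1⟩

theorem exists_walk_of_edist_le {V : Type*} {G : SimpleGraph V} {x a : V} {L : ℕ}
    (h : G.edist x a ≤ L) : ∃ q : G.Walk a x, q.length ≤ L := by
  have hr : G.Reachable x a := by
    rw [← SimpleGraph.edist_ne_top_iff_reachable]
    exact ne_top_of_le_ne_top (by simp) h
  obtain ⟨q, hq⟩ := hr.exists_walk_length_eq_edist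
  refine ⟨q.reverse, ?_⟩
  rw [← hq] at h
  simpa using h

theorem edist_le_of_walk {V : Type*} {G : SimpleGraph V} {x a : V} {L : ℕ} (q : G.Walk a x)
    (hq : q.length ≤ L) : G.edist x a ≤ L :=
  (SimpleGraph.Walk.edist_le q.reverse).trans (by simpa using hq)

/-- The balls of radius `L` stay inside regions on which both graphs agree, so the identity serves
as renaming. Degrees are assumed separately, since a vertex on the boundary of a ball may have
neighbors outside its region. -/
theorem sameInformation_of_regions {ι : Type*} {n L : ℕ} (G G' : PortGraph n) (s : List ι)
    (f : ι → Fin n) (R : ι → Set (Fin n)) (hmem : ∀ x ∈ s, f x ∈ R x)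
    (hadj : ∀ x ∈ s, ∀ a ∈ R x, ∀ b ∈ R x, G.graph.Adj a b ↔ G'.graph.Adj a b)
    (hdeg : ∀ x ∈ s, ∀ a ∈ R x, G.deg a = G'.deg a)
    (hport : ∀ x ∈ s, ∀ a ∈ R x, ∀ b ∈ R x, G.graph.Adj a b → G.port a b = G'.port a b)
    (hfar : ∀ x ∈ s, ∀ a ∈ R x, ∀ b ∉ R x, G.graph.Adj a b → ∀ q : G.graph.Walk a (f x),
      (∀ y ∈ q.support, y ∈ R x) → L ≤ q.length)
    (hfar' : ∀ x ∈ s, ∀ a ∈ R x, ∀ b ∉ R x, G'.graph.Adj a b → ∀ q : G'.graph.Walk a (f x),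
      (∀ y ∈ q.support, y ∈ R x) → L ≤ q.length) :
    G.SameInformation L (s.map f) G' (s.map f) := by
  have ball : ∀ x ∈ s, ∀ a, G.graph.edist (f x) a ≤ L → a ∈ R x := by
    intro x hx a ha
    obtain ⟨q, hq⟩ := exists_walk_of_edist_le ha
    exact support_subset_of_far (hmem x hx) (hfar x hx) q hq a (by simp)
  have key : ∀ x ∈ s, ∀ a, G.graph.edist (f x) a ≤ L ↔ G'.graph.edist (f x) a ≤ L := by
    intro x hx a
    constructor
    · intro ha
      obtain ⟨q, hq⟩ := exists_walk_of_edist_le ha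
      obtain ⟨q', hq'⟩ := walk_transfer (fun a ha b hb => (hadj x hx a ha b hb).1) q
        (support_subset_of_far (hmem x hx) (hfar x hx) q hq)
      exact edist_le_of_walk q' (hq'.trans_le hq)
    · intro ha
      obtain ⟨q, hq⟩ := exists_walk_of_edist_le ha
      obtain ⟨q', hq'⟩ := walk_transfer (fun a ha b hb => (hadj x hx a ha b hb).2) q
        (support_subset_of_far (hmem x hx) (hfar' x hx) q hq)
      exact edist_le_of_walk q' (hq'.trans_le hq)
  refine ⟨Equiv.refl _, by simp, ?_, ?_, ?_, ?_⟩
  · intro v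
    simp only [PortGraph.SeenNode, List.mem_map, exists_exists_and_eq_and]
    exact exists_congr fun x => and_congr_right fun hx => key x hx v
  · intro v hv
    simp only [PortGraph.SeenNode, List.mem_map, exists_exists_and_eq_and] at hv
    obtain ⟨x, hx, hv⟩ := hv
    exact hdeg x hx v (ball x hx v hv)
  · intro u v
    simp only [PortGraph.SeenEdge, List.mem_map, exists_exists_and_eq_and, Equiv.refl_apply]
    constructor
    · rintro ⟨h1, x, hx, h2, h3⟩
      exact ⟨(hadj x hx u (ball x hx u h2) v (ball x hx v h3)).1 h1, x, hx, (key x hx u).1 h2,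
        (key x hx v).1 h3⟩
    · rintro ⟨h1, x, hx, h2, h3⟩
      have h2' := (key x hx u).2 h2
      have h3' := (key x hx v).2 h3
      exact ⟨(hadj x hx u (ball x hx u h2') v (ball x hx v h3')).2 h1, x, hx, h2', h3'⟩
  · intro u v huv
    simp only [PortGraph.SeenEdge, List.mem_map, exists_exists_and_eq_and] at huv
    obtain ⟨h1, x, hx, h2, h3⟩ := huv
    exact hport x hx u (ball x hx u h2) v (ball x hx v h3) h1

/-! ### The regions of the instances -/

section Region

variable {b : ℕ} {T : RootedTree} {ℓ : T → Word} {mate : T → T} {r : ℕ}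
  {tw : slots b ℓ → slots b ℓ} {p0 : slots b ℓ} {c c' : T → ℕ}

/-- The part of the instances that arises from the descendants of `w`. -/
def region (p0 : slots b ℓ) (w : T) : Set (Vtx b ℓ r)
  | .inl s => w < s
  -- Membership is decided by the internal node of the slot, not by its leaf; hence a slot and its
  -- twin lie on the same side.
  | .inr (.inl p) => w < p.1.1
  | .inr (.inr _) => w < p0.1.1

/-- The links between proper descendants of `w`. -/
def linkGraph (b : ℕ) {T : RootedTree} (ℓ : T → Word) (c : T → ℕ) (w : T) : SimpleGraph T where
  Adj s t := (w < s ∧ w < t) ∧ (Link b ℓ c s t ∨ Link b ℓ c t s)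
  symm := ⟨fun _ _ h => ⟨h.1.symm, h.2.symm⟩⟩
  loopless := ⟨fun _ h => h.2.elim (fun h => h.lt.ne rfl) fun h => h.lt.ne rfl⟩

/-- The potential neighbors above `w` of leaves below `w` have distance more than `L` from the
pivot of `w`. -/
def Far (b : ℕ) {T : RootedTree} (ℓ : T → Word) (mate : T → T) (L : ℕ) : Prop :=
  ∀ c : T → ℕ, (∀ w, c w ∈ Set.Icc 1 b) → ∀ w, IsReflect w → ∀ u v, Cand b ℓ v u → v < w → w < u →
    ∀ q : (linkGraph b ℓ c w).Walk u (pivot b ℓ mate c w), L ≤ q.length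

/-- Links join comparable nodes, so one that leaves the part below `w` joins a leaf below `w` to an
internal node above `w`. The only other exits lead from such a leaf to the slot of such a pair. -/
theorem region_exit (h : Layout b T ℓ mate) (htw : IsTwin tw) {w : T} (hw : IsReflect w) {x y : Vtx b ℓ r}
    (hx : x ∈ region p0 w) (hy : y ∉ region p0 w) (ha : (instGraph tw htw p0 c).Adj x y) :
    ∃ u v, ∃ hu : ¬ IsReflect u, x = .inl ⟨u, hu⟩ ∧ Cand b ℓ v u ∧ v < w ∧ w < u := by
  rcases x with s | p | i <;> rcases y with t | q | j
  · have hx : w < s.1 := hx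
    have hy : ¬ w < t.1 := hy
    rcases (adj_split_split htw).1 ha with hl | hl
    · exact absurd (hx.trans hl.lt) hy
    · refine ⟨s, t, s.2, rfl, hl.toCand, ?_, hx⟩
      rcases ancestors_lt_trichotomy hl.lt.le hx.le with h3 | h3 | h3
      · exact h3
      · exact absurd (h3 ▸ hw) t.2
      · exact absurd h3 hy
  · have hx : w < s.1 := hx
    have hy : ¬ w < q.1.1 := hy
    obtain ⟨h1, -⟩ := (adj_split_slot htw).1 ha
    have hcand := q.2.1
    rw [h1] at hcand
    refine ⟨s, q.1.1, s.2, rfl, hcand, ?_, hx⟩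
    rcases ancestors_lt_trichotomy hcand.lt.le hx.le with h3 | h3 | h3
    · exact h3
    · exact absurd (h3 ▸ hw) (h.not_isReflect hcand.internal)
    · exact absurd h3 hy
  · exact absurd ha (not_adj_split_rest htw)
  · have hx : w < p.1.1 := hx
    have hy : ¬ w < t.1 := hy
    obtain ⟨h1, -⟩ := (adj_split_slot htw).1 ha.symm
    exact absurd (h1 ▸ hx.trans p.2.1.lt) hy
  · have hx : w < p.1.1 := hx
    have hy : ¬ w < q.1.1 := hy
    rcases (adj_slot_slot htw).1 ha with ⟨rfl, -⟩ | ⟨rfl, -⟩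
    · rw [(htw p).1] at hy
      exact absurd hx hy
    · rw [(htw q).1] at hx
      exact absurd hx hy
  · have hx : w < p.1.1 := hx
    have hy : ¬ w < p0.1.1 := hy
    exact absurd ((adj_slot_rest htw).1 ha ▸ hx) hy
  · exact absurd ha.symm (not_adj_split_rest htw)
  · have hx : w < p0.1.1 := hx
    have hy : ¬ w < q.1.1 := hy
    exact absurd ((adj_slot_rest htw).1 ha.symm ▸ hx) hy
  · exact absurd ha (not_adj_rest_rest htw)

theorem link_congr {w v u : T} (hcc : ∀ w', w < w' → c w' = c' w') (hv : w < v) :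
    Link b ℓ c v u ↔ Link b ℓ c' v u :=
  ⟨fun h => ⟨h.toCand, fun x hx h1 h2 => hcc x (hv.trans h1) ▸ h.choice x hx h1 h2⟩,
    fun h => ⟨h.toCand, fun x hx h1 h2 => (hcc x (hv.trans h1)).symm ▸ h.choice x hx h1 h2⟩⟩

theorem adj_congr (htw : IsTwin tw) {w : T} (hcc : ∀ w', w < w' → c w' = c' w')
    {x y : Vtx b ℓ r} (hx : x ∈ region p0 w) (hy : y ∈ region p0 w) :
    (instGraph tw htw p0 c).Adj x y ↔ (instGraph tw htw p0 c').Adj x y := by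
  rcases x with s | p | i <;> rcases y with t | q | j
  · rw [adj_split_split htw, adj_split_split htw, link_congr hcc hx, link_congr hcc hy]
  · rw [adj_split_slot htw, adj_split_slot htw, link_congr hcc hy]
  · exact iff_of_false (not_adj_split_rest htw) (not_adj_split_rest htw)
  · rw [(instGraph tw htw p0 c).adj_comm, (instGraph tw htw p0 c').adj_comm, adj_split_slot htw,
      adj_split_slot htw, link_congr hcc hx]
  · rw [adj_slot_slot htw, adj_slot_slot htw, link_congr hcc hx, link_congr hcc hy]
  · rw [adj_slot_rest htw, adj_slot_rest htw]
  · rw [(instGraph tw htw p0 c).adj_comm, (instGraph tw htw p0 c').adj_comm]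
    exact iff_of_false (not_adj_split_rest htw) (not_adj_split_rest htw)
  · rw [(instGraph tw htw p0 c).adj_comm, (instGraph tw htw p0 c').adj_comm, adj_slot_rest htw,
      adj_slot_rest htw]
  · exact iff_of_false (not_adj_rest_rest htw) (not_adj_rest_rest htw)

/-- Only leaves of `T` are exits of a region, so filler vertices have their whole neighborhood
inside. -/
theorem neighborSet_congr (h : Layout b T ℓ mate) (htw : IsTwin tw) {w : T} (hw : IsReflect w)
    (hcc : ∀ w', w < w' → c w' = c' w') {x : slots b ℓ ⊕ Fin r}
    (hx : (.inr x : Vtx b ℓ r) ∈ region p0 w) :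
    (instGraph tw htw p0 c).neighborSet (.inr x) =
      (instGraph (r := r) tw htw p0 c').neighborSet (.inr x) := by
  have key : ∀ c y, (instGraph tw htw p0 c).Adj (.inr x : Vtx b ℓ r) y → y ∈ region p0 w := by
    intro c y hy
    by_contra hn
    obtain ⟨u, -, hu, he, -⟩ := region_exit h htw hw hx hn hy
    cases he
  ext y
  exact ⟨fun hy => (adj_congr htw hcc hx (key c y hy)).1 hy,
    fun hy => (adj_congr htw hcc hx (key c' y hy)).2 hy⟩

theorem instPort_congr [Finite T] (h : Layout b T ℓ mate) (htw : IsTwin tw) {w : T}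
    (hw : IsReflect w) (hcc : ∀ w', w < w' → c w' = c' w') {x y : Vtx b ℓ r}
    (hx : x ∈ region p0 w) :
    instPort mate tw htw p0 c x y = instPort mate tw htw p0 c' x y := by
  rcases x with s | x
  · rcases y with t | q | j <;> rfl
  · simp only [instPort, neighborSet_congr h htw hw hcc hx]

theorem ncard_neighborSet_congr (h : Layout b T ℓ mate) (htw : IsTwin tw) {w : T}
    (hc : ∀ w, c w ∈ Set.Icc 1 b) (hc' : ∀ w, c' w ∈ Set.Icc 1 b)
    (hw : IsReflect w) (hcc : ∀ w', w < w' → c w' = c' w') {x : Vtx b ℓ r}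
    (hx : x ∈ region p0 w) :
    ((instGraph tw htw p0 c).neighborSet x).ncard =
      ((instGraph tw htw p0 c').neighborSet x).ncard := by
  rcases x with s | x
  · rw [ncard_neighborSet_split h hc, ncard_neighborSet_split h hc']
  · rw [neighborSet_congr h htw hw hcc hx]

open Classical in
/-- The leaf from which a slot hangs. -/
noncomputable def slotRoot (tw : slots b ℓ → slots b ℓ) (c : T → ℕ) (p : slots b ℓ) : T :=
  if Link b ℓ c p.1.1 p.1.2 then (tw p).1.2 else p.1.2

/-- The split node from which a node hangs. -/
noncomputable def splitRoot (tw : slots b ℓ → slots b ℓ) (p0 : slots b ℓ) (c : T → ℕ) :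
    Vtx b ℓ r → T
  | .inl s => s
  | .inr (.inl p) => slotRoot tw c p
  | .inr (.inr _) => slotRoot tw c p0

theorem lt_slotRoot (htw : IsTwin tw) (p : slots b ℓ) : p.1.1 < slotRoot tw c p := by
  unfold slotRoot
  split_ifs
  · exact (htw p).1 ▸ (tw p).2.1.lt
  · exact p.2.1.lt

theorem lt_splitRoot (htw : IsTwin tw) {w : T} {x : Vtx b ℓ r} (hx : x ∈ region p0 w) :
    w < splitRoot tw p0 c x := by
  rcases x with s | p | i
  · exact hx
  · exact lt_trans (show w < p.1.1 from hx) (lt_slotRoot htw p)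
  · exact lt_trans (show w < p0.1.1 from hx) (lt_slotRoot htw p0)

theorem Edge.splitRoot_eq_or (htw : IsTwin tw) {x y : Vtx b ℓ r} (he : Edge tw p0 c x y) :
    splitRoot tw p0 c x = splitRoot tw p0 c y ∨
      Link b ℓ c (splitRoot tw p0 c x) (splitRoot tw p0 c y) := by
  cases he with
  | link h => exact .inr h
  | slot p =>
    left
    unfold attach
    split_ifs with hl
    · have : ¬ Link b ℓ c (tw p).1.1 (tw p).1.2 := fun h' => (htw p).2 c ⟨hl, h'⟩
      simp only [splitRoot, slotRoot, if_pos hl, if_neg this]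
    · simp only [splitRoot, slotRoot, if_neg hl]
  | rest i => exact .inl rfl

/-- Contracting every filler vertex to the split node from which it hangs turns edges into links or
points. Thus fillers provide no shortcuts, and bounds on walks along links suffice. -/
theorem exists_linkGraph_walk (htw : IsTwin tw) {w : T} {x y : Vtx b ℓ r}
    (q : (instGraph tw htw p0 c).Walk x y) (hq : ∀ z ∈ q.support, z ∈ region p0 w) :
    ∃ q' : (linkGraph b ℓ c w).Walk (splitRoot tw p0 c x) (splitRoot tw p0 c y),
      q'.length ≤ q.length := by
  induction q with
  | nil => exact ⟨.nil, le_rfl⟩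
  | @cons x z y hxz q ih =>
    obtain ⟨q', hq'⟩ := ih fun a ha => hq a (List.mem_cons_of_mem _ ha)
    have hx := lt_splitRoot (c := c) htw (hq x (by simp))
    have hz := lt_splitRoot (c := c) htw (hq z (by simp))
    have key : splitRoot tw p0 c x = splitRoot tw p0 c z ∨
        (linkGraph b ℓ c w).Adj (splitRoot tw p0 c x) (splitRoot tw p0 c z) := by
      rcases hxz with he | he
      · exact (he.splitRoot_eq_or htw).imp_right fun hl => ⟨⟨hx, hz⟩, .inl hl⟩
      · exact (he.splitRoot_eq_or htw).imp Eq.symm fun hl => ⟨⟨hx, hz⟩, .inr hl⟩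
    rcases key with he | ha
    · exact ⟨q'.copy he.symm rfl, by simp; omega⟩
    · exact ⟨.cons ha q', by simp; omega⟩

end Region

/-! ### The adversary -/

section Adversary

variable {b : ℕ} {T : RootedTree} {ℓ : T → Word} {mate : T → T} {r n : ℕ}
  {tw : slots b ℓ → slots b ℓ} {p0 : slots b ℓ} {c c' : T → ℕ}

/-- The instance given by the choices `c`, with nodes renamed by `e`. -/
noncomputable def inst [Finite T] (h : Layout b T ℓ mate) (htw : IsTwin tw) (p0 : slots b ℓ)
    (e : Vtx b ℓ r ≃ Fin n) (c : T → ℕ) (hc : ∀ w, c w ∈ Set.Icc 1 b) : PortGraph n where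
  graph := (instGraph tw htw p0 c).comap e.symm
  port x y := instPort mate tw htw p0 c (e.symm x) (e.symm y)
  port_bijOn x := by
    have h1 : ((instGraph tw htw p0 c).comap e.symm).neighborSet x =
        e '' (instGraph tw htw p0 c).neighborSet (e.symm x) := by
      ext y
      simp [Equiv.image_eq_preimage_symm]
    rw [h1, Set.ncard_image_of_injective _ e.injective]
    refine (instPort_bijOn (htw := htw) (p0 := p0) h hc (e.symm x)).comp (f := e.symm)
      ⟨?_, e.symm.injective.injOn, ?_⟩
    · rintro _ ⟨y, hy, rfl⟩
      simpa using hy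
    · exact fun y hy => ⟨e y, Set.mem_image_of_mem _ hy, by simp⟩

variable {e : Vtx b ℓ r ≃ Fin n}

open Classical in
/-- The node at which the direction is queried that is to be chosen at `w`. -/
noncomputable def pivotVtx (b : ℕ) {T : RootedTree} {ℓ : T → Word} (mate : T → T) {r : ℕ}
    (p0 : slots b ℓ) (c : T → ℕ) (w : T) : Vtx b ℓ r :=
  if hw : ¬ IsReflect (pivot b ℓ mate c w) then .inl ⟨_, hw⟩ else .inr (.inl p0)

theorem pivotVtx_eq (h : Layout b T ℓ mate) (hc : ∀ w, c w ∈ Set.Icc 1 b) {w : T}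
    (hw : IsReflect w) : pivotVtx (r := r) b mate p0 c w =
      .inl ⟨pivot b ℓ mate c w, (h.isPivot_pivot hc hw).split⟩ := by
  rw [pivotVtx, dif_pos]

theorem pivotVtx_injOn (h : Layout b T ℓ mate) (hc : ∀ w, c w ∈ Set.Icc 1 b) {w w' : T}
    (hw : IsReflect w) (hw' : IsReflect w')
    (he : pivotVtx (r := r) b mate p0 c w = pivotVtx b mate p0 c w') : w = w' := by
  rw [pivotVtx_eq h hc hw, pivotVtx_eq h hc hw'] at he
  have h1 : pivot b ℓ mate c w = pivot b ℓ mate c w' :=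
    congrArg Subtype.val (Sum.inl.inj he)
  rw [← (h.isPivot_pivot hc hw).mate_eq, h1, (h.isPivot_pivot hc hw').mate_eq]

/-- The query sequence: first the pivots of the nodes in `ws`, then all other nodes. -/
noncomputable def querySeq (mate : T → T) (p0 : slots b ℓ) (e : Vtx b ℓ r ≃ Fin n) (c : T → ℕ)
    (ws : List T) : List (Fin n) :=
  (ws.map fun w => e (pivotVtx b mate p0 c w)) ++
    (Finset.univ.filter fun x => x ∉ ws.map fun w => e (pivotVtx b mate p0 c w)).toList

theorem mem_querySeq {ws : List T} (x : Fin n) : x ∈ querySeq mate p0 e c ws := by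
  rw [querySeq, List.mem_append, Finset.mem_toList, Finset.mem_filter]
  by_cases hx : x ∈ ws.map fun w => e (pivotVtx b mate p0 c w)
  · exact .inl hx
  · exact .inr ⟨Finset.mem_univ _, hx⟩

theorem nodup_map_pivot (h : Layout b T ℓ mate) (hc : ∀ w, c w ∈ Set.Icc 1 b) {ws : List T}
    (hws : ws.Nodup) (hr : ∀ w ∈ ws, IsReflect w) :
    (ws.map fun w => e (pivotVtx b mate p0 c w)).Nodup :=
  hws.map_on fun w hw w' hw' he =>
    pivotVtx_injOn (r := r) (p0 := p0) h hc (hr w hw) (hr w' hw') (e.injective he)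

theorem nodup_querySeq (h : Layout b T ℓ mate) (hc : ∀ w, c w ∈ Set.Icc 1 b) {ws : List T}
    (hws : ws.Nodup) (hr : ∀ w ∈ ws, IsReflect w) : (querySeq mate p0 e c ws).Nodup := by
  rw [querySeq, List.nodup_append']
  refine ⟨nodup_map_pivot h hc hws hr, Finset.nodup_toList _, ?_⟩
  intro x hx hx'
  rw [Finset.mem_toList, Finset.mem_filter] at hx'
  exact hx'.2 hx

theorem take_querySeq (h : Layout b T ℓ mate) (hc : ∀ w, c w ∈ Set.Icc 1 b) {ws : List T}
    (hws : ws.Nodup) (hr : ∀ w ∈ ws, IsReflect w) {i : ℕ} (hi : i < ws.length) :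
    (querySeq mate p0 e c ws).take
      ((querySeq mate p0 e c ws).idxOf (e (pivotVtx b mate p0 c ws[i])) + 1) =
      (ws.take (i + 1)).map fun w => e (pivotVtx b mate p0 c w) := by
  have hlen : i < (ws.map fun w => e (pivotVtx b mate p0 c w)).length := by simpa using hi
  have h1 : (ws.map fun w => e (pivotVtx b mate p0 c w))[i] =
      e (pivotVtx b mate p0 c ws[i]) := by simp
  have h2 : (querySeq mate p0 e c ws).idxOf (e (pivotVtx b mate p0 c ws[i])) = i := by
    rw [← h1, querySeq, List.idxOf_append_of_mem (List.getElem_mem hlen)]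
    exact (nodup_map_pivot h hc hws hr).idxOf_getElem i hlen
  rw [h2, querySeq, List.take_append_of_le_length (by omega), List.map_take]

variable [Finite T] {h : Layout b T ℓ mate} {htw : IsTwin tw}
  {hc : ∀ w, c w ∈ Set.Icc 1 b} {hc' : ∀ w, c' w ∈ Set.Icc 1 b}

theorem inst_deg (x : Vtx b ℓ r) : (inst h htw p0 e c hc).deg (e x) =
    ((instGraph tw htw p0 c).neighborSet x).ncard := by
  have h1 : (inst h htw p0 e c hc).graph.neighborSet (e x) =
      e '' (instGraph tw htw p0 c).neighborSet x := by
    ext y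
    simp [Equiv.image_eq_preimage_symm, inst]
  rw [PortGraph.deg, h1, Set.ncard_image_of_injective _ e.injective]

theorem inst_isTree : (inst h htw p0 e c hc).graph.IsTree :=
  (SimpleGraph.Iso.isTree_iff (SimpleGraph.Iso.comap e.symm (instGraph tw htw p0 c))).2
    (instGraph_isTree h hc)

theorem inst_far (h : Layout b T ℓ mate) (hc : ∀ w, c w ∈ Set.Icc 1 b) {L : ℕ}
    (hfar : Far b ℓ mate L) {w : T} (hw : IsReflect w) {x y : Fin n}
    (hx : e.symm x ∈ region p0 w) (hy : e.symm y ∉ region p0 w)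
    (ha : (inst h htw p0 e c hc).graph.Adj x y)
    (q : (inst h htw p0 e c hc).graph.Walk x (e (pivotVtx b mate p0 c w)))
    (hq : ∀ z ∈ q.support, e.symm z ∈ region p0 w) : L ≤ q.length := by
  let f : (inst h htw p0 e c hc).graph →g instGraph tw htw p0 c := ⟨e.symm, fun h => h⟩
  have hq2 : ∀ z ∈ (q.map f).support, z ∈ region p0 w := by
    intro z hz
    rw [SimpleGraph.Walk.support_map, List.mem_map] at hz
    obtain ⟨a, ha, rfl⟩ := hz
    exact hq a ha
  obtain ⟨q', hq'⟩ := exists_linkGraph_walk htw (q.map f) hq2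
  obtain ⟨u, v, hu, he, hcand, hvw, hwu⟩ := region_exit h htw hw hx hy ha
  have e1 : splitRoot tw p0 c (f x) = u := by
    change splitRoot tw p0 c (e.symm x) = u
    rw [he]
    rfl
  have e2 : splitRoot tw p0 c (f (e (pivotVtx b mate p0 c w))) = pivot b ℓ mate c w := by
    change splitRoot tw p0 c (e.symm (e _)) = _
    rw [e.symm_apply_apply, pivotVtx_eq h hc hw]
    rfl
  have := hfar c hc w hw u v hcand hvw hwu (q'.copy e1 e2)
  rw [SimpleGraph.Walk.length_copy] at this
  rw [SimpleGraph.Walk.length_map] at hq'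
  omega

/-- The information revealed at the pivots of nodes in `s` depends only on the choices made below
these nodes. -/
theorem inst_sameInformation (h : Layout b T ℓ mate) (hc : ∀ w, c w ∈ Set.Icc 1 b)
    (hc' : ∀ w, c' w ∈ Set.Icc 1 b) {L : ℕ} (hfar : Far b ℓ mate L) (s : List T)
    (hs : ∀ w ∈ s, IsReflect w) (hcc : ∀ w ∈ s, ∀ w', w < w' → c w' = c' w') :
    (inst h htw p0 e c hc).SameInformation L (s.map fun w => e (pivotVtx b mate p0 c w))
      (inst h htw p0 e c' hc') (s.map fun w => e (pivotVtx b mate p0 c' w)) := by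
  have hpiv : ∀ w ∈ s, pivotVtx (r := r) b mate p0 c w = pivotVtx b mate p0 c' w := by
    intro w hw
    rw [pivotVtx_eq h hc (hs w hw), pivotVtx_eq h hc' (hs w hw)]
    congr 2
    exact h.pivot_congr hc (hs w hw) (hcc w hw)
  have hmap : (s.map fun w => e (pivotVtx b mate p0 c' w)) =
      s.map fun w => e (pivotVtx b mate p0 c w) :=
    List.map_congr_left fun w hw => by rw [hpiv w hw]
  rw [hmap]
  refine sameInformation_of_regions _ _ s _ (fun w => {x | e.symm x ∈ region p0 w})
    ?_ ?_ ?_ ?_ ?_ ?_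
  · intro w hw
    simp only [Set.mem_ofPred_eq, e.symm_apply_apply]
    rw [pivotVtx_eq h hc (hs w hw)]
    exact h.lt_pivot hc (hs w hw)
  · intro w hw x hx y hy
    exact adj_congr htw (hcc w hw) hx hy
  · intro w hw x hx
    have h1 := inst_deg (h := h) (htw := htw) (p0 := p0) (e := e) (hc := hc) (e.symm x)
    have h2 := inst_deg (h := h) (htw := htw) (p0 := p0) (e := e) (hc := hc') (e.symm x)
    rw [e.apply_symm_apply] at h1 h2
    rw [h1, h2]
    exact ncard_neighborSet_congr h htw hc hc' (hs w hw) (hcc w hw) hx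
  · intro w hw x hx y hy _
    exact instPort_congr h htw (hs w hw) (hcc w hw) hx
  · intro w hw x hx y hy ha q hq
    exact inst_far h hc hfar (hs w hw) hx hy ha q hq
  · intro w hw x hx y hy ha q hq
    have := inst_far h hc' hfar (hs w hw) hx hy ha
      (q.copy rfl (by rw [hpiv w hw])) (by simpa using hq)
    simpa using this

/-- A deterministic algorithm fails for some choices. -/
theorem exists_failure (h : Layout b T ℓ mate) (htw : IsTwin tw) (p0 : slots b ℓ)
    (e : Vtx b ℓ r ≃ Fin n) {L : ℕ} (hfar : Far b ℓ mate L) {ws : List T} (hws : ws.Nodup)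
    (hmem : ∀ w, w ∈ ws ↔ IsReflect w) (hord : ws.Pairwise fun s t => ¬ s < t)
    (A : OnlineLocalAlgorithm L) :
    ∃ c, ∃ hc : ∀ w, c w ∈ Set.Icc 1 b, (∀ w, ¬ IsReflect w → c w = 1) ∧
      ¬ (inst h htw p0 e c hc).IsSinklessOrientation
      (A.output (inst h htw p0 e c hc) (querySeq mate p0 e c ws)) := by
  classical
  have hb3 := h.three_le
  by_contra! hok
  have hr : ∀ w ∈ ws, IsReflect w := fun w hw => (hmem w).1 hw
  -- Invariant: the first `j` pivots orient their port `c w` outwards, except possibly that of the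
  -- root.
  have step : ∀ j ≤ ws.length, ∃ c, ∃ hc : ∀ w, c w ∈ Set.Icc 1 b,
      (∀ w, ¬ IsReflect w → c w = 1) ∧ ∀ (i : ℕ) (hi : i < ws.length), i < j → ws[i] ≠ ⊥ → c ws[i] ∈ A.out n (inst h htw p0 e c hc)
        ((ws.take (i + 1)).map fun w => e (pivotVtx b mate p0 c w)) := by
    intro j
    induction j with
    | zero => exact fun _ => ⟨fun _ => 1, fun _ => ⟨le_rfl, (by omega : 1 ≤ b)⟩, fun _ _ => rfl,
        fun i _ hi => by omega⟩
    | succ j ih =>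
      intro hj
      obtain ⟨c, hc, hone, hgood⟩ := ih (by omega)
      have hj' : j < ws.length := hj
      -- Only leaves are matched with the root, so its choice never serves as the direction at an
      -- internal split node.
      by_cases hbot : ws[j] = ⊥
      · refine ⟨c, hc, hone, fun i hi hij hne => hgood i hi ?_ hne⟩
        rcases Nat.lt_succ_iff_lt_or_eq.1 hij with h1 | rfl
        · exact h1
        · exact absurd hbot hne
      have hwr := hr _ (List.getElem_mem hj')
      set w := ws[j] with hw
      set G := inst h htw p0 e c hc with hG
      obtain ⟨hO1, hO2⟩ := hok c hc hone
      have hdeg : G.deg (e (pivotVtx b mate p0 c w)) = b := by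
        rw [hG, inst_deg, pivotVtx_eq h hc hwr, ncard_neighborSet_split h hc]
      obtain ⟨y, hy, hOy⟩ := hO2 (e (pivotVtx b mate p0 c w)) (by rw [hdeg]; exact hb3)
      have hport := (G.port_bijOn _).mapsTo hy
      have hdeg' : (G.graph.neighborSet (e (pivotVtx b mate p0 c w))).ncard = b := hdeg
      rw [hdeg'] at hport
      rw [OnlineLocalAlgorithm.output, take_querySeq h hc hws hr hj'] at hOy
      -- The new choice at `w`: a port that the pivot orients outwards in the current instance,
      -- which exists because the algorithm is assumed to be correct there.
      set k := G.port (e (pivotVtx b mate p0 c w)) y with hk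
      have hc' : ∀ x, Function.update c w k x ∈ Set.Icc 1 b := by
        intro x
        by_cases hx : x = w
        · subst hx
          simpa using hport
        · simpa [hx] using hc x
      -- No earlier reflect node in `ws` is an ancestor of `w`, so changing the choice at `w` does
      -- not alter what has been revealed up to and including its pivot.
      have hsame : ∀ (i : ℕ) (hi : i < ws.length), i ≤ j →
          A.out n G ((ws.take (i + 1)).map fun w => e (pivotVtx b mate p0 c w)) =
          A.out n (inst h htw p0 e (Function.update c w k) hc') ((ws.take (i + 1)).map
            fun x => e (pivotVtx b mate p0 (Function.update c w k) x)) := by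
        intro i hi hij
        refine A.online_local _ _ _ _ _ (inst_sameInformation h hc hc' hfar _
          (fun x hx => hr x (List.mem_of_mem_take hx)) fun x hx x' hxx' => ?_)
        rw [Function.update_of_ne]
        rintro rfl
        obtain ⟨l, hl, rfl⟩ := List.mem_take_iff_getElem.1 hx
        rcases (show l ≤ j by omega).lt_or_eq with h1 | rfl
        · exact List.pairwise_iff_getElem.1 hord l j (by omega) hj' h1 hxx'
        · exact lt_irrefl _ hxx'
      refine ⟨Function.update c w k, hc', fun x hx => ?_, fun i hi hij hne => ?_⟩
      · rw [Function.update_of_ne (by rintro rfl; exact hx hwr), hone x hx]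
      rw [← hsame i hi (by omega)]
      rcases Nat.lt_succ_iff_lt_or_eq.1 hij with h1 | rfl
      · rw [Function.update_of_ne]
        · exact hgood i hi h1 hne
        · intro he
          exact h1.ne ((hws.getElem_inj_iff).1 he)
      · rw [← hw, Function.update_self]
        exact hOy
  obtain ⟨c, hc, hone, hgood⟩ := step ws.length le_rfl
  obtain ⟨hO1, hO2⟩ := hok c hc hone
  -- The leaf `u` needs an outgoing edge, but its other end is a pivot that has already oriented
  -- this edge, at port `c (mate v)`, towards `u`.
  obtain ⟨u, hu, hsink⟩ := h.exists_sink hc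
  have hur := Layout.not_isReflect_leaf hu
  obtain ⟨y, hy, hOy⟩ := hO2 (e (.inl ⟨u, hur⟩)) (by
    rw [inst_deg, ncard_neighborSet_split h hc]
    exact hb3)
  have hadj : (instGraph tw htw p0 c).Adj (.inl ⟨u, hur⟩) (e.symm y) := by
    simpa [inst] using hy
  obtain ⟨v, hv, hev, hl⟩ : ∃ v hv, e.symm y = .inl ⟨v, hv⟩ ∧ Link b ℓ c v u := by
    rcases hey : e.symm y with v | p | i
    · rw [hey] at hadj
      refine ⟨v, v.2, rfl, ((adj_split_split htw).1 hadj).resolve_left fun hl => ?_⟩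
      have h1 : numChildren u = b := hl.internal
      omega
    · rw [hey] at hadj
      obtain ⟨h1, h2⟩ := (adj_split_slot htw).1 hadj
      have hcand := p.2.1
      have h1 : p.1.2 = u := h1
      rw [h1] at hcand h2
      exact absurd (hsink _ hcand).1 h2
    · rw [hey] at hadj
      exact absurd hadj (not_adj_split_rest htw)
  obtain ⟨-, hpiv, hdir⟩ := hsink v hl.toCand
  have hmr := h.mate_reflect v hv
  obtain ⟨i, hi, hiv⟩ := List.mem_iff_getElem.1 ((hmem _).2 hmr)
  have hyv : y = e (pivotVtx b mate p0 c ws[i]) := by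
    rw [hiv, pivotVtx_eq h hc hmr, ← e.symm_apply_eq, hev]
    congr 2
    exact h.eq_pivot hpiv
  have hout := hgood i hi hi (hiv ▸ h.mate_ne_bot hl.internal)
  have hOyu : A.output (inst h htw p0 e c hc) (querySeq mate p0 e c ws) y
      (e (.inl ⟨u, hur⟩)) := by
    have hport : (inst h htw p0 e c hc).port y (e (.inl ⟨u, hur⟩)) = c ws[i] := by
      have h0 : numChildren v ≠ 0 := by have := hl.internal; omega
      simp only [inst, e.symm_apply_apply, hev, instPort, if_neg h0, hdir, hiv]
      rfl
    rw [OnlineLocalAlgorithm.output, hport, hyv, take_querySeq h hc hws hr hi]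
    exact hout
  exact (hO1 _ _ hy).1 hOy hOyu

end Adversary

/-! ### The labels of the unmarked nodes -/

section Slab

variable {b : ℕ} {T : RootedTree} {ℓ : T → Word} {mate : T → T} {s t v w : T} {a a' : Word}

/-- The string `a` is star-free, and is not cleared by the reflections above `t`. -/
structure FreeAt (b : ℕ) {T : RootedTree} (ℓ : T → Word) (t : T) (a : Word) : Prop where
  zero : symb a 0 = some (.num 1) ∨ symb a 0 = some (.num 2)
  isNum : ∀ j ≤ rk t, IsNum b (symb a j)
  not_suffix : ∀ w, IsReflect w → w < t → ¬ ℓ w <:+ a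

/-- The string `a` arises from the label of the reflect node `w`, and `w` is not yet matched. -/
structure StarAt (b : ℕ) {T : RootedTree} (ℓ : T → Word) (mate : T → T) (t w : T) (a : Word) :
    Prop where
  reflect : IsReflect w
  lt : w < t
  unmatched : ∀ v, ¬ IsReflect v → v < t → mate v ≠ w
  star : symb a (rk w + 1) = some .star
  below : ∀ j < rk w + 1, symb a j = symb (ℓ w) j
  above : ∀ j, rk w + 1 < j → j ≤ rk t → IsNum b (symb a j)

/-- The labels of the component that contains the node with label `ℓ t` when `t` is about to be
processed. -/
structure Slab (b : ℕ) {T : RootedTree} (ℓ : T → Word) (mate : T → T) (t : T) (a : Word) :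
    Prop where
  length : a.length = rk t + 1
  closed : ∀ v, numChildren v = b → v < t →
    symb a (rk (mate v) + 1) = symb (ℓ t) (rk (mate v) + 1)
  cases : FreeAt b ℓ t a ∨ ∃ w, StarAt b ℓ mate t w a

/-- The adjacency relation between labels in a component of unmarked nodes. -/
structure WAdj (a a' : Word) : Prop where
  zero_left : symb a 0 = some (.num 1)
  zero_right : symb a' 0 = some (.num 2)
  fits : Fits a'.length a a'

namespace Layout

theorem slab_reflect (h : Layout b T ℓ mate) (hw : IsReflect w) : Slab b ℓ mate w (ℓ w) where
  length := h.length w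
  closed _ _ _ := rfl
  cases := .inl ⟨(h.mem_words w).1, fun _ => h.isNum_symb_reflect hw,
    fun w' hw' hlt => h.independent w' w hw' hw hlt.ne⟩

theorem starAt_split (h : Layout b T ℓ mate) (hv : ¬ IsReflect v) :
    StarAt b ℓ mate v (mate v) (ℓ v) where
  reflect := h.mate_reflect v hv
  lt := h.mate_lt v hv
  unmatched v' hv' hlt := h.mate_ne v v' hv hv' hlt
  star := h.symb_mate v hv
  below := h.symb_below_mate v hv
  above _ h1 h2 := h.isNum_symb_split hv h2 h1.ne'

theorem slab_split (h : Layout b T ℓ mate) (hv : ¬ IsReflect v) : Slab b ℓ mate v (ℓ v) where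
  length := h.length v
  closed _ _ _ := rfl
  cases := .inr ⟨_, h.starAt_split hv⟩

theorem slab_self (h : Layout b T ℓ mate) (t : T) : Slab b ℓ mate t (ℓ t) := by
  by_cases ht : IsReflect t
  · exact h.slab_reflect ht
  · exact h.slab_split ht

theorem not_slab_of_incomparable (h : Layout b T ℓ mate) (h1 : ¬ s ≤ t) (h2 : ¬ t ≤ s)
    (hs : Slab b ℓ mate s a) : ¬ Slab b ℓ mate t a := by
  intro ht
  obtain ⟨g, hg, hgs, hgt, hne⟩ := h.separation h1 h2
  exact hne ((hs.closed g hg hgs).symm.trans (ht.closed g hg hgt))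

/-- If `t` is below `v`, then labels at `t` have a number where `ℓ v` has its star; otherwise the
branches of `t` and `v` part at some split node. So marked labels never reappear in components. -/
theorem not_slab_split (h : Layout b T ℓ mate) (hv : ¬ IsReflect v) (hn : ¬ t ≤ v) :
    ¬ Slab b ℓ mate t (ℓ v) := by
  intro ht
  by_cases hvt : v ≤ t
  · have hlt := hvt.lt_of_ne fun e => hn e.ge
    have hb := h.internal_of_lt hv hlt
    have h1 := ht.closed v hb hlt
    rw [h.symb_mate v hv] at h1
    exact (h.isNum_dir hb hlt).ne_star h1.symm
  · exact h.not_slab_of_incomparable hn hvt ht (h.slab_split hv)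

theorem split_injOn (h : Layout b T ℓ mate) : Set.InjOn ℓ {v | ¬ IsReflect v} := by
  intro v hv v' hv' he
  by_contra hne
  have h1 : v' ≤ v := by
    by_contra hn
    exact h.not_slab_split hv hn (he ▸ h.slab_split hv')
  have h2 : v ≤ v' := by
    by_contra hn
    exact h.not_slab_split hv' hn (he ▸ h.slab_split hv)
  exact hne (h2.antisymm h1)

theorem slab_bot (h : Layout b T ℓ mate) :
    Slab b ℓ mate ⊥ a ↔ a = [.num 1] ∨ a = [.num 2] := by
  have hb := h.three_le
  constructor
  · intro hs
    rcases hs.cases with hf | ⟨w, hw⟩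
    · have hl := hs.length
      rw [rk_bot, zero_add, List.length_eq_one_iff] at hl
      obtain ⟨x, rfl⟩ := hl
      simpa [symb] using hf.zero
    · exact absurd hw.lt not_lt_bot
  · intro ha
    refine ⟨?_, fun v _ hv => absurd hv not_lt_bot, .inl ⟨?_, ?_, fun w _ hw =>
      absurd hw not_lt_bot⟩⟩
    · rcases ha with rfl | rfl <;> simp [rk_bot]
    · rcases ha with rfl | rfl <;> simp [symb]
    · intro j hj
      rw [rk_bot] at hj
      obtain rfl : j = 0 := by omega
      rcases ha with rfl | rfl
      · exact ⟨1, ⟨le_rfl, by omega⟩, by simp [symb]⟩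
      · exact ⟨2, ⟨by omega, by omega⟩, by simp [symb]⟩

/-- The string `1` is cleared by the reflection at the root, so a later label ending in 1 must come
from the reflected node and has its star at position 1. -/
theorem slab_starAt_bot (h : Layout b T ℓ mate) (hs : Slab b ℓ mate t a) (ht : t ≠ ⊥)
    (h0 : symb a 0 = some (.num 1)) : StarAt b ℓ mate t ⊥ a := by
  rcases hs.cases with hf | ⟨w, hw⟩
  · refine absurd (suffix_iff_symb.2 ?_)
      (hf.not_suffix ⊥ h.root_reflect (bot_lt_iff_ne_bot.2 ht))
    intro i hi
    rw [h.length, rk_bot] at hi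
    obtain rfl : i = 0 := by omega
    rw [h0, h.root]
    simp [symb]
  · by_cases hb : w = ⊥
    · exact hb ▸ hw
    · have := h.symb_reflect_zero hw.reflect hb
      rw [← hw.below 0 (by omega), h0] at this
      simp at this

/-! #### Reflections -/

theorem slab_cons_num (h : Layout b T ℓ mate) (ht : IsReflect t) (hc : t ⋖ s) {k : ℕ}
    (hk : k ∈ Set.Icc 1 b) (ha : Slab b ℓ mate t a) (hne : a ≠ ℓ t) :
    Slab b ℓ mate s (.num k :: a) := by
  have := h.finite
  have hrk := rk_child_reflect hc ht
  have hl := ha.length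
  have hsplit : ∀ v, ¬ IsReflect v → v < s → v < t := fun v hv hlt =>
    (le_of_lt_child hc hlt).lt_of_ne fun e => hv (e ▸ ht)
  refine ⟨by simp [hl, hrk], ?_, ?_⟩
  · intro v hv hlt
    have hvr := h.not_isReflect hv
    have hlt' := hsplit v hvr hlt
    have h1 := h.rk_mate_lt hvr
    have h2 := rk_mono hlt'.le
    rw [symb_cons_of_lt (by omega), ha.closed v hv hlt', h.symb_child hv hlt' hc.1.le]
  · rcases ha.cases with hf | ⟨w, hw⟩
    · refine .inl ⟨?_, ?_, ?_⟩
      · rw [symb_cons_of_lt (by omega)]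
        exact hf.zero
      · intro j hj
        rcases (show j ≤ rk t ∨ j = a.length by omega) with h1 | rfl
        · rw [symb_cons_of_lt (by omega)]
          exact hf.isNum j h1
        · rw [symb_cons_length]
          exact ⟨k, hk, rfl⟩
      · intro w hw hlt hsuf
        rw [suffix_iff_symb, h.length] at hsuf
        have hwt := le_of_lt_child hc hlt
        have hwk := rk_mono hwt
        have hsuf' : ℓ w <:+ a := by
          rw [suffix_iff_symb, h.length]
          intro i hi
          rw [hsuf i hi, symb_cons_of_lt (by omega)]
        rcases hwt.eq_or_lt with rfl | hwt
        · exact hne (hsuf'.eq_of_length (by rw [hl, h.length])).symm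
        · exact hf.not_suffix w hw hwt hsuf'
    · have hwk := rk_lt hw.reflect hw.lt
      refine .inr ⟨w, hw.reflect, hw.lt.trans hc.1,
        fun v hv hlt => hw.unmatched v hv (hsplit v hv hlt), ?_, ?_, ?_⟩
      · rw [symb_cons_of_lt (by omega)]
        exact hw.star
      · intro j hj
        rw [symb_cons_of_lt (by omega)]
        exact hw.below j hj
      · intro j h1 h2
        rcases (show j ≤ rk t ∨ j = a.length by omega) with h3 | rfl
        · rw [symb_cons_of_lt (by omega)]
          exact hw.above j h1 h3
        · rw [symb_cons_length]
          exact ⟨k, hk, rfl⟩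

theorem slab_cons_star (h : Layout b T ℓ mate) (ht : IsReflect t) (hc : t ⋖ s) :
    Slab b ℓ mate s (.star :: ℓ t) := by
  have := h.finite
  have hrk := rk_child_reflect hc ht
  have hl := h.length t
  have hsplit : ∀ v, ¬ IsReflect v → v < s → v < t := fun v hv hlt =>
    (le_of_lt_child hc hlt).lt_of_ne fun e => hv (e ▸ ht)
  refine ⟨by simp [hl, hrk], ?_, .inr ⟨t, ht, hc.1, ?_, ?_, ?_, ?_⟩⟩
  · intro v hv hlt
    have hvr := h.not_isReflect hv
    have hlt' := hsplit v hvr hlt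
    have h1 := h.rk_mate_lt hvr
    have h2 := rk_mono hlt'.le
    rw [symb_cons_of_lt (by omega), h.symb_child hv hlt' hc.1.le]
  · rintro v hv hlt rfl
    exact (h.mate_lt v hv).not_ge (le_of_lt_child hc hlt)
  · rw [← hl, symb_cons_length]
  · intro j hj
    rw [symb_cons_of_lt (by omega)]
  · intro j h1 h2
    omega

/-- The new top symbol is a star only if the string is a reflected `ℓ t`: any other star stems from
an earlier reflect node and sits at a lower position. -/
theorem slab_of_cons (h : Layout b T ℓ mate) (ht : IsReflect t) (hc : t ⋖ s)
    (ha : Slab b ℓ mate s a) : (∃ k ∈ Set.Icc 1 b, ∃ a', a = .num k :: a' ∧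
      Slab b ℓ mate t a' ∧ a' ≠ ℓ t) ∨ a = .star :: ℓ t := by
  have := h.finite
  have hrk := rk_child_reflect hc ht
  obtain ⟨x, a', rfl⟩ : ∃ x a', a = x :: a' := by
    cases a with
    | nil => exact absurd ha.length (by simp)
    | cons x a' => exact ⟨x, a', rfl⟩
  have hl : a'.length = rk t + 1 := by
    have := ha.length
    simp only [List.length_cons] at this
    omega
  have hclosed : ∀ v, numChildren v = b → v < t →
      symb a' (rk (mate v) + 1) = symb (ℓ t) (rk (mate v) + 1) := by
    intro v hv hlt
    have h1 := h.rk_mate_lt (h.not_isReflect hv)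
    have h2 := rk_mono hlt.le
    have h3 := ha.closed v hv (hlt.trans hc.1)
    rwa [symb_cons_of_lt (by omega), h.symb_child hv hlt hc.1.le] at h3
  have htop : symb (x :: a') (rk t + 1) = some x := by rw [← hl, symb_cons_length]
  rcases ha.cases with hf | ⟨w, hw⟩
  · left
    obtain ⟨k, hk, hx⟩ := hf.isNum (rk t + 1) (by omega)
    obtain rfl : x = .num k := Option.some.inj (htop.symm.trans hx)
    have hsuf : a' <:+ .num k :: a' := List.suffix_cons _ _
    refine ⟨k, hk, a', rfl, ⟨hl, hclosed, .inl ⟨?_, ?_, ?_⟩⟩, ?_⟩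
    · simpa [symb_cons_of_lt (show 0 < a'.length by omega)] using hf.zero
    · intro j hj
      simpa [symb_cons_of_lt (show j < a'.length by omega)] using hf.isNum j (by omega)
    · intro w hw hlt hs
      exact hf.not_suffix w hw (hlt.trans hc.1) (hs.trans hsuf)
    · rintro rfl
      exact hf.not_suffix t ht hc.1 hsuf
  · rcases (le_of_lt_child hc hw.lt).eq_or_lt with rfl | hlt
    · right
      obtain rfl : x = .star := Option.some.inj (htop.symm.trans hw.star)
      congr 1
      refine word_ext_of_length (by rw [hl, h.length]) fun i hi => ?_
      rw [← hw.below i (by omega), symb_cons_of_lt hi]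
    · left
      have hwk := rk_lt hw.reflect hlt
      obtain ⟨k, hk, hx⟩ := hw.above (rk t + 1) (by omega) (by omega)
      obtain rfl : x = .num k := Option.some.inj (htop.symm.trans hx)
      have hstar : symb a' (rk w + 1) = some .star := by
        have := hw.star
        rwa [symb_cons_of_lt (by omega)] at this
      refine ⟨k, hk, a', rfl, ⟨hl, hclosed, .inr ⟨w, hw.reflect, hlt,
        fun v hv hvt => hw.unmatched v hv (hvt.trans hc.1), hstar, ?_, ?_⟩⟩, ?_⟩
      · intro j hj
        have := hw.below j hj
        rwa [symb_cons_of_lt (by omega)] at this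
      · intro j h1 h2
        have := hw.above j h1 (by omega)
        rwa [symb_cons_of_lt (by omega)] at this
      · rintro rfl
        exact h.starFree t ht (mem_iff_symb.2 ⟨_, hstar⟩)

/-- This matches the adjacency rule of a reflection. The new position forces equal copies unless the
end with 0-th symbol 2 is the reflected node and gets a star. If the other end is reflected, then
`t` is the root and the new position is 1, which `Fits` ignores. -/
theorem wAdj_cons (h : Layout b T ℓ mate) (ht : IsReflect t) {x x' : Symbol}
    (ha : Slab b ℓ mate t a) (ha' : Slab b ℓ mate t a') (hx : x = .star ↔ a = ℓ t)
    (hx' : x' = .star ↔ a' = ℓ t) :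
    WAdj (x :: a) (x' :: a') ↔ WAdj a a' ∧ (x = x' ∨ a = ℓ t ∨ a' = ℓ t) := by
  have := h.finite
  have hl := ha.length
  have hl' := ha'.length
  have e0 : symb (x :: a) 0 = symb a 0 := symb_cons_of_lt (by omega)
  have e0' : symb (x' :: a') 0 = symb a' 0 := symb_cons_of_lt (by omega)
  have e1 : symb (x :: a) (rk t + 1) = some x := by rw [← hl, symb_cons_length]
  have e1' : symb (x' :: a') (rk t + 1) = some x' := by rw [← hl', symb_cons_length]
  constructor
  · rintro ⟨h1, h2, h3⟩
    rw [e0] at h1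
    rw [e0'] at h2
    refine ⟨⟨h1, h2, fun j hj hj' => ?_⟩, ?_⟩
    · have := h3 j hj (by simp only [List.length_cons]; omega)
      rwa [symb_cons_of_lt (by omega), symb_cons_of_lt (by omega)] at this
    · by_cases hb : t = ⊥
      · subst hb
        right; left
        rcases h.slab_bot.1 ha with rfl | rfl
        · exact h.root.symm
        · simp [symb] at h1
      · have h4 := h.one_le_rk hb
        have := h3 (rk t + 1) (by omega) (by simp only [List.length_cons]; omega)
        rw [e1, e1'] at this
        rcases this with h5 | h5
        · exact .inl (Option.some.inj h5)
        · exact .inr (.inr (hx'.1 (Option.some.inj h5)))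
  · rintro ⟨⟨h1, h2, h3⟩, h4⟩
    refine ⟨e0.trans h1, e0'.trans h2, fun j hj hj' => ?_⟩
    simp only [List.length_cons] at hj'
    rcases (show j < a'.length ∨ j = rk t + 1 by omega) with h5 | rfl
    · rw [symb_cons_of_lt (by omega), symb_cons_of_lt h5]
      exact h3 j hj h5
    · rw [e1, e1']
      rcases h4 with rfl | rfl | rfl
      · exact .inl rfl
      · have hb : t ≠ ⊥ := by
          rintro rfl
          rw [rk_bot] at hj
          omega
        rw [h.symb_reflect_zero ht hb] at h1
        simp at h1
      · exact .inr (congrArg some (hx'.2 rfl))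

/-! #### Splits -/

theorem slab_of_child (h : Layout b T ℓ mate) (hv : ¬ IsReflect v) (hc : v ⋖ s)
    (ha : Slab b ℓ mate s a) : Slab b ℓ mate v a ∧ a ≠ ℓ v := by
  have := h.finite
  have hrk := rk_child_split hc hv
  have hb := h.internal_of_lt hv hc.1
  have hrefl : ∀ w, IsReflect w → w < s → w < v := fun w hw hlt =>
    (le_of_lt_child hc hlt).lt_of_ne fun e => hv (e ▸ hw)
  refine ⟨⟨hrk ▸ ha.length, ?_, ?_⟩, ?_⟩
  · intro g hg hlt
    rw [ha.closed g hg (hlt.trans hc.1), h.symb_child hg hlt hc.1.le]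
  · rcases ha.cases with hf | ⟨w, hw⟩
    · exact .inl ⟨hf.zero, hrk ▸ hf.isNum, fun w hw hlt => hf.not_suffix w hw (hlt.trans hc.1)⟩
    · exact .inr ⟨w, hw.reflect, hrefl w hw.reflect hw.lt,
        fun g hg hlt => hw.unmatched g hg (hlt.trans hc.1), hw.star, hw.below, hrk ▸ hw.above⟩
  · rintro rfl
    exact h.not_slab_split hv hc.1.not_ge ha

/-- Below its star, the string copies the label of `mate v`. Above it, the reflect nodes in question
lie between `mate v` and `v`, so they are already matched (`closes`) and their positions are
settled. -/
theorem eq_of_starAt_mate (h : Layout b T ℓ mate) (hv : ¬ IsReflect v) (ha : Slab b ℓ mate v a)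
    (hw : StarAt b ℓ mate v (mate v) a) : a = ℓ v := by
  have := h.finite
  refine word_ext_of_length (by rw [ha.length, h.length]) fun i hi => ?_
  rw [ha.length] at hi
  rcases lt_trichotomy i (rk (mate v) + 1) with h1 | rfl | h1
  · rw [hw.below i h1, h.symb_below_mate v hv i h1]
  · rw [hw.star, h.symb_mate v hv]
  · obtain ⟨w', hw', hr, rfl⟩ : ∃ w' < v, IsReflect w' ∧ rk w' + 1 = i := by
      obtain ⟨w', h2, h3, h4⟩ := exists_reflect_rk v (i := i - 1) (by omega)
      exact ⟨w', h2, h3, by omega⟩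
    have hlt := lt_of_rk_lt (h.mate_lt v hv).le hw'.le (by omega)
    obtain ⟨g, hg, rfl, -, hgv⟩ := h.closes v w' hv hr hlt hw'
    exact ha.closed g (h.internal_of_lt hg hgv) hgv

/-- Within the component, only `ℓ v` has a star at the position of `v`; every other label has a
direction there, which decides the child to which it passes. -/
theorem isNum_of_ne (h : Layout b T ℓ mate) (hv : ¬ IsReflect v) (ha : Slab b ℓ mate v a)
    (hne : a ≠ ℓ v) : IsNum b (symb a (rk (mate v) + 1)) := by
  have := h.finite
  have h1 := h.rk_mate_lt hv
  rcases ha.cases with hf | ⟨w, hw⟩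
  · exact hf.isNum _ h1
  · rcases lt_trichotomy (rk (mate v)) (rk w) with h2 | h2 | h2
    · rw [hw.below _ (by omega)]
      exact h.isNum_symb_reflect hw.reflect h2
    · obtain rfl := rk_inj (h.mate_reflect v hv) hw.reflect (h.mate_lt v hv).le hw.lt.le h2
      exact absurd (h.eq_of_starAt_mate hv ha hw) hne
    · exact hw.above _ (by omega) h1

theorem slab_child (h : Layout b T ℓ mate) (hv : numChildren v = b) (hc : v ⋖ s)
    (ha : Slab b ℓ mate v a) (hne : a ≠ ℓ v)
    (hd : symb a (rk (mate v) + 1) = symb (ℓ s) (rk (mate v) + 1)) : Slab b ℓ mate s a := by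
  have := h.finite
  have hvr := h.not_isReflect hv
  have hrk := rk_child_split hc hvr
  refine ⟨hrk ▸ ha.length, ?_, ?_⟩
  · intro g hg hlt
    rcases (le_of_lt_child hc hlt).eq_or_lt with rfl | hlt
    · exact hd
    · rw [ha.closed g hg hlt, h.symb_child hg hlt hc.1.le]
  · rcases ha.cases with hf | ⟨w, hw⟩
    · exact .inl ⟨hf.zero, hrk ▸ hf.isNum, fun w hw hlt => hf.not_suffix w hw
        ((le_of_lt_child hc hlt).lt_of_ne fun e => hvr (e ▸ hw))⟩
    · refine .inr ⟨w, hw.reflect, hw.lt.trans hc.1, fun g hg hlt he => ?_, hw.star, hw.below,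
        hrk ▸ hw.above⟩
      rcases (le_of_lt_child hc hlt).eq_or_lt with rfl | hlt
      · exact hne (h.eq_of_starAt_mate hvr ha (he ▸ hw))
      · exact hw.unmatched g hg hlt he

/-- A star-free label would be cleared by a reflect node on the branch, a contradiction. So it comes
from some reflect node; since every reflect node above `v` is matched by now, this one is matched
with `v` itself. -/
theorem slab_leaf (h : Layout b T ℓ mate) (hv : numChildren v = 0) (ha : Slab b ℓ mate v a) :
    a = ℓ v := by
  have := h.finite
  have hvr := not_isReflect_leaf hv
  rcases ha.cases with hf | ⟨w, hw⟩
  · have hmem : a ∈ starFreeWords b := by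
      refine ⟨⟨hf.zero, fun x hx => ?_⟩, fun hx => ?_⟩
      · obtain ⟨i, hi⟩ := mem_iff_symb.1 hx
        have := lt_length_of_symb hi
        obtain ⟨k, hk, hk'⟩ := hf.isNum i (by have := ha.length; omega)
        exact .inr ⟨k, hk, Option.some.inj (hi.symm.trans hk')⟩
      · obtain ⟨i, hi⟩ := mem_iff_symb.1 hx
        have := lt_length_of_symb hi
        exact (hf.isNum i (by have := ha.length; omega)).ne_star hi
    obtain ⟨_, ⟨y, hy, rfl⟩, hsuf⟩ := h.clearing a hmem (by
      rintro _ ⟨y, -, rfl⟩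
      rw [h.length, ha.length]
      have := h.rk_le v y hv
      omega)
    exfalso
    rw [suffix_iff_symb, h.length] at hsuf
    have hle : y ≤ v ∨ v ≤ y := h.le_or_le_of_dir fun g hg hgy hgv => by
      have h1 := h.rk_mate_lt (h.not_isReflect hg)
      have h2 := rk_mono hgy.le
      rw [hsuf _ (by omega), ha.closed g hg hgv]
    have hne : y ≠ v := by
      rintro rfl
      exact hvr hy
    rcases hle with hle | hle
    · refine hf.not_suffix y hy (hle.lt_of_ne hne) (suffix_iff_symb.2 ?_)
      rwa [h.length]
    · exact h.leaf_not_lt hv (hle.lt_of_ne hne.symm)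
  · obtain ⟨g, hg, rfl, -, hgv⟩ := h.matched v w hv hw.reflect hw.lt
    rcases hgv.eq_or_lt with rfl | hgv
    · exact h.eq_of_starAt_mate hvr ha hw
    · exact absurd rfl (hw.unmatched g hg hgv)

theorem exists_child_slab (h : Layout b T ℓ mate) (hv : ¬ IsReflect v) (ha : Slab b ℓ mate v a)
    (hne : a ≠ ℓ v) : numChildren v = b ∧ ∃ s, v ⋖ s ∧ Slab b ℓ mate s a := by
  have hb := (h.children_cases v hv).resolve_left fun h0 => hne (h.slab_leaf h0 ha)
  obtain ⟨k, hk, hk'⟩ := h.isNum_of_ne hv ha hne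
  obtain ⟨s, hs, hd⟩ := h.exists_child_dir hb hk
  exact ⟨hb, s, hs, h.slab_child hb hs ha hne (hk'.trans (hd s le_rfl).symm)⟩

theorem symb_slab_child (hc : v ⋖ s) (hv : numChildren v = b) (ha : Slab b ℓ mate s a) :
    symb a (rk (mate v) + 1) = symb (ℓ s) (rk (mate v) + 1) := ha.closed v hv hc.1

/-- The position of `v` is at least 2 and holds numbers on both sides, so adjacent labels agree
there; no edge avoiding `ℓ v` joins the parts of different children. -/
theorem child_eq_of_wAdj (h : Layout b T ℓ mate) {s' : T} (hv : numChildren v = b) (hc : v ⋖ s)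
    (hc' : v ⋖ s') (ha : Slab b ℓ mate s a) (ha' : Slab b ℓ mate s' a') (hadj : WAdj a a') :
    s = s' := by
  have := h.finite
  have h1 := h.rk_mate_pos hv
  have h2 := h.rk_mate_lt (h.not_isReflect hv)
  have h3 := rk_mono hc'.1.le
  refine h.child_eq_of_dir hv hc hc' le_rfl le_rfl ?_
  rw [← symb_slab_child hc hv ha, ← symb_slab_child hc' hv ha']
  refine (hadj.fits _ (by omega) (by rw [ha'.length]; omega)).resolve_right fun hs => ?_
  rw [symb_slab_child hc' hv ha'] at hs
  exact (h.isNum_dir hv hc'.1).ne_star hs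

/-- Two neighbors of `ℓ v` coincide if they have the same symbol at the position of its star. -/
theorem wAdj_unique (h : Layout b T ℓ mate) {x : Word} (ht : t ≠ ⊥) (hx : x.length = rk t + 1)
    (ha : Slab b ℓ mate t a) (ha' : Slab b ℓ mate t a') (hadj : WAdj a x) (hadj' : WAdj a' x)
    (hs : ∀ j, symb x j = some .star → symb a j = symb a' j) : a = a' := by
  have hb := h.slab_starAt_bot ha ht hadj.zero_left
  have hb' := h.slab_starAt_bot ha' ht hadj'.zero_left
  refine word_ext_of_length (by rw [ha.length, ha'.length]) fun i hi => ?_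
  rw [ha.length] at hi
  by_cases h0 : i = 0
  · rw [h0, hadj.zero_left, hadj'.zero_left]
  by_cases h1 : i = 1
  · have e := hb.star
    have e' := hb'.star
    rw [rk_bot] at e e'
    rw [h1]
    exact e.trans e'.symm
  · rcases hadj.fits i (by omega) (by omega) with h2 | h2
    · rcases hadj'.fits i (by omega) (by omega) with h3 | h3
      · rw [h2, h3]
      · exact hs i h3
    · exact hs i h2

end Layout

end Slab

/-! ### The intermediate graphs -/

/-- The nodes of the construction tree that can be processed next, when `d` has been processed. -/
def Front {T : RootedTree} (d : Set T) (t : T) : Prop := t ∉ d ∧ ∀ s < t, s ∈ d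

/-- The description of the marked graph obtained after processing the nodes in `d`. -/
structure Describes (b : ℕ) {T : RootedTree} (ℓ : T → Word) (mate : T → T) (d : Set T)
    (G : MarkedGraph) : Prop where
  lower : IsLowerSet d
  inj : ∀ p q, G.label p = G.label q → p = q
  unmarked : ∀ p ∉ G.marked, ∃ t, Front d t ∧ Slab b ℓ mate t (G.label p)
  exists_unmarked : ∀ t, Front d t → ∀ a, Slab b ℓ mate t a → ∃ p ∉ G.marked, G.label p = a
  marked : ∀ p ∈ G.marked, ∃ v ∈ d, ¬ IsReflect v ∧ G.label p = ℓ v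
  exists_marked : ∀ v ∈ d, ¬ IsReflect v → ∃ p ∈ G.marked, G.label p = ℓ v
  adj : ∀ p ∉ G.marked, ∀ q ∉ G.marked, G.graph.Adj p q ↔ ∃ t, Front d t ∧
    Slab b ℓ mate t (G.label p) ∧ Slab b ℓ mate t (G.label q) ∧
      (WAdj (G.label p) (G.label q) ∨ WAdj (G.label q) (G.label p))
  -- Since `adj` speaks of unmarked pairs only, this is what makes the degree of a node with 0-th
  -- symbol 2 computable.
  two : ∀ p ∉ G.marked, symb (G.label p) 0 = some (.num 2) → ∀ q, G.graph.Adj p q → q ∉ G.marked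
  conn : ∀ t, Front d t → ∀ p q, p ∉ G.marked → q ∉ G.marked → Slab b ℓ mate t (G.label p) →
    Slab b ℓ mate t (G.label q) → G.unmarkedGraph.Reachable p q

section Describes

variable {b : ℕ} {T : RootedTree} {ℓ : T → Word} {mate : T → T} {d : Set T} {s t v w : T}
  {G : MarkedGraph} {a a' : Word}

theorem front_unique (h : Layout b T ℓ mate) (ht : Front d t) (hs : Front d s)
    (ha : Slab b ℓ mate t a) (ha' : Slab b ℓ mate s a) : t = s := by
  by_contra hne
  refine h.not_slab_of_incomparable (fun hle => ?_) (fun hle => ?_) ha ha'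
  · exact ht.1 (hs.2 t (hle.lt_of_ne hne))
  · exact hs.1 (ht.2 s (hle.lt_of_ne (Ne.symm hne)))

theorem front_bot : Front (∅ : Set T) t ↔ t = ⊥ := by
  constructor
  · intro ht
    by_contra hne
    exact ht.2 ⊥ (bot_lt_iff_ne_bot.2 hne)
  · rintro rfl
    exact ⟨id, fun s hs => absurd hs not_lt_bot⟩

theorem Front.isLowerSet_insert (ht : Front d t) (hd : IsLowerSet d) :
    IsLowerSet (insert t d) := by
  rintro x y hyx (rfl | hx)
  · rcases hyx.eq_or_lt with rfl | hlt
    · exact .inl rfl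
    · exact .inr (ht.2 y hlt)
  · exact .inr (hd hyx hx)

theorem Front.insert_iff [Finite T] (ht : Front d t) (hd : IsLowerSet d) :
    Front (insert t d) s ↔ t ⋖ s ∨ (s ≠ t ∧ Front d s) := by
  constructor
  · rintro ⟨h1, h2⟩
    rw [Set.mem_insert_iff, not_or] at h1
    by_cases hts : t < s
    · left
      refine ⟨hts, fun x hx hxs => ?_⟩
      rcases h2 x hxs with rfl | hx'
      · exact lt_irrefl _ hx
      · exact ht.1 (hd hx.le hx')
    · refine .inr ⟨h1.1, h1.2, fun x hx => ?_⟩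
      rcases h2 x hx with rfl | hx'
      · exact absurd hx hts
      · exact hx'
  · rintro (hts | ⟨h1, h2, h3⟩)
    · refine ⟨?_, fun x hx => ?_⟩
      · rintro (rfl | hs)
        · exact lt_irrefl _ hts.1
        · exact ht.1 (hd hts.1.le hs)
      · rcases (le_of_lt_child hts hx).eq_or_lt with rfl | hx
        · exact .inl rfl
        · exact .inr (ht.2 x hx)
    · refine ⟨?_, fun x hx => .inr (h3 x hx)⟩
      rintro (rfl | hs)
      · exact h1 rfl
      · exact h2 hs

namespace Describes

theorem not_marked (h : Layout b T ℓ mate) (hG : Describes b ℓ mate d G) (ht : Front d t)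
    {p : G.V} (hp : Slab b ℓ mate t (G.label p)) : p ∉ G.marked := by
  intro hm
  obtain ⟨v, hv, hvr, he⟩ := hG.marked p hm
  exact h.not_slab_split hvr (fun hle => ht.1 (hG.lower hle hv)) (he ▸ hp)

theorem mem_component (h : Layout b T ℓ mate) (hG : Describes b ℓ mate d G) (ht : Front d t)
    {p q : G.V} (hp : Slab b ℓ mate t (G.label p)) :
    q ∈ G.component p ↔ Slab b ℓ mate t (G.label q) := by
  constructor
  · intro hq
    have hq' : G.unmarkedGraph.Reachable p q := hq
    rw [SimpleGraph.reachable_iff_reflTransGen] at hq'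
    induction hq' with
    | refl => exact hp
    | tail _ hadj ih =>
      obtain ⟨s, hs, h1, h2, -⟩ := (hG.adj _ hadj.2.1 _ hadj.2.2).1 hadj.1
      rwa [front_unique h ht hs (ih (by rwa [MarkedGraph.component, Set.mem_ofPred_eq,
        SimpleGraph.reachable_iff_reflTransGen])) h1]
  · intro hq
    exact hG.conn t ht p q (hG.not_marked h ht hp) (hG.not_marked h ht hq) hp hq

theorem initial (h : Layout b T ℓ mate) : Describes b ℓ mate ∅ MarkedGraph.initial := by
  have hV : ∀ p : MarkedGraph.initial.V, p = (0 : Fin 2) ∨ p = (1 : Fin 2) := by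
    intro p
    change Fin 2 at p
    fin_cases p
    · exact .inl rfl
    · exact .inr rfl
  have hl0 : MarkedGraph.initial.label (0 : Fin 2) = [.num 1] := rfl
  have hl1 : MarkedGraph.initial.label (1 : Fin 2) = [.num 2] := rfl
  have hsl : ∀ p, Slab b ℓ mate ⊥ (MarkedGraph.initial.label p) := by
    intro p
    rw [h.slab_bot]
    rcases hV p with rfl | rfl
    · exact .inl hl0
    · exact .inr hl1
  have hW : WAdj [.num 1] [.num 2] :=
    ⟨rfl, rfl, fun j h1 h2 => by simp only [List.length_singleton] at h2; omega⟩
  have hadj : ∀ p q : MarkedGraph.initial.V, MarkedGraph.initial.graph.Adj p q ↔ p ≠ q :=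
    fun p q => Iff.rfl
  refine ⟨isLowerSet_empty, ?_, ?_, ?_, ?_, ?_, ?_, ?_, ?_⟩
  · intro p q hpq
    rcases hV p with rfl | rfl <;> rcases hV q with rfl | rfl
    · rfl
    · simp [hl0, hl1] at hpq
    · simp [hl0, hl1] at hpq
    · rfl
  · exact fun p _ => ⟨⊥, front_bot.2 rfl, hsl p⟩
  · intro t ht a ha
    rw [front_bot.1 ht, h.slab_bot] at ha
    rcases ha with rfl | rfl
    · exact ⟨(0 : Fin 2), id, hl0⟩
    · exact ⟨(1 : Fin 2), id, hl1⟩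
  · exact fun p hp => absurd hp id
  · exact fun v hv => absurd hv id
  · intro p _ q _
    rw [hadj]
    constructor
    · intro hne
      refine ⟨⊥, front_bot.2 rfl, hsl p, hsl q, ?_⟩
      rcases hV p with rfl | rfl <;> rcases hV q with rfl | rfl
      · exact absurd rfl hne
      · exact .inl hW
      · exact .inr hW
      · exact absurd rfl hne
    · rintro ⟨t, -, -, -, h1 | h1⟩ rfl <;>
      · have := h1.zero_left.symm.trans h1.zero_right
        simp at this
  · exact fun p _ _ q _ => id
  · intro t _ p q _ _ _ _
    by_cases he : p = q
    · exact he ▸ .rfl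
    · exact SimpleGraph.Adj.reachable ⟨he, id, id⟩

/-- Without `x`, its component falls apart according to the symbol at the position of `v`. Each part
remains connected because all paths from it to `x` arrive through the same neighbor of `x`, by
`wAdj_unique`. -/
theorem split (h : Layout b T ℓ mate) (hG : Describes b ℓ mate d G) (hv : Front d v)
    (hvr : ¬ IsReflect v) {x : G.V} (hx : G.label x = ℓ v) :
    Describes b ℓ mate (insert v d) (G.split x) := by
  have := h.finite
  have hfr := fun s => hv.insert_iff (s := s) hG.lower
  have hxs : Slab b ℓ mate v (G.label x) := hx ▸ h.slab_split hvr
  have hxm := hG.not_marked h hv hxs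
  have hmem : ∀ p : G.V, p ∉ (G.split x).marked ↔ p ≠ x ∧ p ∉ G.marked := by
    intro p
    change ¬ (p ∈ insert x G.marked) ↔ _
    rw [Set.mem_insert_iff, not_or]
  have hchild : ∀ p : G.V, p ≠ x → Slab b ℓ mate v (G.label p) →
      numChildren v = b ∧ ∃ s, v ⋖ s ∧ Slab b ℓ mate s (G.label p) := fun p hp hps =>
    h.exists_child_slab hvr hps fun he => hp (hG.inj _ _ (he.trans hx.symm))
  have hback : ∀ (s : T) (p : G.V), v ⋖ s → Slab b ℓ mate s (G.label p) →
      p ≠ x ∧ Slab b ℓ mate v (G.label p) := by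
    intro s p hs hp
    obtain ⟨h1, h2⟩ := h.slab_of_child hvr hs hp
    exact ⟨fun he => h2 (he ▸ hx), h1⟩
  refine ⟨hv.isLowerSet_insert hG.lower, hG.inj, ?_, ?_, ?_, ?_, ?_, ?_, ?_⟩
  · intro (p : G.V) hp
    obtain ⟨hpx, hpm⟩ := (hmem p).1 hp
    obtain ⟨t, ht, hpt⟩ := hG.unmarked p hpm
    by_cases htv : t = v
    · obtain ⟨_, s, hs, hps⟩ := hchild p hpx (htv ▸ hpt)
      exact ⟨s, (hfr s).2 (.inl hs), hps⟩
    · exact ⟨t, (hfr t).2 (.inr ⟨htv, ht⟩), hpt⟩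
  · intro t ht a ha
    rcases (hfr t).1 ht with hvt | ⟨hne, ht⟩
    · obtain ⟨h1, h2⟩ := h.slab_of_child hvr hvt ha
      obtain ⟨p, hp, rfl⟩ := hG.exists_unmarked v hv a h1
      exact ⟨p, (hmem p).2 ⟨fun he => h2 (he ▸ hx), hp⟩, rfl⟩
    · obtain ⟨p, hp, rfl⟩ := hG.exists_unmarked t ht a ha
      refine ⟨p, (hmem p).2 ⟨?_, hp⟩, rfl⟩
      rintro rfl
      exact hne (front_unique h ht hv ha hxs)
  · rintro (p : G.V) (hp | hp)
    · exact ⟨v, .inl rfl, hvr, hp ▸ hx⟩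
    · obtain ⟨u, hu, hur, he⟩ := hG.marked p hp
      exact ⟨u, .inr hu, hur, he⟩
  · rintro u (rfl | hu) hur
    · exact ⟨x, .inl rfl, hx⟩
    · obtain ⟨p, hp, he⟩ := hG.exists_marked u hu hur
      exact ⟨p, .inr hp, he⟩
  · intro (p : G.V) hp (q : G.V) hq
    obtain ⟨hpx, hpm⟩ := (hmem p).1 hp
    obtain ⟨hqx, hqm⟩ := (hmem q).1 hq
    refine (hG.adj p hpm q hqm).trans ⟨?_, ?_⟩
    · rintro ⟨t, ht, h1, h2, h3⟩
      by_cases htv : t = v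
      · rw [htv] at h1 h2
        obtain ⟨hb, s, hs, hps⟩ := hchild p hpx h1
        obtain ⟨_, s', hs', hqs⟩ := hchild q hqx h2
        have hss : s = s' := by
          rcases h3 with h3 | h3
          · exact h.child_eq_of_wAdj hb hs hs' hps hqs h3
          · exact (h.child_eq_of_wAdj hb hs' hs hqs hps h3).symm
        subst hss
        exact ⟨s, (hfr s).2 (.inl hs), hps, hqs, h3⟩
      · exact ⟨t, (hfr t).2 (.inr ⟨htv, ht⟩), h1, h2, h3⟩
    · rintro ⟨t, ht, h1, h2, h3⟩
      rcases (hfr t).1 ht with hvt | ⟨-, ht⟩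
      · exact ⟨v, hv, (hback t p hvt h1).2, (hback t q hvt h2).2, h3⟩
      · exact ⟨t, ht, h1, h2, h3⟩
  · intro (p : G.V) hp h2 (q : G.V) hpq
    obtain ⟨hpx, hpm⟩ := (hmem p).1 hp
    refine (hmem q).2 ⟨?_, hG.two p hpm h2 q hpq⟩
    rintro rfl
    obtain ⟨t, ht, h3, h4, h5⟩ := (hG.adj p hpm q hxm).1 hpq
    rw [front_unique h ht hv h4 hxs] at h3
    obtain ⟨hb, -⟩ := hchild p hpx h3
    have h6 : symb (G.label q) 0 = some (.num 2) := hx ▸ h.symb_internal_zero hb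
    rcases h5 with h5 | h5
    · have := h5.zero_left.symm.trans h2
      simp at this
    · have := h5.zero_left.symm.trans h6
      simp at this
  · intro t ht (p : G.V) (q : G.V) hp hq hps hqs
    obtain ⟨hpx, hpm⟩ := (hmem p).1 hp
    obtain ⟨hqx, hqm⟩ := (hmem q).1 hq
    rcases (hfr t).1 ht with hvt | ⟨hne, ht⟩
    · have hb := h.internal_of_lt hvr hvt.1
      -- every node of the new component is connected to a neighbor of `x`
      have key : ∀ p : G.V, Slab b ℓ mate t (G.label p) → ∃ y : G.V,
          (G.split x).unmarkedGraph.Reachable p y ∧ Slab b ℓ mate t (G.label y) ∧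
            G.graph.Adj y x := by
        intro z hzs
        have hzv := (hback t z hvt hzs).2
        have hr := hG.conn v hv z x (hG.not_marked h hv hzv) hxm hzv hxs
        rw [SimpleGraph.reachable_iff_reflTransGen] at hr
        induction hr using Relation.ReflTransGen.head_induction_on with
        | refl => exact absurd rfl (hback t x hvt hzs).1
        | @head p p' hadj _ ih =>
          obtain ⟨hpx, hpv⟩ := hback t p hvt hzs
          by_cases hp' : p' = x
          · subst hp'
            exact ⟨p, .rfl, hzs, hadj.1⟩
          obtain ⟨s, hs, h1, h2, h3⟩ := (hG.adj _ hadj.2.1 _ hadj.2.2).1 hadj.1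
          rw [front_unique h hs hv h1 hpv] at h2
          obtain ⟨_, s', hs', hp's⟩ := hchild p' hp' h2
          have hss : t = s' := by
            rcases h3 with h3 | h3
            · exact h.child_eq_of_wAdj hb hvt hs' hzs hp's h3
            · exact (h.child_eq_of_wAdj hb hs' hvt hp's hzs h3).symm
          subst hss
          obtain ⟨y, hy, h4⟩ := ih hp's h2
          refine ⟨y, .trans (SimpleGraph.Adj.reachable ⟨hadj.1, ?_, ?_⟩) hy, h4⟩
          · exact (hmem p).2 ⟨hpx, hadj.2.1⟩
          · exact (hmem p').2 ⟨hp', hadj.2.2⟩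
      have hleft : ∀ y : G.V, Slab b ℓ mate t (G.label y) → G.graph.Adj y x →
          WAdj (G.label y) (ℓ v) := by
        intro y hy hadj
        obtain ⟨s, -, -, -, h3⟩ :=
          (hG.adj y (hG.not_marked h hv (hback t y hvt hy).2) x hxm).1 hadj
        rw [hx] at h3
        refine h3.resolve_right fun h4 => ?_
        have := h4.zero_left.symm.trans (h.symb_internal_zero hb)
        simp at this
      obtain ⟨y, hy, hys, hyx⟩ := key p hps
      obtain ⟨y', hy', hys', hyx'⟩ := key q hqs
      have hyy : y = y' := by
        refine hG.inj _ _ (h.wAdj_unique (fun e => (h.mate_lt v hvr).ne_bot ?_)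
          (h.length v) (hback t y hvt hys).2 (hback t y' hvt hys').2
          (hleft y hys hyx) (hleft y' hys' hyx') fun j hj => ?_)
        · exact e
        · rw [h.star_unique v hvr j hj, hys.closed v hb hvt.1, hys'.closed v hb hvt.1]
      exact hy.trans (hyy ▸ hy'.symm)
    · have hr := hG.conn t ht p q hpm hqm hps hqs
      have hpc : ∀ z, G.unmarkedGraph.Reachable p z → z ≠ x := by
        rintro z hz rfl
        have := (hG.mem_component h ht hps).1 hz
        exact hne (front_unique h ht hv this hxs)
      rw [SimpleGraph.reachable_iff_reflTransGen] at hr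
      refine (SimpleGraph.reachable_iff_reflTransGen (G := (G.split x).unmarkedGraph) p q).2 ?_
      clear hqx hqm hq hqs
      induction hr with
      | refl => exact .refl
      | @tail y z hy hadj ih =>
        have hy' : G.unmarkedGraph.Reachable p y := by
          rwa [SimpleGraph.reachable_iff_reflTransGen]
        have hz' := hy'.trans (SimpleGraph.Adj.reachable hadj)
        have hyu := (hmem y).2 ⟨hpc y hy', hadj.2.1⟩
        have hzu := (hmem z).2 ⟨hpc z hz', hadj.2.2⟩
        exact ih.tail ⟨hadj.1, hyu, hzu⟩

end Describes

end Describes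

/-! ### Reflections preserve the description -/

namespace Describes

variable {b : ℕ} {T : RootedTree} {ℓ : T → Word} {mate : T → T} {d : Set T} {t : T}
  {G : MarkedGraph}

-- Each label in the reflected component gains one top symbol, so slabs change as in `slab_of_cons`
-- and edges as in `wAdj_cons`. Everything outside this component keeps index 1 and its label.
open Classical in
theorem reflect (h : Layout b T ℓ mate) (hG : Describes b ℓ mate d G) (ht : Front d t)
    (htr : IsReflect t) {x : G.V} (hx : G.label x = ℓ t) :
    Describes b ℓ mate (insert t d) (G.reflect b x) := by
  have := h.finite
  have hb3 := h.three_le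
  obtain ⟨s, hs⟩ := Set.ncard_eq_one.1 htr
  have hts : t ⋖ s := by
    have : s ∈ ({s} : Set T) := rfl
    rwa [← hs] at this
  have hchild : ∀ u, t ⋖ u ↔ u = s := fun u => by
    rw [← Set.mem_singleton_iff, ← hs]
    rfl
  have hfr : ∀ u, Front (insert t d) u ↔ u = s ∨ (u ≠ t ∧ Front d u) := fun u => by
    rw [ht.insert_iff hG.lower, hchild]
  have hfs : Front (insert t d) s := (hfr s).2 (.inl rfl)
  have hsd : ∀ v ∈ d, ¬ s ≤ v := fun v hv hle => ht.1 (hG.lower (hts.1.le.trans hle) hv)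
  have hsfd : ¬ Front d s := fun hf => ht.1 (hf.2 t hts.1)
  have hxs : Slab b ℓ mate t (G.label x) := hx ▸ h.slab_reflect htr
  have hxm := hG.not_marked h ht hxs
  have hcomp : ∀ q, q ∈ G.component x ↔ Slab b ℓ mate t (G.label q) := fun q =>
    hG.mem_component h ht hxs
  have heqx : ∀ p, p = x ↔ G.label p = ℓ t :=
    fun p => ⟨fun e => e ▸ hx, fun e => hG.inj _ _ (e.trans hx.symm)⟩
  let top : (G.reflect b x).V → Symbol := fun p => if p.1.2 = x then .star else .num p.1.1
  have htop : ∀ p, top p = .star ↔ G.label p.1.2 = ℓ t := by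
    intro p
    rw [← heqx]
    by_cases hp : p.1.2 = x <;> simp [top, hp]
  have hidx : ∀ p : (G.reflect b x).V, p.1.1 ∈ Set.Icc 1 b := by
    intro p
    rcases p.2 with h1 | ⟨h1, h2, -⟩
    · rw [h1]
      exact ⟨le_rfl, by omega⟩
    · exact ⟨by omega, h2⟩
  have hidx1 : ∀ p : (G.reflect b x).V,
      p.1.2 = x ∨ ¬ Slab b ℓ mate t (G.label p.1.2) → p.1.1 = 1 := by
    intro p hp
    rcases p.2 with h1 | ⟨-, -, h2, h3⟩
    · exact h1
    · exact absurd hp (by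
        rw [not_or, not_not]
        exact ⟨h3, (hcomp _).1 h2⟩)
  have hin : ∀ p : (G.reflect b x).V, Slab b ℓ mate t (G.label p.1.2) →
      (G.reflect b x).label p = top p :: G.label p.1.2 := by
    intro p hp
    by_cases hpx : p.1.2 = x
    · simp [MarkedGraph.reflect, top, hpx]
    · simp [MarkedGraph.reflect, top, hpx, (hcomp _).2 hp]
  have hout : ∀ p : (G.reflect b x).V, ¬ Slab b ℓ mate t (G.label p.1.2) →
      (G.reflect b x).label p = G.label p.1.2 := by
    intro p hp
    have hpx : p.1.2 ≠ x := fun e => hp (by rwa [e])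
    have hpc : p.1.2 ∉ G.component x := fun e => hp ((hcomp _).1 e)
    simp [MarkedGraph.reflect, hpx, hpc]
  have hext : ∀ p q : (G.reflect b x).V, p.1.1 = q.1.1 → p.1.2 = q.1.2 → p = q :=
    fun p q h1 h2 => Subtype.ext (Prod.ext h1 h2)
  have hslab : ∀ p : (G.reflect b x).V,
      Slab b ℓ mate s ((G.reflect b x).label p) ↔ Slab b ℓ mate t (G.label p.1.2) := by
    intro p
    constructor
    · intro hp
      by_contra hn
      rw [hout p hn] at hp
      by_cases hm : p.1.2 ∈ G.marked
      · obtain ⟨v, hv, hvr, he⟩ := hG.marked _ hm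
        exact h.not_slab_split hvr (hsd v hv) (he ▸ hp)
      · obtain ⟨u, hu, hpu⟩ := hG.unmarked _ hm
        have hut : u ≠ t := by
          rintro rfl
          exact hn hpu
        have := front_unique h ((hfr u).2 (.inr ⟨hut, hu⟩)) hfs hpu hp
        exact hsfd (this ▸ hu)
    · intro hp
      rw [hin p hp]
      by_cases hpx : p.1.2 = x
      · have h1 : top p = .star := if_pos hpx
        rw [h1, hpx, hx]
        exact h.slab_cons_star htr hts
      · have h1 : top p = .num p.1.1 := if_neg hpx
        rw [h1]
        exact h.slab_cons_num htr hts (hidx p) hp fun e => hpx ((heqx _).2 e)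
  have hother : ∀ u, u ≠ t → Front d u → ∀ p : (G.reflect b x).V,
      (Slab b ℓ mate u ((G.reflect b x).label p) ↔ Slab b ℓ mate u (G.label p.1.2)) ∧
      (Slab b ℓ mate u (G.label p.1.2) → ¬ Slab b ℓ mate t (G.label p.1.2)) := by
    intro u hut hu p
    have h1 : Slab b ℓ mate u (G.label p.1.2) → ¬ Slab b ℓ mate t (G.label p.1.2) :=
      fun h2 h3 => hut (front_unique h hu ht h2 h3)
    refine ⟨?_, h1⟩
    by_cases hp : Slab b ℓ mate t (G.label p.1.2)
    · refine ⟨fun h2 => ?_, fun h2 => absurd hp (h1 h2)⟩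
      have := front_unique h ((hfr u).2 (.inr ⟨hut, hu⟩)) hfs h2 ((hslab p).2 hp)
      exact absurd (this ▸ hu) hsfd
    · rw [hout p hp]
  have hmk : ∀ p : (G.reflect b x).V, p ∈ (G.reflect b x).marked ↔ p.1.2 ∈ G.marked :=
    fun p => Iff.rfl
  have hadj : ∀ p q : (G.reflect b x).V, (G.reflect b x).graph.Adj p q ↔
      G.graph.Adj p.1.2 q.1.2 ∧ (p.1.1 = q.1.1 ∨ p.1.2 = x ∨ q.1.2 = x) := fun p q => Iff.rfl
  refine ⟨ht.isLowerSet_insert hG.lower, ?_, ?_, ?_, ?_, ?_, ?_, ?_, ?_⟩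
  · intro p q hpq
    have hiff : Slab b ℓ mate t (G.label p.1.2) ↔ Slab b ℓ mate t (G.label q.1.2) := by
      rw [← hslab, ← hslab, hpq]
    by_cases hp : Slab b ℓ mate t (G.label p.1.2)
    · rw [hin p hp, hin q (hiff.1 hp), List.cons.injEq] at hpq
      have h2 := hG.inj _ _ hpq.2
      refine hext p q ?_ h2
      by_cases hpx : p.1.2 = x
      · rw [hidx1 p (.inl hpx), hidx1 q (.inl (h2 ▸ hpx))]
      · have h3 := hpq.1
        simp only [top, if_neg hpx, if_neg (h2 ▸ hpx)] at h3
        exact Symbol.num.inj h3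
    · have hq := fun hq => hp (hiff.2 hq)
      rw [hout p hp, hout q hq] at hpq
      exact hext p q (by rw [hidx1 p (.inr hp), hidx1 q (.inr hq)]) (hG.inj _ _ hpq)
  · intro p hp
    obtain ⟨u, hu, hpu⟩ := hG.unmarked p.1.2 hp
    by_cases hut : u = t
    · exact ⟨s, hfs, (hslab p).2 (hut ▸ hpu)⟩
    · exact ⟨u, (hfr u).2 (.inr ⟨hut, hu⟩), (hother u hut hu p).1.2 hpu⟩
  · intro u hu a ha
    rcases (hfr u).1 hu with rfl | ⟨hut, hu⟩
    · rcases h.slab_of_cons htr hts ha with ⟨k, hk, a', rfl, ha', hne⟩ | rfl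
      · obtain ⟨p, hp, rfl⟩ := hG.exists_unmarked t ht a' ha'
        have hpx : p ≠ x := fun e => hne ((heqx p).1 e)
        have hkp : k = 1 ∨ (2 ≤ k ∧ k ≤ b ∧ p ∈ G.component x ∧ p ≠ x) := by
          rcases hk.1.eq_or_lt with h1 | h1
          · exact .inl h1.symm
          · exact .inr ⟨h1, hk.2, (hcomp p).2 ha', hpx⟩
        refine ⟨⟨(k, p), hkp⟩, hp, ?_⟩
        rw [hin ⟨(k, p), hkp⟩ ha']
        simp [top, hpx]
      · refine ⟨⟨(1, x), .inl rfl⟩, hxm, ?_⟩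
        rw [hin ⟨(1, x), .inl rfl⟩ hxs]
        simp [top, hx]
    · obtain ⟨p, hp, rfl⟩ := hG.exists_unmarked u hu a ha
      exact ⟨⟨(1, p), .inl rfl⟩, hp, hout _ ((hother u hut hu ⟨(1, p), .inl rfl⟩).2 ha)⟩
  · intro p hp
    obtain ⟨v, hv, hvr, he⟩ := hG.marked p.1.2 hp
    refine ⟨v, .inr hv, hvr, ?_⟩
    rw [hout p fun hps => hG.not_marked h ht hps hp, he]
  · intro v hv hvr
    have hv' : v ∈ d := hv.resolve_left fun e => hvr (e ▸ htr)
    obtain ⟨p, hp, he⟩ := hG.exists_marked v hv' hvr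
    refine ⟨⟨(1, p), .inl rfl⟩, hp, ?_⟩
    rw [hout ⟨(1, p), .inl rfl⟩ fun hps => hG.not_marked h ht hps hp]
    exact he
  · intro p hp q hq
    rw [hadj, hG.adj _ hp _ hq]
    constructor
    · rintro ⟨⟨u, hu, h1, h2, h3⟩, h4⟩
      by_cases hut : u = t
      · subst hut
        refine ⟨s, hfs, (hslab p).2 h1, (hslab q).2 h2, ?_⟩
        have h5 : top p = top q ∨ G.label p.1.2 = ℓ u ∨ G.label q.1.2 = ℓ u := by
          rw [← heqx, ← heqx]
          by_cases hpx : p.1.2 = x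
          · exact .inr (.inl hpx)
          · by_cases hqx : q.1.2 = x
            · exact .inr (.inr hqx)
            · left
              simp only [top, if_neg hpx, if_neg hqx]
              exact congrArg _ (h4.resolve_right (by simp [hpx, hqx]))
        rw [hin p h1, hin q h2, h.wAdj_cons htr h1 h2 (htop p) (htop q),
          h.wAdj_cons htr h2 h1 (htop q) (htop p)]
        exact h3.imp (fun h3 => ⟨h3, h5⟩) fun h3 => ⟨h3, h5.imp Eq.symm Or.symm⟩
      · refine ⟨u, (hfr u).2 (.inr ⟨hut, hu⟩), (hother u hut hu p).1.2 h1,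
          (hother u hut hu q).1.2 h2, ?_⟩
        rwa [hout p ((hother u hut hu p).2 h1), hout q ((hother u hut hu q).2 h2)]
    · rintro ⟨u, hu, h1, h2, h3⟩
      rcases (hfr u).1 hu with rfl | ⟨hut, hu⟩
      · rw [hslab] at h1 h2
        rw [hin p h1, hin q h2, h.wAdj_cons htr h1 h2 (htop p) (htop q),
          h.wAdj_cons htr h2 h1 (htop q) (htop p)] at h3
        refine ⟨⟨t, ht, h1, h2, h3.imp And.left And.left⟩, ?_⟩
        have h5 : top p = top q ∨ G.label p.1.2 = ℓ t ∨ G.label q.1.2 = ℓ t :=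
          h3.elim And.right fun h3 => h3.2.imp Eq.symm Or.symm
        rw [← heqx, ← heqx] at h5
        by_cases hpx : p.1.2 = x
        · exact .inr (.inl hpx)
        · by_cases hqx : q.1.2 = x
          · exact .inr (.inr hqx)
          · left
            have h6 := h5.resolve_right (by simp [hpx, hqx])
            simp only [top, if_neg hpx, if_neg hqx] at h6
            exact Symbol.num.inj h6
      · rw [(hother u hut hu p).1] at h1
        rw [(hother u hut hu q).1] at h2
        have h4 := (hother u hut hu p).2 h1
        have h5 := (hother u hut hu q).2 h2
        rw [hout p h4, hout q h5] at h3
        exact ⟨⟨u, hu, h1, h2, h3⟩, .inl (by rw [hidx1 p (.inr h4), hidx1 q (.inr h5)])⟩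
  · intro p hp h2 q hpq
    refine hG.two p.1.2 hp ?_ q.1.2 hpq.1
    by_cases hps : Slab b ℓ mate t (G.label p.1.2)
    · rwa [hin p hps, symb_cons_of_lt (by rw [hps.length]; omega)] at h2
    · rwa [hout p hps] at h2
  · intro u hu p q hp hq hpu hqu
    rcases (hfr u).1 hu with rfl | ⟨hut, hu⟩
    -- A path from `x` lifts to each copy, since `x` is shared by all copies.
    · have key : ∀ z, Relation.ReflTransGen G.unmarkedGraph.Adj x z →
          ∀ p : (G.reflect b x).V, p.1.2 = z →
            (G.reflect b x).unmarkedGraph.Reachable ⟨(1, x), .inl rfl⟩ p := by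
        intro z hz
        induction hz with
        | refl =>
          intro p hp
          have : p = ⟨(1, x), .inl rfl⟩ := hext _ _ (hidx1 p (.inl hp)) hp
          rw [this]
          exact .rfl
        | @tail y z hy hyz ih =>
          intro p hp
          have hyc : y ∈ G.component x := by
            rwa [MarkedGraph.component, Set.mem_ofPred_eq, SimpleGraph.reachable_iff_reflTransGen]
          obtain ⟨y', hy1, hy2⟩ : ∃ y' : (G.reflect b x).V, y'.1.2 = y ∧
              (y'.1.1 = p.1.1 ∨ y = x) := by
            by_cases hyx : y = x
            · exact ⟨⟨(1, y), .inl rfl⟩, rfl, .inr hyx⟩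
            · have hk : p.1.1 = 1 ∨ (2 ≤ p.1.1 ∧ p.1.1 ≤ b ∧ y ∈ G.component x ∧ y ≠ x) := by
                rcases p.2 with h1 | ⟨h1, h2, -⟩
                · exact .inl h1
                · exact .inr ⟨h1, h2, hyc, hyx⟩
              exact ⟨⟨(p.1.1, y), hk⟩, rfl, .inl rfl⟩
          refine (ih y' hy1).trans (SimpleGraph.Adj.reachable ⟨(hadj _ _).2 ⟨?_, ?_⟩, ?_, ?_⟩)
          · rw [hy1, hp]
            exact hyz.1
          · rcases hy2 with h1 | h1
            · exact .inl h1
            · exact .inr (.inl (hy1.trans h1))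
          · rw [hmk, hy1]
            exact hyz.2.1
          · rw [hmk, hp]
            exact hyz.2.2
      have hr : ∀ p : (G.reflect b x).V, Slab b ℓ mate u ((G.reflect b x).label p) →
          Relation.ReflTransGen G.unmarkedGraph.Adj x p.1.2 := fun p hp =>
        (SimpleGraph.reachable_iff_reflTransGen _ _).1 ((hcomp p.1.2).2 ((hslab p).1 hp))
      exact (key _ (hr p hpu) p rfl).symm.trans (key _ (hr q hqu) q rfl)
    · rw [(hother u hut hu p).1] at hpu
      rw [(hother u hut hu q).1] at hqu
      have hr := hG.conn u hu p.1.2 q.1.2 hp hq hpu hqu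
      have e1 : p = ⟨(1, p.1.2), .inl rfl⟩ :=
        hext _ _ (hidx1 p (.inr ((hother u hut hu p).2 hpu))) rfl
      have e2 : q = ⟨(1, q.1.2), .inl rfl⟩ :=
        hext _ _ (hidx1 q (.inr ((hother u hut hu q).2 hqu))) rfl
      rw [e1, e2]
      let f : G.unmarkedGraph →g (G.reflect b x).unmarkedGraph :=
        ⟨fun y => ⟨(1, y), .inl rfl⟩, fun hyz => ⟨(hadj _ _).2 ⟨hyz.1, .inl rfl⟩, hyz.2⟩⟩
      exact hr.map f

theorem process (h : Layout b T ℓ mate) (hG : Describes b ℓ mate d G) (ht : Front d t) :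
    Describes b ℓ mate (insert t d) (G.process b ℓ t) := by
  obtain ⟨p, -, hp⟩ := hG.exists_unmarked t ht _ (h.slab_self t)
  have hex : ∃ x : G.V, G.label x = ℓ t := ⟨p, hp⟩
  rw [MarkedGraph.process, dif_pos hex]
  by_cases htr : IsReflect t
  · rw [if_pos htr]
    exact hG.reflect h ht htr hex.choose_spec
  · rw [if_neg htr]
    exact hG.split h ht htr hex.choose_spec

end Describes

/-! ### The description along a processing order -/

variable {b : ℕ} {T : RootedTree} {ℓ : T → Word} {mate : T → T} {o : List T}

theorem front_take (ho : IsProcessingOrder o) {i : ℕ} (hi : i < o.length) :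
    Front {t | t ∈ o.take i} o[i] := by
  obtain ⟨h1, h2, h3⟩ := ho
  constructor
  · intro hmem
    obtain ⟨j, hj, he⟩ := List.mem_take_iff_getElem.1 hmem
    have := (h1.getElem_inj_iff).1 he
    omega
  · intro s hs
    obtain ⟨j, hj, rfl⟩ := List.mem_iff_getElem.1 (h2 s)
    refine List.mem_take_iff_getElem.2 ⟨j, ?_, rfl⟩
    by_contra hn
    rcases (show i < j ∨ i = j by omega) with h4 | rfl
    · exact List.pairwise_iff_getElem.1 h3 i j hi hj h4 hs
    · exact lt_irrefl _ hs

theorem describes_graphAfter (h : Layout b T ℓ mate) (ho : IsProcessingOrder o) {i : ℕ}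
    (hi : i ≤ o.length) :
    Describes b ℓ mate {t | t ∈ o.take i} (graphAfter b ℓ (o.take i)) := by
  induction i with
  | zero =>
    have : {t : T | t ∈ o.take 0} = ∅ := by simp
    rw [this]
    exact Describes.initial h
  | succ i ih =>
    have hi' : i < o.length := hi
    have h1 : {t | t ∈ o.take (i + 1)} = insert o[i] {t | t ∈ o.take i} := by
      ext t
      rw [List.take_succ_eq_append_getElem hi', Set.mem_ofPred_eq, List.mem_append,
        List.mem_singleton, or_comm]
      rfl
    have h2 : graphAfter b ℓ (o.take (i + 1)) =
        (graphAfter b ℓ (o.take i)).process b ℓ o[i] := by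
      rw [List.take_succ_eq_append_getElem hi', graphAfter, List.foldl_append]
      rfl
    rw [h1, h2]
    exact (ih hi'.le).process h (front_take ho hi')

/-- Every split node of the construction tree gives a node of the input tree. -/
theorem ncard_split_le (h : Layout b T ℓ mate) (ho : IsProcessingOrder o) :
    {v : T | ¬ IsReflect v}.ncard ≤ Nat.card (inputTree b ℓ o).V := by
  have hG := describes_graphAfter h ho (le_refl o.length)
  rw [List.take_length] at hG
  have := (inputTree b ℓ o).finite
  choose f _ hf using fun v : {v : T // ¬ IsReflect v} => hG.exists_marked v (ho.2.1 v) v.2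
  rw [← Nat.card_coe_set_eq]
  refine Nat.card_le_card_of_injective (fun v : {v : T | ¬ IsReflect v} => f ⟨v.1, v.2⟩) ?_
  intro v v' he
  have h1 := (hf ⟨v.1, v.2⟩).symm.trans ((congrArg _ he).trans (hf ⟨v'.1, v'.2⟩))
  exact Subtype.ext (h.split_injOn v.2 v'.2 h1)

/-! ### Distances in the intermediate graphs -/

section Distance

variable {b : ℕ} {T : RootedTree} {ℓ : T → Word} {mate : T → T} {s v w : T}

/-- The final substring of length `n`. -/
def trunc (n : ℕ) (a : Word) : Word := wordOf n (symbD a)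

theorem length_trunc (n : ℕ) (a : Word) : (trunc n a).length = n := length_wordOf _ _

theorem symb_trunc {n i : ℕ} {a : Word} (hi : i < n) (ha : i < a.length) :
    symb (trunc n a) i = symb a i := by
  rw [trunc, symb_wordOf hi, symbD_spec ha]

namespace Layout

theorem symb_trunc_label (h : Layout b T ℓ mate) (hvs : v ≤ s) {i : ℕ} (hi : i ≤ rk v) :
    symb (trunc (rk v + 1) (ℓ s)) i = symb (ℓ s) i := by
  have := h.finite
  have := rk_mono hvs
  exact symb_trunc (by omega) (by rw [h.length]; omega)

/-- If `mate s` is above `v`, the truncation keeps the star of `ℓ s`, and `mate s` is still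
unmatched at `v`. If it is below `v`, the truncation is a final part of the label of `mate s`:
star-free, and by independence not cleared. -/
theorem slab_trunc (h : Layout b T ℓ mate) (hv : ¬ IsReflect v) (hs : ¬ IsReflect s)
    (hvs : v < s) : Slab b ℓ mate v (trunc (rk v + 1) (ℓ s)) := by
  have := h.finite
  have hsy := fun i (hi : i ≤ rk v) => h.symb_trunc_label hvs.le hi
  have hmr := h.mate_reflect s hs
  refine ⟨length_trunc _ _, ?_, ?_⟩
  · intro g hg hgv
    have h1 := h.rk_mate_lt (h.not_isReflect hg)
    have h2 := rk_mono hgv.le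
    rw [hsy _ (by omega), h.symb_child hg hgv hvs.le]
  · rcases ancestors_lt_trichotomy (h.mate_lt s hs).le hvs.le with hm | hm | hm
    · have h1 := rk_lt hmr hm
      refine .inr ⟨mate s, hmr, hm, fun g hg hgv => h.mate_ne s g hs hg (hgv.trans hvs), ?_, ?_, ?_⟩
      · rw [hsy _ (by omega), h.symb_mate s hs]
      · intro j hj
        rw [hsy _ (by omega), h.symb_below_mate s hs j hj]
      · intro j h2 h3
        rw [hsy _ h3]
        exact h.isNum_symb_split hs (h3.trans (rk_mono hvs.le)) h2.ne'
    · exact absurd (hm ▸ hmr) hv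
    · have h1 := rk_mono hm.le
      have hsy' : ∀ i ≤ rk v, symb (trunc (rk v + 1) (ℓ s)) i = symb (ℓ (mate s)) i :=
        fun i hi => by rw [hsy i hi, h.symb_below_mate s hs i (by omega)]
      refine .inl ⟨?_, ?_, ?_⟩
      · rw [hsy' 0 (by omega)]
        exact (h.mem_words _).1
      · intro j hj
        rw [hsy' j hj]
        exact h.isNum_symb_reflect hmr (by omega)
      · intro w hw hwv hsuf
        have h2 := rk_mono hwv.le
        refine h.independent w (mate s) hw hmr (hwv.trans hm).ne (suffix_iff_symb.2 fun i hi => ?_)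
        rw [h.length] at hi
        rw [← hsy' i (by omega)]
        exact suffix_iff_symb.1 hsuf i (by rwa [h.length])

theorem wAdj_trunc (h : Layout b T ℓ mate) {c : T → ℕ} {u s : T} (hl : Link b ℓ c s u)
    (hvs : v ≤ s) : WAdj (trunc (rk v + 1) (ℓ u)) (trunc (rk v + 1) (ℓ s)) := by
  have := h.finite
  have h1 := rk_mono hvs
  refine ⟨?_, ?_, fun j hj hj' => ?_⟩
  · rw [h.symb_trunc_label (hvs.trans hl.lt.le) (by omega), h.symb_leaf_zero hl.leaf]
  · rw [h.symb_trunc_label hvs (by omega), h.symb_internal_zero hl.internal]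
  · rw [length_trunc] at hj'
    rw [h.symb_trunc_label (hvs.trans hl.lt.le) (by omega), h.symb_trunc_label hvs (by omega)]
    exact hl.fits j hj (by omega)

end Layout

variable {d : Set T} {G : MarkedGraph}

namespace Describes

theorem exists_node (h : Layout b T ℓ mate) (hG : Describes b ℓ mate d G) (hv : Front d v)
    (hvr : ¬ IsReflect v) (hs : ¬ IsReflect s) (hvs : v < s) :
    ∃ p ∉ G.marked, G.label p = trunc (rk v + 1) (ℓ s) :=
  hG.exists_unmarked v hv _ (h.slab_trunc hvr hs hvs)

theorem exists_walk (h : Layout b T ℓ mate) (hG : Describes b ℓ mate d G) (hv : Front d v)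
    (hvr : ¬ IsReflect v) (hvw : v < w) {c : T → ℕ} {s t : T} (q : (linkGraph b ℓ c w).Walk s t) :
    ∀ p p' : G.V, G.label p = trunc (rk v + 1) (ℓ s) → G.label p' = trunc (rk v + 1) (ℓ t) →
      ∃ q' : G.unmarkedGraph.Walk p p', q'.length = q.length := by
  have := h.finite
  induction q with
  | nil =>
    intro p p' hp hp'
    obtain rfl := hG.inj _ _ (hp.trans hp'.symm)
    exact ⟨.nil, rfl⟩
  | @cons s s' t hadj q ih =>
    intro p p' hp hp'
    obtain ⟨⟨hws, hws'⟩, hl⟩ := hadj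
    have hsr : ¬ IsReflect s ∧ ¬ IsReflect s' := by
      rcases hl with hl | hl
      · exact ⟨h.not_isReflect hl.internal, Layout.not_isReflect_leaf hl.leaf⟩
      · exact ⟨Layout.not_isReflect_leaf hl.leaf, h.not_isReflect hl.internal⟩
    obtain ⟨y, hy, hys⟩ := hG.exists_node h hv hvr hsr.2 (hvw.trans hws')
    obtain ⟨q', hq'⟩ := ih y p' hys hp'
    have hps := h.slab_trunc hvr hsr.1 (hvw.trans hws)
    have hpm := hG.not_marked h hv (hp ▸ hps)
    have ha : G.unmarkedGraph.Adj p y := by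
      refine ⟨(hG.adj p hpm y hy).2 ⟨v, hv, hp ▸ hps,
        hys ▸ h.slab_trunc hvr hsr.2 (hvw.trans hws'), ?_⟩, hpm, hy⟩
      rw [hp, hys]
      rcases hl with hl | hl
      · exact .inr (h.wAdj_trunc hl (hvw.trans hws).le)
      · exact .inl (h.wAdj_trunc hl (hvw.trans hws').le)
    exact ⟨.cons ha q', congrArg (· + 1) hq'⟩

/-- The truncated label is also a truncation of the star-free label of `w`, so `Fits` leaves no
freedom from position 2 on. Positions 0 and 1 of a neighbor are 1 and a star, so there is exactly
one neighbor. -/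
theorem isTwoLeaf (h : Layout b T ℓ mate) (hG : Describes b ℓ mate d G) (hv : Front d v)
    (hvb : numChildren v = b) (hw : IsReflect w) (hvw : v < w) {z : T} (hz : numChildren z = b)
    (hzw : mate z = w) {y : G.V} (hy : G.label y = trunc (rk v + 1) (ℓ z)) : G.IsTwoLeaf y := by
  have := h.finite
  have hvr := h.not_isReflect hvb
  have hzr := h.not_isReflect hz
  have hvz : v < z := hvw.trans (hzw ▸ h.mate_lt z hzr)
  have hrk := rk_mono hvw.le
  have hsy : ∀ i ≤ rk v, symb (G.label y) i = symb (ℓ w) i := fun i hi => by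
    rw [hy, h.symb_trunc_label hvz.le hi, h.symb_below_mate z hzr i (by rw [hzw]; omega), hzw]
  have hyl : (G.label y).length = rk v + 1 := by rw [hy, length_trunc]
  have hy0 : symb (G.label y) 0 = some (.num 2) := by
    rw [hy, h.symb_trunc_label hvz.le (by omega), h.symb_internal_zero hz]
  have hys : Slab b ℓ mate v (G.label y) := hy ▸ h.slab_trunc hvr hzr hvz
  have hym := hG.not_marked h hv hys
  have hvbot : v ≠ ⊥ := fun e => hvr (e ▸ h.root_reflect)
  have hrv : 2 ≤ rk v := by
    have h1 := h.rk_mate_pos hvb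
    have h2 := h.rk_mate_lt hvr
    omega
  -- the only neighbor
  let f : ℕ → Symbol := fun j => if j = 0 then .num 1 else if j = 1 then .star else symbD (ℓ w) j
  set a := wordOf (rk v + 1) f with ha
  have ha0 : symb a 0 = some (.num 1) := symb_wordOf (by omega)
  have ha1 : symb a 1 = some .star := symb_wordOf (by omega)
  have ha2 : ∀ j, 2 ≤ j → j ≤ rk v → symb a j = symb (ℓ w) j := fun j h1 h2 => by
    rw [ha, symb_wordOf (by omega), symbD_spec (by rw [h.length]; omega)]
    simp [f, show j ≠ 0 by omega, show j ≠ 1 by omega]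
  have has : Slab b ℓ mate v a := by
    refine ⟨length_wordOf _ _, fun g hg hgv => ?_, .inr ⟨⊥, h.root_reflect,
      bot_lt_iff_ne_bot.2 hvbot, fun g hg hgv => h.mate_ne_bot (h.internal_of_lt hg hgv), ?_, ?_, ?_⟩⟩
    · have h1 := h.rk_mate_pos hg
      have h2 := h.rk_mate_lt (h.not_isReflect hg)
      have h3 := rk_mono hgv.le
      rw [ha2 _ (by omega) (by omega), h.symb_child hg hgv hvw.le]
    · rw [rk_bot]
      exact ha1
    · intro j hj
      rw [rk_bot] at hj
      obtain rfl : j = 0 := by omega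
      rw [ha0, h.root]
      rfl
    · intro j h1 h2
      rw [rk_bot] at h1
      rw [ha2 j (by omega) h2]
      exact h.isNum_symb_reflect hw (by omega)
  have hay : WAdj a (G.label y) := ⟨ha0, hy0, fun j h1 h2 => .inl <| by
    rw [hyl] at h2
    rw [ha2 j h1 (by omega), hsy j (by omega)]⟩
  obtain ⟨p, hp, hpa⟩ := hG.exists_unmarked v hv a has
  have hadj : ∀ q, G.graph.Adj y q ↔ q = p := by
    intro q
    constructor
    · intro hq
      obtain ⟨t, ht, h1, h2, h3⟩ := (hG.adj y hym q (hG.two y hym hy0 q hq)).1 hq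
      rw [front_unique h ht hv h1 hys] at h2
      refine hG.inj _ _ (Eq.trans ?_ hpa.symm)
      refine h.wAdj_unique hvbot hyl h2 has (h3.resolve_left fun h4 => ?_) hay fun j hj => ?_
      · have := h4.zero_left.symm.trans hy0
        simp at this
      · have hjl := lt_length_of_symb hj
        rw [hsy j (by omega)] at hj
        exact absurd hj (h.isNum_symb_reflect hw (by omega)).ne_star
    · rintro rfl
      exact (hG.adj y hym q hp).2 ⟨v, hv, hys, hpa ▸ has, .inr (hpa ▸ hay)⟩
  refine ⟨Set.ncard_eq_one.2 ⟨p, ?_⟩, hy0⟩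
  ext q
  exact hadj q

end Describes

theorem unmarkedGraph_le (G : MarkedGraph) : G.unmarkedGraph ≤ G.graph := fun _ _ h => h.1

/-- In the graph just before `v` is processed, the node labeled `ℓ v` is adjacent to the truncation
of `u`, from which the truncated walk leads to a 2-leaf of the same component. The total length
`q.length + 1` is at least `D`. -/
theorem far_of_isDistanceCorrect (h : Layout b T ℓ mate) {o : List T} (ho : IsProcessingOrder o)
    {D : ℕ} (hD : IsDistanceCorrect b ℓ o D) : Far b ℓ mate (D - 1) := by
  intro c hc w hw u v hcand hvw hwu q
  have hvb := hcand.internal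
  have hvr := h.not_isReflect hvb
  obtain ⟨i, hi, hiv⟩ := List.mem_iff_getElem.1 (ho.2.1 v)
  have hG := describes_graphAfter h ho hi.le
  have hv := front_take ho hi
  rw [hiv] at hv
  set G := graphAfter b ℓ (o.take i) with hGdef
  obtain ⟨x, hxm, hx⟩ := hG.exists_unmarked v hv _ (h.slab_split hvr)
  have hur := Layout.not_isReflect_leaf hcand.leaf
  have hus := h.slab_trunc hvr hur hcand.lt
  obtain ⟨p, hpm, hp⟩ := hG.exists_node h hv hvr hur hcand.lt
  have hpiv := h.isPivot_pivot hc hw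
  have hvz : v < pivot b ℓ mate c w := hvw.trans (h.lt_pivot hc hw)
  obtain ⟨y, hym, hy⟩ := hG.exists_node h hv hvr hpiv.split hvz
  obtain ⟨q', hq'⟩ := hG.exists_walk h hv hvr hvw q p y hp hy
  have hxp : G.unmarkedGraph.Adj x p := by
    refine ⟨(hG.adj x hxm p hpm).2 ⟨v, hv, hx ▸ h.slab_split hvr, hp ▸ hus, .inr ?_⟩, hxm, hpm⟩
    have := h.finite
    have hrk := rk_mono hcand.lt.le
    rw [hp, hx]
    refine ⟨?_, h.symb_internal_zero hvb, fun j hj hj' => ?_⟩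
    · rw [h.symb_trunc_label hcand.lt.le (by omega), h.symb_leaf_zero hcand.leaf]
    · rw [h.length] at hj'
      rw [h.symb_trunc_label hcand.lt.le (by omega)]
      exact hcand.fits j hj hj'
  have hleaf := hG.isTwoLeaf h hv hvb hw hvw (h.internal_pivot hc hw fun e => by
    subst e
    exact not_lt_bot hvw) hpiv.mate_eq hy
  have h1 := hD i hi (hiv ▸ hvr) x y (by rw [hiv]; exact hx) hleaf
    ((SimpleGraph.Walk.cons hxp q').reachable)
  have h2 := SimpleGraph.dist_le ((SimpleGraph.Walk.cons hxp q').mapLe (unmarkedGraph_le G))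
  rw [SimpleGraph.Walk.length_map, SimpleGraph.Walk.length_cons, hq'] at h2
  have h3 := h1.trans h2
  omega

end Distance

/-! ### Random choices -/

theorem exists_isTwin {b : ℕ} {T : RootedTree} {ℓ : T → Word} {mate : T → T}
    (h : Layout b T ℓ mate) : ∃ tw : slots b ℓ → slots b ℓ, IsTwin tw := by
  have key : ∀ p : slots b ℓ, ∃ q : slots b ℓ, q.1.1 = p.1.1 ∧
      ∀ c, ¬ (Link b ℓ c p.1.1 p.1.2 ∧ Link b ℓ c q.1.1 q.1.2) := by
    rintro ⟨⟨v, u⟩, hvu, w, hw, h1, h2⟩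
    obtain ⟨u', hvu', hwu', hne⟩ := h.exists_twin hvu hw h1 h2
    refine ⟨⟨(v, u'), hvu', w, hw, h1, hwu'⟩, rfl, fun c hl => hne ?_⟩
    rw [hl.1.choice w hw h1 h2, hl.2.choice w hw h1 hwu']
  choose tw htw using key
  exact ⟨tw, htw⟩

theorem card_vtx {b : ℕ} {T : RootedTree} [Finite T] {ℓ : T → Word} (r : ℕ) :
    Nat.card (Vtx b ℓ r) = {v : T | ¬ IsReflect v}.ncard + ((slots b ℓ).ncard + r) := by
  rw [Nat.card_sum, Nat.card_sum, Nat.card_fin]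
  rfl

open MeasureTheory in
/-- If one of finitely many events always occurs, then one of them is at least as likely as the
average. -/
theorem exists_one_div_card_le {Ω κ : Type*} [MeasurableSpace Ω] (μ : Measure Ω)
    [IsProbabilityMeasure μ] [Finite κ] (S : κ → Set Ω) (hS : ∀ ω, ∃ k, ω ∈ S k) :
    ∃ k, 1 / (Nat.card κ : ℝ) ≤ μ.real (S k) := by
  have := Fintype.ofFinite κ
  have hU : (⋃ k, S k) = Set.univ := Set.eq_univ_of_forall fun ω => Set.mem_iUnion.2 (hS ω)
  by_contra! hn
  have h1 := measureReal_iUnion_fintype_le (μ := μ) S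
  rw [hU, probReal_univ] at h1
  have hne : (Finset.univ : Finset κ).Nonempty := by
    by_contra he
    rw [Finset.not_nonempty_iff_eq_empty] at he
    rw [he, Finset.sum_empty] at h1
    linarith
  have h2 := Finset.sum_lt_sum_of_nonempty hne fun k _ => hn k
  have h3 : (0 : ℝ) < Nat.card κ := by
    obtain ⟨k, -⟩ := hne
    have : Nonempty κ := ⟨k⟩
    exact_mod_cast Nat.card_pos
  rw [Finset.sum_const, Finset.card_univ, ← Nat.card_eq_fintype_card, nsmul_eq_mul,
    mul_one_div_cancel h3.ne'] at h2
  linarith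

end SinklessLB

theorem mainTheorem4 (D Δ : ℕ) (hD : 1 ≤ D) (hΔ : 3 ≤ Δ)
    (T : RootedTree) (ℓ : T → Word) (hT : IsConstructionTree Δ T ℓ)
    (o : List T) (ho : IsProcessingOrder o) (hcorrect : IsDistanceCorrect Δ ℓ o D)
    {Ω : Type*} [MeasurableSpace Ω] (μ : MeasureTheory.Measure Ω)
    [MeasureTheory.IsProbabilityMeasure μ]
    (A : RandomizedOnlineLocalAlgorithm Ω (D - 1))
    (n : ℕ) (hn : Δ * Nat.card (inputTree Δ ℓ o).V ≤ n) :
    ∃ (G : PortGraph n) (σ : List (Fin n)),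
      G.graph.IsTree ∧ σ.Nodup ∧ (∀ v, v ∈ σ) ∧
        1 / (Δ : ℝ) ^ (reflectNodes T).ncard ≤
          μ.real {ω | ¬ G.IsSinklessOrientation ((A.algo ω).output G σ)} := by
  classical
  obtain ⟨mate, h⟩ := hT.exists_layout
  have := h.finite
  have hfar := far_of_isDistanceCorrect h ho hcorrect
  obtain ⟨p0, hp0⟩ := h.slots_nonempty
  obtain ⟨tw, htw⟩ := exists_isTwin h
  have hcard := h.card_split_add_slots_le
  have hle := Nat.mul_le_mul_left Δ (ncard_split_le h ho)
  -- Split nodes and slots number at most Δ times the split nodes, which embed into the input tree;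
  -- the hypothesis on `n` leaves room for the `r` surplus vertices.
  obtain ⟨r, hr⟩ : ∃ r, n = {v : T | ¬ IsReflect v}.ncard + ((slots Δ ℓ).ncard + r) :=
    ⟨n - ({v : T | ¬ IsReflect v}.ncard + (slots Δ ℓ).ncard), by omega⟩
  have e : Vtx Δ ℓ r ≃ Fin n := Finite.equivFinOfCardEq (by rw [card_vtx, hr])
  -- Reversing the processing order puts descendants before their ancestors.
  set ws := (o.filter fun t => IsReflect t).reverse with hws
  have hnd : ws.Nodup := List.nodup_reverse.2 (ho.1.filter _)
  have hmem : ∀ w, w ∈ ws ↔ IsReflect w := fun w => by simp [hws, ho.2.1 w]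
  have hord : ws.Pairwise fun s t => ¬ s < t := List.pairwise_reverse.2 (ho.2.2.filter _)
  -- Choices away from reflect nodes are normalized to 1, so exactly Δ ^ |V_R| instances take part
  -- in the union bound; `Fin Δ` is shifted to start at 1.
  let ch : (reflectNodes T → Fin Δ) → T → ℕ := fun f w =>
    if hw : IsReflect w then (f ⟨w, hw⟩ : ℕ) + 1 else 1
  have hch : ∀ f w, ch f w ∈ Set.Icc 1 Δ := by
    intro f w
    by_cases hw : IsReflect w
    · have := (f ⟨w, hw⟩).2
      simp only [ch, dif_pos hw, Set.mem_Icc]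
      omega
    · simp only [ch, dif_neg hw, Set.mem_Icc]
      omega
  have hall : ∀ ω, ∃ f, ¬ (inst h htw ⟨p0, hp0⟩ e (ch f) (hch f)).IsSinklessOrientation
      ((A.algo ω).output (inst h htw ⟨p0, hp0⟩ e (ch f) (hch f))
        (querySeq mate ⟨p0, hp0⟩ e (ch f) ws)) := by
    intro ω
    obtain ⟨c, hc, hone, hfail⟩ := exists_failure h htw ⟨p0, hp0⟩ e hfar hnd hmem hord (A.algo ω)
    obtain ⟨f, rfl⟩ : ∃ f, c = ch f := by
      refine ⟨fun w => ⟨c w - 1, by have := hc w; simp only [Set.mem_Icc] at this; omega⟩, ?_⟩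
      funext w
      by_cases hw : IsReflect w
      · have := (hc w).1
        simp only [ch, dif_pos hw]
        omega
      · simp only [ch, dif_neg hw, hone w hw]
    exact ⟨f, hfail⟩
  obtain ⟨f, hf⟩ := exists_one_div_card_le μ (fun f => {ω |
    ¬ (inst h htw ⟨p0, hp0⟩ e (ch f) (hch f)).IsSinklessOrientation
      ((A.algo ω).output (inst h htw ⟨p0, hp0⟩ e (ch f) (hch f))
        (querySeq mate ⟨p0, hp0⟩ e (ch f) ws))}) hall
  refine ⟨inst h htw ⟨p0, hp0⟩ e (ch f) (hch f), querySeq mate ⟨p0, hp0⟩ e (ch f) ws, inst_isTree,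
    nodup_querySeq h (hch f) hnd fun w => (hmem w).1, mem_querySeq, le_trans (le_of_eq ?_) hf⟩
  rw [Nat.card_fun, Nat.card_fin, Nat.card_coe_set_eq, Nat.cast_pow]
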